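/- **Setting.** Let $d\in\{1,2,3\}$, $L_1,\dots,L_d>0$, $\lambda_0,\lambda_1,\lambda_2\in\mathbb R$, $p\in\{0,1\}$, $q=2p$, and let $N$ be a real polynomial with $N(0)=N'(0)=0$. Assume that $$u_t=(\lambda_0+\lambda_1\Delta+\lambda_2\Delta^2)u+\Delta^pN(u),\qquad u(0,\cdot)=u_0,\tag{1}$$ is parabolic and semilinear: $\lambda_2<0$, or $\lambda_2=0<\lambda_1$ and $p=0$. Solutions are sought with period $2\pi/L_j$ in $x_j$ and even in every coordinate, $u(t,x)=\sum_{k\in\mathbb N^d}\alpha_k a_k(t)\prod_j\cos(k_jL_jx_j)$, where $\alpha_k=2^{\#\{j:\,k_j\neq0\}}$. For $k\in\mathbb N^d$ put $(kL)^2=\sum_j(k_jL_j)^2$, $\mu_k=\lambda_0-\lambda_1(kL)^2+\lambda_2(kL)^4$ and $\omega_k=\alpha_k\nu^{k_1+\dots+k_d}$ with a fixed $\nu\ge1$. Let $\ell^1_\omega$ be the space of real sequences $a=(a_k)_{k\in\mathbb N^d}$ with $\|a\|_\omega=\sum_k|a_k|\omega_k<\infty$, a Banach algebra under the convolution $(a*b)_k=\sum_{k_1+k_2=k,\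 k_i\in\mathbb Z^d}a_{|k_1|}b_{|k_2|}$ (componentwise absolute values). Let $(\mathcal La)_k=\mu_ka_k$, with domain $D(\mathcal L)=\{a\in\ell^1_\omega:\mathcal La\in\ell^1_\omega\}$ carrying the graph norm, let $(\mathcal Qa)_k=\mathrm i^q(kL)^qa_k$, and let $\mathcal N:\ell^1_\omega\to\ell^1_\omega$ be the polynomial $N$ evaluated with convolution powers; $D\mathcal N$ is its Fréchet derivative. Let $K\ge1$, $0=t_0<t_1<\dots<t_K$, $J_i=(t_{i-1},t_i]$, $\tau_i=t_i-t_{i-1}$. Let $X_i=C([t_{i-1},t_i];\ell^1_\omega)$ with the sup norm, $\boldsymbol X=\prod_{i=1}^KX_i$ with the maximum norm, $\mathcal D_i=X_i\cap C(J_i;D(\mathcal L))\cap C^1((t_{i-1},t_i);\ell^1_\omega)$ and $\boldsymbol{\mathcal D}=\prod_i\mathcal D_i$. Fix $\varphi\in\ell^1_\omega$. For $\boldsymbol a=(a^{J_1},\dots,a^{J_K})\in\boldsymbol{\mathcal D}$ let $F(\boldsymbol a)=(F_1,\dots,F_K)$, where $$(F_i)_1=\dot a^{J_i}-\mathcal La^{J_i}-\mathcal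 Q\,\mathcal N(a^{J_i})\ \text{ on }(t_{i-1},t_i),\qquad (F_1)_2=a^{J_1}(t_0)-\varphi,\qquad (F_i)_2=a^{J_i}(t_{i-1})-a^{J_{i-1}}(t_{i-1})\ \ (i\ge2).$$ Let $\bar{\boldsymbol a}\in\boldsymbol{\mathcal D}$. For $t_{i-1}\le s<t\le t_i$ let $U_{J_i}(t,s)\phi=b(t)$, where $b$ is the solution of $\dot b=\mathcal Lb+\mathcal Q\,D\mathcal N(\bar a^{J_i}(t))\,b$ on $(s,t_i]$ with $b(s)=\phi$; here $\phi\in\ell^1_\omega$ or $\phi=\mathcal Q\psi$ with $\psi\in\ell^1_\omega$, and a solution is a continuous, integrable function $(s,t_i]\to\ell^1_\omega$ whose coefficients satisfy the corresponding system of ODEs on $(s,t_i)$ and tend to those of $\phi$ as $t\downarrow s$. Let $\gamma\in[0,1)$ and let $W^{\mathcal S_{J_i}},W_q^{\mathcal S_{J_i}},W^{(t_i,J_i)},W_q^{(t_i,J_i)},W^{(t_i,t_{i-1})}>0$ $(i=1,\dots,K)$ be constants with, in the operator norm of $\ell^1_\omega$, $$\|U_{J_i}(t,s)\|\le W^{\mathcal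 S_{J_i}},\quad (t-s)^\gamma\|U_{J_i}(t,s)\mathcal Q\|\le W_q^{\mathcal S_{J_i}}\qquad(t_{i-1}<s<t\le t_i),$$ $$\|U_{J_i}(t_i,s)\|\le W^{(t_i,J_i)}\ \ (t_{i-1}<s<t_i),\qquad (t_i-s)^\gamma\|U_{J_i}(t_i,s)\mathcal Q\|\le W_q^{(t_i,J_i)}\ \ (t_{i-1}\le s<t_i),\qquad \|U_{J_i}(t_i,t_{i-1})\|\le W^{(t_i,t_{i-1})}.$$ Put $\hat\tau_i=\tau_i^{1-\gamma}/(1-\gamma)$ and $W^{(t_i,t_j)}=W^{(t_i,t_{i-1})}\cdots W^{(t_{j+1},t_j)}$ for $j<i$, $W^{(t_i,t_i)}=1$. Let $\boldsymbol W_\ell,\boldsymbol W_X,\boldsymbol W_Y$ be the matrix infinity norms (maximal absolute row sums) of the lower triangular $K\times K$ matrices whose diagonal entries are $W^{\mathcal S_{J_i}}$, $\hat\tau_iW_q^{\mathcal S_{J_i}}$, $\tau_iW^{\mathcal S_{J_i}}$, respectively, and whose entries at $(i,j)$, $j<i$, are $$W^{\mathcal S_{J_i}}W^{(t_{i-1},t_{j-1})},\qquad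 \hat\tau_jW^{\mathcal S_{J_i}}W^{(t_{i-1},t_j)}W_q^{(t_j,J_j)},\qquad \tau_jW^{\mathcal S_{J_i}}W^{(t_{i-1},t_j)}W^{(t_j,J_j)},$$ respectively. **Theorem (local existence over multiple time steps).** Assume that for every $i$ the defects satisfy $\|(F_i(\bar{\boldsymbol a}))_1(t)\|_\omega\le\delta^{J_i}$ for all $t\in(t_{i-1},t_i)$ and $\|(F_i(\bar{\boldsymbol a}))_2\|_\omega\le\varepsilon^{J_i}$, and that there are non-decreasing functions $L_{\bar a^{J_i}}:(0,\infty)\to(0,\infty)$ such that for all $\varrho>0$ and all $a_1,a_2\in X_i$ with $\|a_1-\bar a^{J_i}\|_{X_i},\|a_2-\bar a^{J_i}\|_{X_i}\le\varrho$, $$\|\mathcal N(a_1)-\mathcal N(a_2)-D\mathcal N(\bar a^{J_i})(a_1-a_2)\|_{X_i}\le L_{\bar a^{J_i}}(\varrho)\,\|a_1-a_2\|_{X_i}.$$ Let $\boldsymbol\delta=\max_i\delta^{J_i}$, $\boldsymbol\varepsilon=\max_i\varepsilon^{J_i}$. If some $\boldsymbol\varrho_0>0$ satisfies $$\boldsymbol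 W_\ell\,\boldsymbol\varepsilon+\boldsymbol W_X\max_i\{L_{\bar a^{J_i}}(\boldsymbol\varrho_0)\}\,\boldsymbol\varrho_0+\boldsymbol W_Y\,\boldsymbol\delta\le\boldsymbol\varrho_0,$$ then there is exactly one $\tilde{\boldsymbol a}\in\boldsymbol{\mathcal D}$ with $\|\tilde{\boldsymbol a}-\bar{\boldsymbol a}\|_{\boldsymbol X}\le\boldsymbol\varrho_0$ and $F(\tilde{\boldsymbol a})=0$. Moreover, the function $u(t,x)=\sum_k\alpha_k\tilde a^{J_i}_k(t)\prod_j\cos(k_jL_jx_j)$ for $t\in[t_{i-1},t_i]$ is well defined and is a classical solution of (1) on $[0,t_K]$ with $u_0(x)=\sum_k\alpha_k\varphi_k\prod_j\cos(k_jL_jx_j)$: it is continuous on $[0,t_K]\times\mathbb R^d$, has the stated periods and symmetry, and for $t\in(0,t_K]$ it is $C^4$ in $x$ ($C^2$ if $\lambda_2=0$) and satisfies (1) pointwise (with one-sided time derivative at $t_K$). -/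

import Mathlib

open Set Filter Topology Polynomial

/-- The data of the equation `u_t = (lam0 + lam1 Δ + lam2 Δ²) u + Δ^p N(u)` on the `d`-dimensional
box with side lengths `2π / L j`, periodic boundary conditions and even symmetry, together with
the geometric rate `nu` of the weights. The equation is parabolic, and semilinear: the order of the
Laplacian in front of `N` is less than that of the linear part. -/
structure PDEData (d : ℕ) where
  L : Fin d → ℝ
  L_pos : ∀ j, 0 < L j
  lam0 : ℝ
  lam1 : ℝ
  lam2 : ℝ
  p : ℕ
  p_le : p ≤ 1
  parabolic_semilinear : lam2 < 0 ∨ (lam2 = 0 ∧ 0 < lam1 ∧ p = 0)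
  N : ℝ[X]
  N_zero : N.eval 0 = 0
  N_deriv_zero : N.derivative.eval 0 = 0
  nu : ℝ
  one_le_nu : 1 ≤ nu

noncomputable section

namespace PDEData

variable {d : ℕ}

/-- `α_k`: the number of sign patterns of `k`, i.e. `2` to the number of nonzero entries of `k`. -/
def alpha (k : Fin d → ℕ) : ℝ := ∏ j, if k j = 0 then 1 else 2

/-- `(k L)² = ∑ (k_j L_j)²`. -/
def kLsq (P : PDEData d) (k : Fin d → ℕ) : ℝ := ∑ j, ((k j : ℝ) * P.L j) ^ 2

/-- The eigenvalues `μ_k = λ₀ - λ₁ (kL)² + λ₂ (kL)⁴` of the linear part. -/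
def mu (P : PDEData d) (k : Fin d → ℕ) : ℝ :=
  P.lam0 - P.lam1 * P.kLsq k + P.lam2 * P.kLsq k ^ 2

/-- The symbol `i^q (kL)^q`, `q = 2p`, of `Δ^p`. -/
def qsym (P : PDEData d) (k : Fin d → ℕ) : ℝ := (-1) ^ P.p * P.kLsq k ^ P.p

/-- The weight `ω_k = α_k ν^(k_1 + ⋯ + k_d)`. -/
def omega (P : PDEData d) (k : Fin d → ℕ) : ℝ := alpha k * P.nu ^ (∑ j, k j)

lemma alpha_pos (k : Fin d → ℕ) : 0 < alpha k :=
  Finset.prod_pos fun j _ => by split_ifs <;> norm_num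

lemma alpha_le (k : Fin d → ℕ) : alpha k ≤ 2 ^ d := by
  unfold alpha
  calc _ ≤ ∏ _j : Fin d, (2 : ℝ) := Finset.prod_le_prod
        (fun j _ => by split_ifs <;> norm_num) (fun j _ => by split_ifs <;> norm_num)
    _ = 2 ^ d := by simp

lemma one_le_alpha (k : Fin d → ℕ) : 1 ≤ alpha k := by
  unfold alpha
  calc (1 : ℝ) = ∏ _j : Fin d, (1 : ℝ) := by simp
    _ ≤ _ := Finset.prod_le_prod (fun j _ => by norm_num)
        (fun j _ => by split_ifs <;> norm_num)

lemma nu_pos (P : PDEData d) : 0 < P.nu := lt_of_lt_of_le one_pos P.one_le_nu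

lemma omega_pos (P : PDEData d) (k : Fin d → ℕ) : 0 < P.omega k :=
  mul_pos (alpha_pos k) (pow_pos P.nu_pos _)

/-- The sequences `a = (a_k)_{k ≥ 0}` with `∑ |a_k| ω_k < ∞`, as a linear subspace. -/
def ellSubmodule (P : PDEData d) : Submodule ℝ ((Fin d → ℕ) → ℝ) where
  carrier := {a | Summable fun k => |a k| * P.omega k}
  zero_mem' := by simp [summable_zero]
  add_mem' {a b} ha hb := by
    refine Summable.of_nonneg_of_le
      (fun k => mul_nonneg (abs_nonneg _) (P.omega_pos k).le) (fun k => ?_) (ha.add hb)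
    rw [← add_mul]
    exact mul_le_mul_of_nonneg_right (abs_add_le _ _) (P.omega_pos k).le
  smul_mem' c a ha := by
    have := Summable.mul_left |c| ha
    simpa [abs_mul, mul_assoc] using this

/-- The space `ℓ¹_ω`; its topology is that of the norm `‖a‖_ω = ∑ |a_k| ω_k`. -/
def Ell (P : PDEData d) : Type := P.ellSubmodule

instance (P : PDEData d) : AddCommGroup P.Ell := inferInstanceAs (AddCommGroup P.ellSubmodule)
instance (P : PDEData d) : Module ℝ P.Ell := inferInstanceAs (Module ℝ P.ellSubmodule)
instance (P : PDEData d) : CoeFun P.Ell (fun _ => (Fin d → ℕ) → ℝ) := ⟨fun a => a.1⟩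

/-- `‖a‖_ω = ∑ |a_k| ω_k`. -/
def normOmega (P : PDEData d) (a : (Fin d → ℕ) → ℝ) : ℝ := ∑' k, |a k| * P.omega k

lemma Ell.summable {P : PDEData d} (a : P.Ell) : Summable fun k => |a k| * P.omega k := a.2

lemma term_nonneg (P : PDEData d) (a : (Fin d → ℕ) → ℝ) (k : Fin d → ℕ) :
    0 ≤ |a k| * P.omega k := mul_nonneg (abs_nonneg _) (P.omega_pos k).le

instance (P : PDEData d) : NormedAddCommGroup P.Ell :=
  AddGroupNorm.toNormedAddCommGroup
    { toFun := fun a => P.normOmega a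
      map_zero' := by
        change ∑' k, |(0 : ℝ)| * P.omega k = 0
        simp
      add_le' := fun a b => by
        change ∑' k, |a k + b k| * P.omega k ≤ ∑' k, |a k| * P.omega k + ∑' k, |b k| * P.omega k
        rw [← Summable.tsum_add a.summable b.summable]
        refine Summable.tsum_le_tsum (fun k => ?_) (a + b).summable (a.summable.add b.summable)
        rw [← add_mul]
        exact mul_le_mul_of_nonneg_right (abs_add_le _ _) (P.omega_pos k).le
      neg' := fun a => by
        change ∑' k, |-a k| * P.omega k = ∑' k, |a k| * P.omega k
        simp
      eq_zero_of_map_eq_zero' := fun a ha => by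
        have h := (hasSum_zero_iff_of_nonneg (P.term_nonneg a)).1
          ((show ∑' k, |a k| * P.omega k = 0 from ha) ▸ a.summable.hasSum)
        refine Subtype.ext (funext fun k => ?_)
        have hk := congrFun h k
        change a k = 0
        simpa [(P.omega_pos k).ne'] using hk }

lemma Ell.norm_def {P : PDEData d} (a : P.Ell) : ‖a‖ = ∑' k, |a k| * P.omega k := rfl

instance (P : PDEData d) : NormedSpace ℝ P.Ell where
  norm_smul_le c a := by
    change ∑' k, |c * a k| * P.omega k ≤ ‖c‖ * ∑' k, |a k| * P.omega k
    rw [← tsum_mul_left]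
    simp [abs_mul, mul_assoc]

/-- The discrete convolution `(a * b)_k = ∑_{k₁ + k₂ = k} a_{|k₁|} b_{|k₂|}`, the sum running over
`k₁, k₂ ∈ ℤ^d`; here `k₁ = m` and `k₂ = k - m`. -/
def conv (a b : (Fin d → ℕ) → ℝ) (k : Fin d → ℕ) : ℝ :=
  ∑' m : Fin d → ℤ, a (fun j => (m j).natAbs) * b (fun j => ((k j : ℤ) - m j).natAbs)

lemma summable_int {P : PDEData d} (a : P.Ell) :
    Summable fun m : Fin d → ℤ =>
      |a (fun j => (m j).natAbs)| * P.nu ^ (∑ j, (m j).natAbs) := by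
  have h1 : Summable fun k : Fin d → ℕ => |a k| * P.nu ^ (∑ j, k j) := by
    refine Summable.of_nonneg_of_le
      (fun k => mul_nonneg (abs_nonneg _) (pow_pos P.nu_pos _).le) (fun k => ?_) a.summable
    refine mul_le_mul_of_nonneg_left ?_ (abs_nonneg _)
    exact le_mul_of_one_le_left (pow_pos P.nu_pos _).le (one_le_alpha k)
  have h2 : Summable fun x : (Fin d → ℕ) × (Fin d → Bool) =>
      (|a x.1| * P.nu ^ (∑ j, x.1 j)) * 1 :=
    Summable.mul_of_nonneg h1 (g := fun _ : Fin d → Bool => (1 : ℝ)) (Summable.of_finite)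
      (fun k => mul_nonneg (abs_nonneg _) (pow_pos P.nu_pos _).le) (fun _ => zero_le_one)
  have hinj : Function.Injective fun m : Fin d → ℤ =>
      ((fun j => (m j).natAbs, fun j => decide (m j < 0)) : (Fin d → ℕ) × (Fin d → Bool)) := by
    intro m n h
    simp only [Prod.mk.injEq] at h
    funext j
    have e1 := congrFun h.1 j
    have e2 := congrFun h.2 j
    simp only [decide_eq_decide] at e2
    omega
  simpa [Function.comp_def] using h2.comp_injective hinj

lemma conv_mem {P : PDEData d} (a b : P.Ell) : conv a b ∈ P.ellSubmodule := by
  obtain ⟨A, hA⟩ : ∃ A : (Fin d → ℤ) → ℝ, A = fun m =>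
    |a (fun j => (m j).natAbs)| * P.nu ^ (∑ j, (m j).natAbs) := ⟨_, rfl⟩
  obtain ⟨B, hB⟩ : ∃ B : (Fin d → ℤ) → ℝ, B = fun m =>
    |b (fun j => (m j).natAbs)| * P.nu ^ (∑ j, (m j).natAbs) := ⟨_, rfl⟩
  have hAs : Summable A := hA ▸ summable_int a
  have hBs : Summable B := hB ▸ summable_int b
  have hA0 : 0 ≤ A := fun m => by
    rw [hA]; exact mul_nonneg (abs_nonneg _) (pow_pos P.nu_pos _).le
  have hB0 : 0 ≤ B := fun m => by
    rw [hB]; exact mul_nonneg (abs_nonneg _) (pow_pos P.nu_pos _).le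
  have hinj : Function.Injective fun x : (Fin d → ℕ) × (Fin d → ℤ) =>
      ((x.2, fun j => (x.1 j : ℤ) - x.2 j) : (Fin d → ℤ) × (Fin d → ℤ)) := by
    rintro ⟨k, m⟩ ⟨k', m'⟩ h
    simp only [Prod.mk.injEq] at h
    obtain ⟨rfl, h2⟩ := h
    refine Prod.ext (funext fun j => ?_) rfl
    have h3 : (k j : ℤ) - m j = (k' j : ℤ) - m j := congrFun h2 j
    change k j = k' j
    omega
  have hC : Summable fun x : (Fin d → ℕ) × (Fin d → ℤ) =>
      A x.2 * B (fun j => (x.1 j : ℤ) - x.2 j) :=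
    (hAs.mul_of_nonneg hBs hA0 hB0).comp_injective hinj
  have hD : Summable fun k : Fin d → ℕ => ∑' m : Fin d → ℤ,
      A m * B (fun j => (k j : ℤ) - m j) := hC.prod
  have key : ∀ k : Fin d → ℕ, |conv a b k| * P.omega k ≤
      2 ^ d * ∑' m : Fin d → ℤ, A m * B (fun j => (k j : ℤ) - m j) := by
    intro k
    have hCk : Summable fun m : Fin d → ℤ => A m * B (fun j => (k j : ℤ) - m j) :=
      hC.prod_factor k
    have hpow : 0 < P.nu ^ (∑ j, k j) := pow_pos P.nu_pos _
    obtain ⟨f, hf⟩ : ∃ f : (Fin d → ℤ) → ℝ, f = fun m =>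
      a (fun j => (m j).natAbs) * b (fun j => ((k j : ℤ) - m j).natAbs) := ⟨_, rfl⟩
    have hconv : conv a b k = ∑' m, f m := by rw [hf]; rfl
    have hpt : ∀ m, |f m| * P.nu ^ (∑ j, k j) ≤ A m * B (fun j => (k j : ℤ) - m j) := by
      intro m
      have hnu : P.nu ^ (∑ j, k j) ≤
          P.nu ^ (∑ j, (m j).natAbs) * P.nu ^ (∑ j, ((k j : ℤ) - m j).natAbs) := by
        rw [← pow_add, ← Finset.sum_add_distrib]
        exact pow_le_pow_right₀ P.one_le_nu (Finset.sum_le_sum fun j _ => by omega)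
      rw [hf, hA, hB, abs_mul]
      refine (mul_le_mul_of_nonneg_left hnu
        (mul_nonneg (abs_nonneg _) (abs_nonneg _))).trans (le_of_eq ?_)
      ring
    have hE : Summable fun m => |f m| * P.nu ^ (∑ j, k j) :=
      Summable.of_nonneg_of_le (fun m => mul_nonneg (abs_nonneg _) hpow.le) hpt hCk
    have hF : Summable fun m => ‖f m‖ := (summable_mul_right_iff hpow.ne').1 hE
    have h1 : |∑' m, f m| ≤ ∑' m, |f m| := norm_tsum_le_tsum_norm hF
    have h2 : (∑' m, |f m|) * P.nu ^ (∑ j, k j) ≤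
        ∑' m : Fin d → ℤ, A m * B (fun j => (k j : ℤ) - m j) := by
      rw [← tsum_mul_right]
      exact hE.tsum_le_tsum hpt hCk
    have h3 : |conv a b k| * P.nu ^ (∑ j, k j) ≤
        ∑' m : Fin d → ℤ, A m * B (fun j => (k j : ℤ) - m j) := by
      rw [hconv]
      exact (mul_le_mul_of_nonneg_right h1 hpow.le).trans h2
    have h4 : |conv a b k| * P.omega k = alpha k * (|conv a b k| * P.nu ^ (∑ j, k j)) := by
      unfold omega; ring
    rw [h4]
    exact mul_le_mul (alpha_le k) h3 (mul_nonneg (abs_nonneg _) hpow.le) (pow_pos two_pos d).le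
  exact Summable.of_nonneg_of_le (P.term_nonneg _) key (hD.mul_left (2 ^ d))

/-- The discrete convolution as a product on `ℓ¹_ω`. -/
def Ell.mul {P : PDEData d} (a b : P.Ell) : P.Ell := ⟨conv a b, conv_mem a b⟩

/-- The unit of the convolution: `1` at `k = 0` and `0` elsewhere. -/
def Ell.one (P : PDEData d) : P.Ell :=
  ⟨fun k => if k = 0 then 1 else 0,
    summable_of_ne_finset_zero (s := {0}) (fun k hk => by
      simp only [Finset.mem_singleton] at hk
      simp [hk])⟩

/-- Convolution powers. -/
def Ell.pow {P : PDEData d} (a : P.Ell) : ℕ → P.Ell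
  | 0 => Ell.one P
  | n + 1 => Ell.mul (Ell.pow a n) a

/-- The nonlinear operator `𝒩 : ℓ¹_ω → ℓ¹_ω`: the polynomial `N` evaluated with convolution
powers, i.e. the Fourier coefficients of `N(u)`. -/
def nonlin (P : PDEData d) (a : P.Ell) : P.Ell :=
  ∑ n ∈ P.N.support, P.N.coeff n • Ell.pow a n

/-- The Fréchet derivative `D𝒩(ψ) φ`. -/
def Dnonlin (P : PDEData d) (psi phi : P.Ell) : P.Ell := fderiv ℝ P.nonlin psi phi

/-- The multiplication operator `(𝒬 φ)_k = i^q (kL)^q φ_k`, on all sequences. -/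
def Q (P : PDEData d) (phi : (Fin d → ℕ) → ℝ) : (Fin d → ℕ) → ℝ := fun k => P.qsym k * phi k

/-- The multiplication operator `(ℒ φ)_k = μ_k φ_k`, on all sequences. -/
def Lop (P : PDEData d) (phi : (Fin d → ℕ) → ℝ) : (Fin d → ℕ) → ℝ := fun k => P.mu k * phi k

/-- The extension by zero of a function on `[t0, t1]` to the real line. -/
def extZero {P : PDEData d} {t0 t1 : ℝ} (a : C(Icc t0 t1, P.Ell)) (t : ℝ) : P.Ell :=
  if h : t ∈ Icc t0 t1 then a ⟨t, h⟩ else 0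

/-- The space `𝒟 = C((t0, t1]; D(ℒ)) ∩ C¹((t0, t1); ℓ¹_ω) ∩ C([t0, t1]; ℓ¹_ω)`, where `D(ℒ)` is the
set of `φ ∈ ℓ¹_ω` with `ℒ φ ∈ ℓ¹_ω` and carries the graph norm. -/
structure InDomain {P : PDEData d} {t0 t1 : ℝ} (a : C(Icc t0 t1, P.Ell)) : Prop where
  cont_domL : ∃ w : ℝ → P.Ell, ContinuousOn w (Ioc t0 t1) ∧
    ∀ t ∈ Ioc t0 t1, ∀ k, w t k = P.Lop (extZero a t) k
  c1 : ContDiffOn ℝ 1 (extZero a) (Ioo t0 t1)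

/-- `b` solves the linearized problem `b' = ℒ b + 𝒬 D𝒩(a(t)) b` on `(s, t1]` with `b(s) = φ`: `b` is
continuous and integrable on `(s, t1]` with values in `ℓ¹_ω`, satisfies the system of differential
equations for its coefficients, and its coefficients tend to those of `φ` as `t ↓ s`. The datum `φ`
need not belong to `ℓ¹_ω`. -/
structure IsLinearizedSolution {P : PDEData d} {t0 t1 : ℝ} (a : C(Icc t0 t1, P.Ell)) (s : ℝ)
    (phi : (Fin d → ℕ) → ℝ) (b : ℝ → P.Ell) : Prop where
  cont : ContinuousOn b (Ioc s t1)
  integrable : MeasureTheory.IntegrableOn (fun t => ‖b t‖) (Ioc s t1) MeasureTheory.volume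
  ode : ∀ t ∈ Ioo s t1, ∀ k, HasDerivAt (fun r => b r k)
    (P.Lop (b t) k + P.Q (P.Dnonlin (extZero a t) (b t)) k) t
  init : ∀ k, Tendsto (fun t => b t k) (𝓝[>] s) (𝓝 (phi k))

open Classical in
/-- The evolution operator `U(t, s) φ = b(t)`, `t0 ≤ s < t ≤ t1`, where `b` is the solution of the
problem linearized about `a` on `(s, t1]` with `b(s) = φ`. -/
def evol {P : PDEData d} {t0 t1 : ℝ} (a : C(Icc t0 t1, P.Ell)) (t s : ℝ)
    (phi : (Fin d → ℕ) → ℝ) : P.Ell :=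
  if h : ∃ b, IsLinearizedSolution a s phi b then h.choose t else 0

/-! ### Several time steps

The times are `t 0 < t 1 < ⋯ < t K`; step `i : Fin K` is the interval from `t i.castSucc` to
`t i.succ`. -/

/-- The space `∏ i, C([t_{i-1}, t_i]; ℓ¹_ω)`; its norm is the maximum of the sup norms. -/
abbrev StepSpace (P : PDEData d) {K : ℕ} (t : Fin (K + 1) → ℝ) : Type :=
  (i : Fin K) → C(Icc (t i.castSucc) (t i.succ), P.Ell)

/-- First component `ȧ - ℒ a - 𝒬 𝒩(a)` of step `i` of the map `F`, at time `r`. -/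
def F1 {P : PDEData d} {K : ℕ} {t : Fin (K + 1) → ℝ} (a : P.StepSpace t) (i : Fin K) (r : ℝ) :
    (Fin d → ℕ) → ℝ := fun k =>
  deriv (extZero (a i)) r k - P.Lop (extZero (a i) r) k - P.Q (P.nonlin (extZero (a i) r)) k

/-- Second component of step `i` of the map `F`: the jump at the left end point of the step, where
the first step is compared with the initial datum `φ`. -/
def F2 {P : PDEData d} {K : ℕ} {t : Fin (K + 1) → ℝ} (phi : P.Ell) (a : P.StepSpace t)
    (i : Fin K) : P.Ell :=
  extZero (a i) (t i.castSucc) -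
    if i.val = 0 then phi
    else extZero (a ⟨i.val - 1, lt_of_le_of_lt (Nat.sub_le _ _) i.isLt⟩) (t i.castSucc)

/-- `a` belongs to the domain `∏ 𝒟_i` of `F` and `F(a) = 0`. -/
def IsZeroOfF {P : PDEData d} {K : ℕ} {t : Fin (K + 1) → ℝ} (phi : P.Ell) (a : P.StepSpace t) :
    Prop :=
  (∀ i, InDomain (a i)) ∧
  (∀ i, ∀ r ∈ Ioo (t i.castSucc) (t i.succ), F1 a i r = 0) ∧
  (∀ i, F2 phi a i = 0)

/-- The step size `τ_i`. -/
def tau {K : ℕ} (t : Fin (K + 1) → ℝ) (i : Fin K) : ℝ := t i.succ - t i.castSucc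

/-- `τ̂_i = τ_i^(1-γ) / (1-γ)`. -/
def tauHat {K : ℕ} (t : Fin (K + 1) → ℝ) (gam : ℝ) (i : Fin K) : ℝ :=
  tau t i ^ (1 - gam) / (1 - gam)

/-- The positive constants of the steps bound the evolution operators `U_i` of the problems
linearized about `a i`: `WS` and `WSq` bound `U_i(r, s)` and `(r - s)^γ U_i(r, s) 𝒬` on
`t_{i-1} < s < r ≤ t_i`, `WE` and `WEq` bound `U_i(t_i, s)` and `(t_i - s)^γ U_i(t_i, s) 𝒬`, and `WT`
bounds `U_i(t_i, t_{i-1})`. -/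
structure EvolutionBounds {P : PDEData d} {K : ℕ} {t : Fin (K + 1) → ℝ} (a : P.StepSpace t)
    (gam : ℝ) (WS WSq WE WEq WT : Fin K → ℝ) : Prop where
  pos : ∀ i, 0 < WS i ∧ 0 < WSq i ∧ 0 < WE i ∧ 0 < WEq i ∧ 0 < WT i
  simplex : ∀ i s r, t i.castSucc < s → s < r → r ≤ t i.succ → ∀ phi : P.Ell,
    ‖evol (a i) r s phi‖ ≤ WS i * ‖phi‖
  simplex_q : ∀ i s r, t i.castSucc < s → s < r → r ≤ t i.succ → ∀ psi : P.Ell,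
    (r - s) ^ gam * ‖evol (a i) r s (P.Q psi)‖ ≤ WSq i * ‖psi‖
  endpoint : ∀ i s, t i.castSucc < s → s < t i.succ → ∀ phi : P.Ell,
    ‖evol (a i) (t i.succ) s phi‖ ≤ WE i * ‖phi‖
  endpoint_q : ∀ i s, t i.castSucc ≤ s → s < t i.succ → ∀ psi : P.Ell,
    (t i.succ - s) ^ gam * ‖evol (a i) (t i.succ) s (P.Q psi)‖ ≤ WEq i * ‖psi‖
  transfer : ∀ i, ∀ phi : P.Ell,
    ‖evol (a i) (t i.succ) (t i.castSucc) phi‖ ≤ WT i * ‖phi‖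

/-- The matrix infinity norm (maximal absolute row sum). -/
def matInfNorm {K : ℕ} (M : Matrix (Fin K) (Fin K) ℝ) : ℝ :=
  letI := Matrix.linftyOpNormedAddCommGroup (m := Fin K) (n := Fin K) (α := ℝ)
  ‖M‖

/-- `W_ℓ`. The product over `j ≤ l < i` is `W^{(t_{i-1}, t_{j-1})}`. -/
def Wl {K : ℕ} (WS WT : Fin K → ℝ) : ℝ :=
  matInfNorm (Matrix.of fun i j =>
    if j < i then WS i * ∏ l ∈ Finset.Ico j i, WT l
    else if j = i then WS i else 0)

/-- `W_X`. The product over `j < l < i` is `W^{(t_{i-1}, t_j)}`. -/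
def WX {K : ℕ} (t : Fin (K + 1) → ℝ) (gam : ℝ) (WS WSq WEq WT : Fin K → ℝ) : ℝ :=
  matInfNorm (Matrix.of fun i j =>
    if j < i then tauHat t gam j * WS i * (∏ l ∈ Finset.Ioo j i, WT l) * WEq j
    else if j = i then tauHat t gam i * WSq i else 0)

/-- `W_Y`. -/
def WY {K : ℕ} (t : Fin (K + 1) → ℝ) (WS WE WT : Fin K → ℝ) : ℝ :=
  matInfNorm (Matrix.of fun i j =>
    if j < i then tau t j * WS i * (∏ l ∈ Finset.Ioo j i, WT l) * WE j
    else if j = i then tau t i * WS i else 0)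

/-! ### The initial value problem for the PDE -/

/-- The cosine series `∑_{k ≥ 0} α_k a_k cos(k_1 L_1 x_1) ⋯ cos(k_d L_d x_d)`. -/
def cosSeries (P : PDEData d) (a : P.Ell) (x : EuclideanSpace ℝ (Fin d)) : ℝ :=
  ∑' k : Fin d → ℕ, alpha k * a k * ∏ j, Real.cos (k j * P.L j * x j)

/-- `u` is a classical solution on `[0, T]` of
`u_t = (lam0 + lam1 Δ + lam2 Δ²) u + Δ^p N(u)`, `u(0, ·) = u0`, periodic with the periods
`2π / L j` and even in every coordinate. At `t = T` the time derivative is one-sided. -/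
structure IsClassicalSolution (P : PDEData d) (u0 : EuclideanSpace ℝ (Fin d) → ℝ) (T : ℝ)
    (u : ℝ → EuclideanSpace ℝ (Fin d) → ℝ) : Prop where
  cont : ContinuousOn (Function.uncurry u) (Icc 0 T ×ˢ univ)
  init : u 0 = u0
  periodic : ∀ t ∈ Icc 0 T, ∀ x j,
    u t (x + EuclideanSpace.single j (2 * Real.pi / P.L j)) = u t x
  even : ∀ t ∈ Icc 0 T, ∀ x y : EuclideanSpace ℝ (Fin d), (∀ j, |x j| = |y j|) → u t x = u t y
  smooth : ∀ t ∈ Ioc 0 T, ContDiff ℝ (if P.lam2 = 0 then 2 else 4) (u t)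
  pde : ∀ t ∈ Ioc 0 T, ∀ x, HasDerivWithinAt (fun s => u s x)
    (P.lam0 * u t x + P.lam1 * Laplacian.laplacian (u t) x
      + P.lam2 * Laplacian.laplacian (Laplacian.laplacian (u t)) x
      + (Laplacian.laplacian^[P.p] fun y => P.N.eval (u t y)) x) (Icc 0 T) t

end PDEData

end

noncomputable section
namespace PDEData

variable {d : ℕ} {P : PDEData d}

/-! ### The space `ℓ¹_ω` -/

/-! The linear part is diagonal, and 𝒬 has at most half its order, so e^{tℒ}𝒬 is bounded by a
multiple of t^(-1/2) (`HalfOrder.exists_norm_heat_le`). Linear and globally Lipschitz problems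
therefore become Volterra equations with an integrable singularity (t - r)^(-1/2), solved by
contraction in an exponentially weighted norm (`VolterraKernel.exists_solution`,
`VolterraKernel.unique`). For a fixed final time t the operators V(s) = U(t, s)𝒬 solve such an
equation backwards in s (`exists_isResolvent`). Fubini then gives the variation of constants formula
(`IsResolvent.duhamel`), which also shows that linearized solutions are unique. Hence the chosen
values `evol` are the operators in that formula (`evol_eq_resolventOp`), and the assumed bounds W
can be inserted into it.

The nonlinear problem is not solved by contraction in the ball: the radius condition gives W_X L(ρ₀)
≤ 1, but not a strict inequality. Instead the remainder of 𝒩 at ā is composed with the radial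
retraction onto the ball of radius ρ₀ (`trunc`). The truncated equation is globally Lipschitz, so on
each step it has exactly one mild solution for every initial value (`LipBound.exists_isTruncSol`,
`IsTruncSol.unique`). Its remainder never exceeds L(ρ₀)ρ₀, wherever the solution goes, so Duhamel's
formula for v - ā bounds the error by the initial error, L(ρ₀)ρ₀ and the defect
(`IsTruncSol.norm_sub_le`). Unrolling this over the steps (`le_of_forall_step_le`) produces the row
sums of the three matrices, and the radius condition says that the error is at most ρ₀
(`norm_sub_le_of_isTruncSol`). There the truncation is inactive, which gives existence. Conversely,
every zero of F in the ball solves the truncated equations, which gives uniqueness.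

Regularity is a bootstrap in the norms with weights ω_k (1 + |k|)^n. They are algebra norms
(`wsum_conv_le`), and one more power of the weight costs only the integrable singularity (t -
r)^(-3/4) (`IsCoeffSol.exists_wsum_le`). After the initial time the coefficients thus decay faster
than any power, which yields membership in the domain (`IsCoeffSol.inDomain`). The steps are glued
to one solution (`IsZeroOfF.exists_isCoeffSol`). Its cosine series, read as an absolutely convergent
Fourier series over ℤ^d, turns convolution into multiplication and may be differentiated term by
term (`cosSeries_mul`, `laplacian_cosSeries`). -/

lemma Ell.ext {a b : P.Ell} (h : ∀ k, a k = b k) : a = b := Subtype.ext (funext h)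

lemma one_le_omega (P : PDEData d) (k : Fin d → ℕ) : 1 ≤ P.omega k :=
  one_le_mul_of_one_le_of_one_le (one_le_alpha k) (one_le_pow₀ P.one_le_nu)

lemma Ell.abs_mul_omega_le (a : P.Ell) (k : Fin d → ℕ) : |a k| * P.omega k ≤ ‖a‖ :=
  a.summable.le_tsum k fun j _ => P.term_nonneg a j

lemma Ell.abs_le_norm (a : P.Ell) (k : Fin d → ℕ) : |a k| ≤ ‖a‖ :=
  (le_mul_of_one_le_right (abs_nonneg _) (P.one_le_omega k)).trans (a.abs_mul_omega_le k)

/-- The coefficient functionals. -/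
def coeffL (P : PDEData d) (k : Fin d → ℕ) : P.Ell →L[ℝ] ℝ :=
  LinearMap.mkContinuous
    { toFun := fun a => a k, map_add' := fun _ _ => rfl, map_smul' := fun _ _ => rfl } 1
    fun a => by
      rw [one_mul]
      exact a.abs_le_norm k

@[simp] lemma coeffL_apply (a : P.Ell) (k : Fin d → ℕ) : P.coeffL k a = a k := rfl

lemma Ell.add_apply (a b : P.Ell) (k : Fin d → ℕ) : (a + b) k = a k + b k := rfl
lemma Ell.sub_apply (a b : P.Ell) (k : Fin d → ℕ) : (a - b) k = a k - b k := rfl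
lemma Ell.smul_apply (c : ℝ) (a : P.Ell) (k : Fin d → ℕ) : (c • a) k = c * a k := rfl
lemma Ell.zero_apply (k : Fin d → ℕ) : (0 : P.Ell) k = 0 := rfl

/-- Multiplication by the weight identifies `ℓ¹_ω` with `ℓ¹`. -/
def toLp (P : PDEData d) : P.Ell ≃ₗᵢ[ℝ] lp (fun _ : Fin d → ℕ => ℝ) 1 where
  toFun a := ⟨fun k => a k * P.omega k, by
    refine memℓp_gen ?_
    simpa [abs_mul, abs_of_pos (P.omega_pos _)] using a.summable⟩
  invFun f := ⟨fun k => f k / P.omega k, by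
    have := (lp.memℓp f).summable (by simp)
    change Summable fun k => |f k / P.omega k| * P.omega k
    simpa [abs_div, abs_of_pos (P.omega_pos _), (P.omega_pos _).ne'] using this⟩
  left_inv a := Ell.ext fun k => mul_div_cancel_right₀ _ (P.omega_pos k).ne'
  right_inv f := by
    ext k
    exact div_mul_cancel₀ _ (P.omega_pos k).ne'
  map_add' a b := by
    ext k
    exact add_mul _ _ _
  map_smul' c a := by
    ext k
    exact mul_assoc _ _ _
  norm_map' a := by
    rw [lp.norm_eq_tsum_rpow (by simp)]
    simp only [ENNReal.toReal_one, Real.rpow_one, div_one]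
    rw [Ell.norm_def]
    exact tsum_congr fun k => by
      change ‖a k * P.omega k‖ = _
      simp [abs_of_pos (P.omega_pos _)]

/-- Needed for Bochner integrals in the space and for the fixed point argument behind the Volterra
equations. -/
instance : CompleteSpace P.Ell := P.toLp.toIsometryEquiv.completeSpace

open Classical in
/-- The multiplication operator with symbol `m` on `ℓ¹_ω`; it is zero unless `m` is bounded. -/
def diag (P : PDEData d) (m : (Fin d → ℕ) → ℝ) : P.Ell →L[ℝ] P.Ell :=
  if h : ∃ C, ∀ k, |m k| ≤ C then
    LinearMap.mkContinuous
      { toFun := fun a => ⟨fun k => m k * a k, by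
          obtain ⟨C, hC⟩ := h
          refine Summable.of_nonneg_of_le (P.term_nonneg _) (fun k => ?_) (a.summable.mul_left C)
          rw [abs_mul, mul_assoc]
          exact mul_le_mul_of_nonneg_right (hC k) (P.term_nonneg a k)⟩
        map_add' := fun a b => Ell.ext fun k => mul_add _ _ _
        map_smul' := fun c a => Ell.ext fun k => mul_left_comm _ _ _ }
      h.choose fun a => by
        change ∑' k, |m k * a k| * P.omega k ≤ _
        rw [Ell.norm_def, ← tsum_mul_left]
        have hle : ∀ k, |m k * a k| * P.omega k ≤ h.choose * (|a k| * P.omega k) := fun k => by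
          rw [abs_mul, mul_assoc]
          exact mul_le_mul_of_nonneg_right (h.choose_spec k) (P.term_nonneg a k)
        have hs := a.summable.mul_left h.choose
        exact Summable.tsum_le_tsum hle
          (Summable.of_nonneg_of_le (fun k => P.term_nonneg (fun k => m k * a k) k) hle hs) hs
  else 0

lemma diag_apply {m : (Fin d → ℕ) → ℝ} {C : ℝ} (h : ∀ k, |m k| ≤ C) (a : P.Ell)
    (k : Fin d → ℕ) : P.diag m a k = m k * a k := by
  unfold diag
  rw [dif_pos ⟨C, h⟩]
  rfl

lemma Ell.norm_le_of_abs_le {a b : P.Ell} {C : ℝ} (h : ∀ k, |a k| ≤ C * |b k|) :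
    ‖a‖ ≤ C * ‖b‖ := by
  rw [Ell.norm_def, Ell.norm_def, ← tsum_mul_left]
  refine Summable.tsum_le_tsum (fun k => ?_) a.summable (b.summable.mul_left C)
  rw [← mul_assoc]
  exact mul_le_mul_of_nonneg_right (h k) (P.omega_pos k).le

lemma norm_diag_le {m : (Fin d → ℕ) → ℝ} {C : ℝ} (h : ∀ k, |m k| ≤ C) :
    ‖P.diag m‖ ≤ C := by
  refine ContinuousLinearMap.opNorm_le_bound _ ((abs_nonneg _).trans (h 0)) fun a => ?_
  refine Ell.norm_le_of_abs_le fun k => ?_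
  rw [diag_apply h, abs_mul]
  exact mul_le_mul_of_nonneg_right (h k) (abs_nonneg _)

lemma diag_sub {m n : (Fin d → ℕ) → ℝ} {C C' : ℝ} (h : ∀ k, |m k| ≤ C)
    (h' : ∀ k, |n k| ≤ C') : P.diag m - P.diag n = P.diag (m - n) := by
  have h'' : ∀ k, |(m - n) k| ≤ C + C' := fun k =>
    (abs_sub _ _).trans (add_le_add (h k) (h' k))
  ext1 a
  refine Ell.ext fun k => ?_
  rw [diag_apply h'', _root_.sub_apply, Ell.sub_apply, diag_apply h, diag_apply h']
  simp [sub_mul]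

lemma diag_zero : P.diag 0 = 0 := by
  ext1 a
  exact Ell.ext fun k => by
    rw [diag_apply (C := 0) (by simp)]
    simp [Ell.zero_apply]

/-! ### Sums over `ℤ^d` -/

/-- Componentwise absolute value. -/
def absV (m : Fin d → ℤ) : Fin d → ℕ := fun j => (m j).natAbs

/-- The integer vectors with given absolute values. -/
def signs (k : Fin d → ℕ) : Finset (Fin d → ℤ) :=
  Fintype.piFinset fun j => {(k j : ℤ), -(k j : ℤ)}

lemma mem_signs {k : Fin d → ℕ} {m : Fin d → ℤ} : m ∈ signs k ↔ absV m = k := by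
  simp only [signs, Fintype.mem_piFinset, Finset.mem_insert, Finset.mem_singleton, absV,
    funext_iff]
  exact forall_congr' fun j => by omega

/-- A sum over sign patterns factors over the coordinates; a zero entry has only one sign. With f =
1 it counts the patterns, which gives α_k; with exponentials it produces the product of cosines. -/
lemma sum_signs_prod {R : Type*} [CommSemiring R] (k : Fin d → ℕ) (f : Fin d → ℤ → R) :
    ∑ m ∈ signs k, ∏ j, f j (m j) =
      ∏ j, if k j = 0 then f j 0 else f j (k j) + f j (-(k j)) := by
  rw [signs, ← Finset.prod_univ_sum]
  refine Finset.prod_congr rfl fun j _ => ?_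
  split_ifs with h
  · simp [h]
  · rw [Finset.sum_pair]
    omega

lemma card_signs (k : Fin d → ℕ) : ((signs k).card : ℝ) = alpha k := by
  have := sum_signs_prod k fun _ _ => (1 : ℝ)
  simp only [Finset.prod_const_one, Finset.sum_const, nsmul_eq_mul, mul_one] at this
  rw [this, alpha]
  norm_num

/-- The fibre of `absV` over k has α_k elements. This is why α_k belongs to the weight: the norm of
ℓ¹_ω is the plain ν-weighted ℓ¹ norm of the even extension to ℤ^d. -/
lemma tsum_absV (F : (Fin d → ℕ) → ENNReal) :
    ∑' m : Fin d → ℤ, F (absV m) = ∑' k, ENNReal.ofReal (alpha k) * F k := by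
  rw [← (Equiv.sigmaFiberEquiv (absV (d := d))).tsum_eq, ENNReal.tsum_sigma']
  refine tsum_congr fun k => ?_
  have h1 : ∀ m : { m : Fin d → ℤ // absV m = k },
      F (absV ((Equiv.sigmaFiberEquiv absV) ⟨k, m⟩)) = F k := fun m => by
    change F (absV m.1) = F k
    rw [m.2]
  simp_rw [h1]
  have h2 : ∑' _ : { m : Fin d → ℤ // absV m = k }, F k = ∑' _ : (signs k), F k :=
    (Equiv.subtypeEquivRight fun m => mem_signs.symm).tsum_eq (fun _ : (signs k) => F k)
  rw [h2, ← card_signs]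
  simp

/-- Flipping the sign of m_j wherever k_j < 0 permutes ℤ^d and changes neither |m| nor, up to signs,
the difference k - m. Thus the convolution of even sequences is even, and sums over k in ℤ^d become
translation invariant. -/
lemma conv_absV (a b : (Fin d → ℕ) → ℝ) (k : Fin d → ℤ) :
    conv a b (absV k) = ∑' m : Fin d → ℤ, a (absV m) * b (absV (k - m)) := by
  have hinv : Function.Involutive
      (fun (m : Fin d → ℤ) j => if k j < 0 then -m j else m j) := fun m => by
    funext j
    dsimp only
    split_ifs <;> simp
  rw [conv, ← hinv.toPerm.tsum_eq]
  refine tsum_congr fun m => ?_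
  congr 2
  · funext j
    simp only [Function.Involutive.coe_toPerm, absV]
    split_ifs <;> simp
  · funext j
    simp only [Function.Involutive.coe_toPerm, absV, Pi.sub_apply]
    split_ifs <;> omega

/-! ### Weighted sums -/

/-- The polynomial weight `1 + k_1 + ⋯ + k_d`. -/
def jap (k : Fin d → ℕ) : ℝ := 1 + ∑ j, (k j : ℝ)

lemma one_le_jap (k : Fin d → ℕ) : 1 ≤ jap k :=
  le_add_of_nonneg_right (Finset.sum_nonneg fun _ _ => Nat.cast_nonneg _)

lemma jap_pos (k : Fin d → ℕ) : 0 < jap k := one_pos.trans_le (one_le_jap k)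

/-- The norm of `a` in the space with the weights `ω_k (1 + |k|)^n`. -/
def wsum (P : PDEData d) (n : ℕ) (a : (Fin d → ℕ) → ℝ) : ENNReal :=
  ∑' k, ENNReal.ofReal (|a k| * P.omega k * jap k ^ n)

/-- The weight on `ℤ^d` belonging to `wsum`. -/
def intWeight (P : PDEData d) (n : ℕ) (k : Fin d → ℕ) : ℝ := P.nu ^ (∑ j, k j) * jap k ^ n

lemma intWeight_pos (P : PDEData d) (n : ℕ) (k : Fin d → ℕ) : 0 < P.intWeight n k :=
  mul_pos (pow_pos P.nu_pos _) (pow_pos (jap_pos k) _)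

/-- Triangle inequality for |k|, together with ν ≥ 1 for the geometric factor and 1 + x + y ≤ (1 +
x)(1 + y) for the polynomial one. This submultiplicativity makes each `wsum` norm compatible with
convolution. -/
lemma intWeight_le (P : PDEData d) (n : ℕ) (k m : Fin d → ℤ) :
    P.intWeight n (absV k) ≤ P.intWeight n (absV m) * P.intWeight n (absV (k - m)) := by
  have h : ∀ j, absV k j ≤ absV m j + absV (k - m) j := fun j => by
    simp only [absV, Pi.sub_apply]; omega
  have h1 : P.nu ^ (∑ j, absV k j) ≤ P.nu ^ (∑ j, absV m j) * P.nu ^ (∑ j, absV (k - m) j) := by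
    rw [← pow_add, ← Finset.sum_add_distrib]
    exact pow_le_pow_right₀ P.one_le_nu (Finset.sum_le_sum fun j _ => h j)
  have h2 : jap (absV k) ≤ jap (absV m) * jap (absV (k - m)) := by
    have h3 : ∑ j, (absV k j : ℝ) ≤ ∑ j, (absV m j : ℝ) + ∑ j, (absV (k - m) j : ℝ) := by
      rw [← Finset.sum_add_distrib]
      exact Finset.sum_le_sum fun j _ => by exact_mod_cast h j
    have h4 : 0 ≤ ∑ j, (absV m j : ℝ) := Finset.sum_nonneg fun _ _ => Nat.cast_nonneg _
    have h5 : 0 ≤ ∑ j, (absV (k - m) j : ℝ) := Finset.sum_nonneg fun j _ => Nat.cast_nonneg _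
    unfold jap
    nlinarith [mul_nonneg h4 h5]
  have h3 : jap (absV k) ^ n ≤ jap (absV m) ^ n * jap (absV (k - m)) ^ n := by
    rw [← mul_pow]
    exact pow_le_pow_left₀ (jap_pos _).le h2 n
  calc _ ≤ (P.nu ^ (∑ j, absV m j) * P.nu ^ (∑ j, absV (k - m) j)) *
        (jap (absV m) ^ n * jap (absV (k - m)) ^ n) :=
        mul_le_mul h1 h3 (pow_nonneg (jap_pos _).le _)
          (mul_nonneg (pow_pos P.nu_pos _).le (pow_pos P.nu_pos _).le)
    _ = _ := by unfold intWeight; ring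

lemma wsum_eq_tsum_int (n : ℕ) (a : (Fin d → ℕ) → ℝ) :
    P.wsum n a = ∑' m : Fin d → ℤ, ENNReal.ofReal (|a (absV m)| * P.intWeight n (absV m)) := by
  rw [tsum_absV fun k => ENNReal.ofReal (|a k| * P.intWeight n k)]
  refine tsum_congr fun k => ?_
  rw [← ENNReal.ofReal_mul (alpha_pos k).le]
  congr 1
  unfold omega intWeight
  ring

/-- Young's inequality on ℤ^d: distribute the submultiplicative weight, exchange the two sums and
translate. In `ENNReal` no summability is needed; where a convolution sum diverges its value is 0
and the bound is trivial. -/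
lemma wsum_conv_le (n : ℕ) (a b : (Fin d → ℕ) → ℝ) :
    P.wsum n (conv a b) ≤ P.wsum n a * P.wsum n b := by
  have habs : ∀ f : (Fin d → ℤ) → ℝ,
      ENNReal.ofReal |∑' m, f m| ≤ ∑' m, ENNReal.ofReal |f m| := fun f => by
    by_cases hf : Summable f
    · have h1 := hf.abs
      rw [← ENNReal.ofReal_tsum_of_nonneg (fun m => abs_nonneg _) h1]
      have h2 : |∑' m, f m| ≤ ∑' m, |f m| := norm_tsum_le_tsum_norm (f := f) hf.norm
      exact ENNReal.ofReal_le_ofReal h2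
    · simp [tsum_eq_zero_of_not_summable hf]
  rw [wsum_eq_tsum_int, wsum_eq_tsum_int, wsum_eq_tsum_int]
  calc _ ≤ ∑' k : Fin d → ℤ, ∑' m : Fin d → ℤ,
        ENNReal.ofReal (|a (absV m)| * P.intWeight n (absV m)) *
          ENNReal.ofReal (|b (absV (k - m))| * P.intWeight n (absV (k - m))) := by
        refine ENNReal.tsum_le_tsum fun k => ?_
        rw [ENNReal.ofReal_mul (abs_nonneg _), conv_absV]
        refine (mul_le_mul_left (habs fun m => a (absV m) * b (absV (k - m))) _).trans ?_
        rw [← ENNReal.tsum_mul_right]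
        refine ENNReal.tsum_le_tsum fun m => ?_
        rw [← ENNReal.ofReal_mul (abs_nonneg _),
          ← ENNReal.ofReal_mul (mul_nonneg (abs_nonneg _) (P.intWeight_pos _ _).le), abs_mul]
        refine ENNReal.ofReal_le_ofReal ?_
        calc _ ≤ |a (absV m)| * |b (absV (k - m))| *
              (P.intWeight n (absV m) * P.intWeight n (absV (k - m))) :=
              mul_le_mul_of_nonneg_left (P.intWeight_le n k m)
                (mul_nonneg (abs_nonneg _) (abs_nonneg _))
          _ = _ := by ring
    _ = _ := by
        rw [ENNReal.tsum_comm, ← ENNReal.tsum_mul_right]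
        refine tsum_congr fun m => ?_
        rw [ENNReal.tsum_mul_left]
        congr 1
        exact (Equiv.subRight m).tsum_eq
          (fun k : Fin d → ℤ => ENNReal.ofReal (|b (absV k)| * P.intWeight n (absV k)))

lemma wsum_zero_eq (a : P.Ell) : P.wsum 0 a = ENNReal.ofReal ‖a‖ := by
  rw [Ell.norm_def, ENNReal.ofReal_tsum_of_nonneg (P.term_nonneg a) a.summable, wsum]
  simp

lemma summable_of_wsum_ne_top {n : ℕ} {a : (Fin d → ℕ) → ℝ} (h : P.wsum n a ≠ ⊤) :
    Summable fun k => |a k| * P.omega k * jap k ^ n := by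
  have := ENNReal.summable_toReal h
  refine this.congr fun k => ENNReal.toReal_ofReal ?_
  exact mul_nonneg (P.term_nonneg a k) (pow_pos (jap_pos k) n).le

lemma wsum_add_le (n : ℕ) (a b : (Fin d → ℕ) → ℝ) :
    P.wsum n (a + b) ≤ P.wsum n a + P.wsum n b := by
  unfold wsum
  rw [← ENNReal.tsum_add]
  refine ENNReal.tsum_le_tsum fun k => ?_
  have hw := mul_nonneg (P.omega_pos k).le (pow_pos (jap_pos k) n).le
  rw [← ENNReal.ofReal_add (mul_nonneg (P.term_nonneg a k) (pow_pos (jap_pos k) n).le)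
    (mul_nonneg (P.term_nonneg b k) (pow_pos (jap_pos k) n).le)]
  refine ENNReal.ofReal_le_ofReal ?_
  rw [mul_assoc, mul_assoc, mul_assoc, ← add_mul]
  exact mul_le_mul_of_nonneg_right (abs_add_le _ _) hw

lemma wsum_smul (n : ℕ) (c : ℝ) (a : (Fin d → ℕ) → ℝ) :
    P.wsum n (c • a) = ENNReal.ofReal |c| * P.wsum n a := by
  unfold wsum
  rw [← ENNReal.tsum_mul_left]
  refine tsum_congr fun k => ?_
  rw [← ENNReal.ofReal_mul (abs_nonneg _)]
  congr 1
  simp [abs_mul]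
  ring

lemma wsum_one (n : ℕ) : P.wsum n (Ell.one P) = 1 := by
  unfold wsum
  rw [tsum_eq_single 0 fun k hk => by simp [Ell.one, hk]]
  simp [Ell.one, omega, alpha, jap]

/-! ### Convolution and the nonlinearity -/

lemma summable_conv (a b : P.Ell) (k : Fin d → ℕ) : Summable fun m : Fin d → ℤ =>
    a (fun j => (m j).natAbs) * b (fun j => ((k j : ℤ) - m j).natAbs) := by
  refine Summable.of_norm_bounded ((summable_int a).mul_right ‖b‖) fun m => ?_
  rw [norm_mul]
  refine mul_le_mul ?_ (b.abs_le_norm _) (norm_nonneg _)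
    (mul_nonneg (abs_nonneg _) (pow_pos P.nu_pos _).le)
  exact le_mul_of_one_le_right (abs_nonneg _) (one_le_pow₀ P.one_le_nu)

lemma norm_mul_le (a b : P.Ell) : ‖Ell.mul a b‖ ≤ ‖a‖ * ‖b‖ := by
  have h := wsum_conv_le (P := P) 0 a b
  have h1 : P.wsum 0 (conv a b) = ENNReal.ofReal ‖Ell.mul a b‖ := wsum_zero_eq (Ell.mul a b)
  rw [h1, wsum_zero_eq, wsum_zero_eq, ← ENNReal.ofReal_mul (norm_nonneg _)] at h
  exact (ENNReal.ofReal_le_ofReal_iff (mul_nonneg (norm_nonneg _) (norm_nonneg _))).1 h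

/-- Convolution as a bounded bilinear map. -/
def mulL (P : PDEData d) : P.Ell →L[ℝ] P.Ell →L[ℝ] P.Ell :=
  LinearMap.mkContinuous₂
    (LinearMap.mk₂ ℝ Ell.mul
      (fun a a' b => Ell.ext fun k => by
        change conv (a + a').1 b k = conv a b k + conv a' b k
        unfold conv
        rw [← (summable_conv a b k).tsum_add (summable_conv a' b k)]
        exact tsum_congr fun m => add_mul _ _ _)
      (fun c a b => Ell.ext fun k => by
        change conv (c • a).1 b k = c * conv a b k
        unfold conv
        rw [← tsum_mul_left]
        exact tsum_congr fun m => mul_assoc _ _ _)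
      (fun a b b' => Ell.ext fun k => by
        change conv a (b + b').1 k = conv a b k + conv a b' k
        unfold conv
        rw [← (summable_conv a b k).tsum_add (summable_conv a b' k)]
        exact tsum_congr fun m => mul_add _ _ _)
      (fun c a b => Ell.ext fun k => by
        change conv a (c • b).1 k = c * conv a b k
        unfold conv
        rw [← tsum_mul_left]
        exact tsum_congr fun m => mul_left_comm _ _ _)) 1
    fun a b => by simpa using norm_mul_le a b

lemma contDiff_pow (n : ℕ) : ContDiff ℝ 1 fun a : P.Ell => Ell.pow a n := by
  induction n with
  | zero => exact contDiff_const
  | succ n ih =>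
    have : (fun a : P.Ell => Ell.pow a (n + 1)) = fun a => P.mulL (Ell.pow a n) a := rfl
    rw [this]
    exact (P.mulL.contDiff.comp ih).clm_apply contDiff_id

lemma contDiff_nonlin : ContDiff ℝ 1 P.nonlin := by
  unfold nonlin
  exact ContDiff.sum fun n _ => (contDiff_pow n).const_smul _

lemma continuous_nonlin : Continuous P.nonlin := contDiff_nonlin.continuous

lemma continuous_fderiv_nonlin : Continuous (fderiv ℝ P.nonlin) :=
  contDiff_nonlin.continuous_fderiv one_ne_zero

lemma wsum_pow_le (m : ℕ) (a : P.Ell) (n : ℕ) :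
    P.wsum m (Ell.pow a n) ≤ P.wsum m a ^ n := by
  induction n with
  | zero =>
    rw [pow_zero]
    exact (wsum_one m).le
  | succ n ih =>
    rw [pow_succ]
    exact (wsum_conv_le m (Ell.pow a n) a).trans (mul_le_mul_left ih _)

/-- The weighted sums of `𝒩(a)` are bounded in terms of those of `a`. -/
lemma wsum_nonlin_le (m : ℕ) (a : P.Ell) :
    P.wsum m (P.nonlin a) ≤
      ∑ n ∈ P.N.support, ENNReal.ofReal |P.N.coeff n| * P.wsum m a ^ n := by
  unfold nonlin
  induction P.N.support using Finset.induction_on with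
  | empty =>
    simp only [Finset.sum_empty, nonpos_iff_eq_zero]
    unfold wsum
    simp [Ell.zero_apply]
  | insert n s hn ih =>
    rw [Finset.sum_insert hn, Finset.sum_insert hn]
    refine (wsum_add_le m (P.N.coeff n • Ell.pow a n).1 _).trans (add_le_add ?_ ih)
    exact (wsum_smul m (P.N.coeff n) (Ell.pow a n).1).trans_le
      (mul_le_mul_right (wsum_pow_le m a n) _)

end PDEData
end

noncomputable section
namespace PDEData

variable {d : ℕ} {P : PDEData d}

/-! ### The semigroup generated by the linear part -/

/-- `D` is the symbol of an operator of at most half the order of `ℒ`; composition with one more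
derivative leaves the order at most three quarters of that of `ℒ`. -/
def HalfOrder (P : PDEData d) (D : (Fin d → ℕ) → ℝ) : Prop :=
  ∃ c C : ℝ, 0 ≤ C ∧ ∀ k, 1 ≤ c - P.mu k ∧ |D k| ≤ C * (c - P.mu k) ^ (1 / 2 : ℝ) ∧
    jap k * |D k| ≤ C * (c - P.mu k) ^ (3 / 4 : ℝ)

lemma kLsq_nonneg (P : PDEData d) (k : Fin d → ℕ) : 0 ≤ P.kLsq k :=
  Finset.sum_nonneg fun _ _ => sq_nonneg _

lemma exists_jap_le (P : PDEData d) :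
    ∃ B, 0 ≤ B ∧ ∀ k, jap k ≤ B * (1 + P.kLsq k) ^ (1 / 2 : ℝ) := by
  refine ⟨1 + ∑ j, (P.L j)⁻¹,
    add_nonneg zero_le_one (Finset.sum_nonneg fun j _ => (inv_pos.2 (P.L_pos j)).le), fun k => ?_⟩
  have hx := P.kLsq_nonneg k
  have h1 : (1 : ℝ) ≤ (1 + P.kLsq k) ^ (1 / 2 : ℝ) :=
    Real.one_le_rpow (by linarith) (by norm_num)
  have h2 : ∀ j, (k j : ℝ) ≤ (P.L j)⁻¹ * (1 + P.kLsq k) ^ (1 / 2 : ℝ) := fun j => by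
    have h3 : ((k j : ℝ) * P.L j) ^ 2 ≤ 1 + P.kLsq k := by
      have := Finset.single_le_sum (f := fun j => ((k j : ℝ) * P.L j) ^ 2)
        (fun i _ => sq_nonneg _) (Finset.mem_univ j)
      unfold kLsq
      linarith
    have h4 : (k j : ℝ) * P.L j ≤ (1 + P.kLsq k) ^ (1 / 2 : ℝ) := by
      rw [← Real.sqrt_eq_rpow]
      exact Real.le_sqrt_of_sq_le h3
    rw [inv_mul_eq_div, le_div_iff₀ (P.L_pos j)]
    exact h4
  unfold jap
  rw [add_mul, one_mul, Finset.sum_mul]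
  exact add_le_add h1 (Finset.sum_le_sum fun j _ => h2 j)

/-- Parabolicity and semilinearity enter here together: c - μ_k grows at least like (1 + (kL)²)^(1 +
p), so the symbol of Δ^p is of half order with respect to it. -/
lemma exists_shift (P : PDEData d) :
    ∃ c B : ℝ, 1 ≤ B ∧ ∀ k, 1 ≤ c - P.mu k ∧ (1 + P.kLsq k) ^ (1 + P.p) ≤ B * (c - P.mu k) := by
  rcases P.parabolic_semilinear with h | ⟨h2, h1, hp⟩
  · have hl : 0 < -P.lam2 := by linarith
    have hne : P.lam2 ≠ 0 := h.ne
    -- Write x = (kL)². One half of -λ₂x² completes the square with λ₁x and leaves the constant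
    -- λ₁²/(2|λ₂|); the other half survives in c - μ_k ≥ 1 + |λ₂|x²/2. The factor 2 + 4/|λ₂| is then
    -- enough because (1 + x)² ≤ 2 + 2x².
    refine ⟨P.lam0 + 1 + P.lam1 ^ 2 / (2 * -P.lam2), 2 + 4 / -P.lam2,
      by have := div_pos four_pos hl; linarith, fun k => ?_⟩
    have hx := P.kLsq_nonneg k
    set x := P.kLsq k with hxdef
    have hy : 1 + -P.lam2 / 2 * x ^ 2 ≤
        P.lam0 + 1 + P.lam1 ^ 2 / (2 * -P.lam2) - P.mu k := by
      have h3 : P.lam1 ^ 2 / (2 * -P.lam2) + P.lam1 * x + -P.lam2 / 2 * x ^ 2 =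
          (P.lam1 + -P.lam2 * x) ^ 2 / (2 * -P.lam2) := by
        field_simp
        ring
      have h4 : 0 ≤ (P.lam1 + -P.lam2 * x) ^ 2 / (2 * -P.lam2) := by positivity
      unfold mu
      rw [← hxdef]
      linarith
    refine ⟨le_trans (by nlinarith [mul_nonneg hl.le (sq_nonneg x)]) hy, ?_⟩
    have hp2 : (1 + x) ^ (1 + P.p) ≤ (1 + x) ^ 2 :=
      pow_le_pow_right₀ (by linarith) (by have := P.p_le; omega)
    have h5 : (1 + x) ^ 2 ≤ (2 + 4 / -P.lam2) * (1 + -P.lam2 / 2 * x ^ 2) := by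
      have h6 : (2 + 4 / -P.lam2) * (1 + -P.lam2 / 2 * x ^ 2) =
          2 + 2 * x ^ 2 + 4 / -P.lam2 + -P.lam2 * x ^ 2 := by
        field_simp
        ring
      rw [h6]
      have := div_pos four_pos hl
      nlinarith [sq_nonneg (1 - x), mul_nonneg hl.le (sq_nonneg x)]
    refine hp2.trans (h5.trans (mul_le_mul_of_nonneg_left hy ?_))
    have := div_pos four_pos hl
    linarith
  · refine ⟨P.lam0 + 1, 1 + 1 / P.lam1, by have := one_div_pos.2 h1; linarith, fun k => ?_⟩
    have hx := P.kLsq_nonneg k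
    have hy : P.lam0 + 1 - P.mu k = 1 + P.lam1 * P.kLsq k := by
      unfold mu
      rw [h2]
      ring
    rw [hy, hp]
    refine ⟨by nlinarith [mul_nonneg h1.le hx], ?_⟩
    have : (1 + 1 / P.lam1) * (1 + P.lam1 * P.kLsq k) =
        1 + P.kLsq k + (1 / P.lam1 + P.lam1 * P.kLsq k) := by
      field_simp
      ring
    rw [this, add_zero, pow_one]
    have := one_div_pos.2 h1
    nlinarith [mul_nonneg h1.le hx]

lemma halfOrder_one (P : PDEData d) : P.HalfOrder fun _ => 1 := by
  obtain ⟨c, B, hB, h⟩ := P.exists_shift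
  obtain ⟨B0, hB0, hj⟩ := P.exists_jap_le
  refine ⟨c, 1 + B0 * B ^ (3 / 4 : ℝ), by positivity, fun k => ⟨(h k).1, ?_, ?_⟩⟩
  · have := Real.one_le_rpow (h k).1 (by norm_num : (0 : ℝ) ≤ 1 / 2)
    have h0 : 0 ≤ B0 * B ^ (3 / 4 : ℝ) := by positivity
    rw [abs_one]
    nlinarith
  · have hy := (h k).1
    have hz : 1 ≤ 1 + P.kLsq k := by linarith [P.kLsq_nonneg k]
    have h1 : (1 + P.kLsq k) ^ (1 / 2 : ℝ) ≤ (B * (c - P.mu k)) ^ (3 / 4 : ℝ) := by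
      calc _ ≤ (B * (c - P.mu k)) ^ (1 / 2 : ℝ) := by
            refine Real.rpow_le_rpow (by linarith) ?_ (by norm_num)
            refine le_trans ?_ (h k).2
            exact le_self_pow₀ hz (by omega)
        _ ≤ _ := Real.rpow_le_rpow_of_exponent_le (by nlinarith) (by norm_num)
    rw [Real.mul_rpow (by linarith) (by linarith)] at h1
    have h2 := (hj k).trans (mul_le_mul_of_nonneg_left h1 hB0)
    have h3 := Real.rpow_nonneg (by linarith : 0 ≤ c - P.mu k) (3 / 4)
    rw [abs_one, mul_one]
    nlinarith

/-- For p = 1 the shifted symbol c - μ dominates (1 + x)², x = (kL)², up to a constant. The symbol x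
is at most its square root, and one more derivative gives (1 + x)^(3/2) = ((1 + x)²)^(3/4), whence
the exponent 3/4. -/
lemma halfOrder_qsym (P : PDEData d) : P.HalfOrder P.qsym := by
  obtain hp | hp : P.p = 0 ∨ P.p = 1 := by have := P.p_le; omega
  · have : P.qsym = fun _ => 1 := by
      funext k
      simp [qsym, hp]
    rw [this]
    exact P.halfOrder_one
  · obtain ⟨c, B, hB, h⟩ := P.exists_shift
    obtain ⟨B0, hB0, hj⟩ := P.exists_jap_le
    refine ⟨c, B ^ (1 / 2 : ℝ) + B0 * B ^ (3 / 4 : ℝ), by positivity,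
      fun k => ⟨(h k).1, ?_, ?_⟩⟩
    all_goals
      have hx := P.kLsq_nonneg k
      have hy := (h k).1
      have hq : |P.qsym k| ≤ 1 + P.kLsq k := by
        simp only [qsym, hp, pow_one]
        rw [abs_le]
        constructor <;> linarith
      have hz := (h k).2
      rw [hp] at hz
      have hy0 : 0 ≤ c - P.mu k := by linarith
      have h3 := Real.rpow_nonneg hy0 (3 / 4)
      have h2 := Real.rpow_nonneg hy0 (1 / 2)
    · have h1 : 1 + P.kLsq k ≤ (B * (c - P.mu k)) ^ (1 / 2 : ℝ) := by
        rw [← Real.sqrt_eq_rpow]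
        exact Real.le_sqrt_of_sq_le hz
      rw [Real.mul_rpow (by linarith) hy0] at h1
      have h0 : 0 ≤ B0 * B ^ (3 / 4 : ℝ) := by positivity
      nlinarith [mul_nonneg h0 h2]
    · have h1 : (1 + P.kLsq k) ^ (1 / 2 : ℝ) * (1 + P.kLsq k) ≤
          (B * (c - P.mu k)) ^ (3 / 4 : ℝ) := by
        calc _ = ((1 + P.kLsq k) ^ 2) ^ (3 / 4 : ℝ) := by
              rw [← Real.rpow_natCast, ← Real.rpow_mul (by linarith),
                ← Real.rpow_add_one (by linarith)]
              norm_num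
          _ ≤ _ := Real.rpow_le_rpow (by positivity) hz (by norm_num)
      rw [Real.mul_rpow (by linarith) hy0] at h1
      have h4 : jap k * |P.qsym k| ≤
          B0 * (1 + P.kLsq k) ^ (1 / 2 : ℝ) * (1 + P.kLsq k) :=
        mul_le_mul (hj k) hq (abs_nonneg _)
          (mul_nonneg hB0 (Real.rpow_nonneg (by linarith) _))
      have h5 : 0 ≤ B ^ (1 / 2 : ℝ) := by positivity
      nlinarith [mul_le_mul_of_nonneg_left h1 hB0, mul_nonneg h5 h3]

/-- The operator `e^{tℒ} D` for `t > 0`, and zero for `t ≤ 0`. -/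
def heat (P : PDEData d) (D : (Fin d → ℕ) → ℝ) (t : ℝ) : P.Ell →L[ℝ] P.Ell :=
  P.diag fun k => if 0 < t then Real.exp (t * P.mu k) * D k else 0

lemma heat_of_nonpos {D : (Fin d → ℕ) → ℝ} {t : ℝ} (ht : t ≤ 0) : P.heat D t = 0 := by
  unfold heat
  simp only [not_lt.2 ht, if_false]
  exact diag_zero

/-- With z = ty this is z^s ≤ max(1, z) ≤ e^z. It is the source of all powers t^(-s) below, and also
of the small factor l^(-1/4) in the contraction estimate. -/
lemma rpow_mul_exp_neg_le {s t y : ℝ} (hs0 : 0 ≤ s) (hs1 : s ≤ 1) (ht : 0 < t) (hy : 0 ≤ y) :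
    y ^ s * Real.exp (-(t * y)) ≤ t ^ (-s) := by
  have hx : 0 ≤ t * y := by positivity
  have h1 : (t * y) ^ s ≤ Real.exp (t * y) := by
    rcases le_total (t * y) 1 with h | h
    · exact (Real.rpow_le_one hx h hs0).trans (Real.one_le_exp hx)
    · calc (t * y) ^ s ≤ (t * y) ^ (1 : ℝ) := Real.rpow_le_rpow_of_exponent_le h hs1
        _ ≤ _ := by
          rw [Real.rpow_one]
          linarith [Real.add_one_le_exp (t * y)]
  rw [Real.mul_rpow ht.le hy] at h1
  rw [Real.rpow_neg ht.le, Real.exp_neg, ← div_eq_mul_inv, div_le_iff₀ (Real.exp_pos _),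
    inv_mul_eq_div, le_div_iff₀ (Real.rpow_pos_of_pos ht s)]
  linarith

lemma exp_mul_mu_le {c y t T : ℝ} (ht : 0 < t) (htT : t ≤ T) :
    Real.exp (t * (c - y)) ≤ Real.exp (|c| * T) * Real.exp (-(t * y)) := by
  rw [← Real.exp_add]
  refine Real.exp_le_exp.2 ?_
  nlinarith [mul_le_mul_of_nonneg_right (le_abs_self c) ht.le,
    mul_le_mul_of_nonneg_left htT (abs_nonneg c)]

/-- Factor e^{tμ} = e^{tc} e^{-t(c - μ)} and trade powers of c - μ for powers of t. Both exponents,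
1/2 for D and 3/4 for D with one extra power of |k|, are below 1 and hence integrable at t = 0. -/
lemma HalfOrder.exists_abs_le {D : (Fin d → ℕ) → ℝ} (hD : P.HalfOrder D) (T : ℝ) :
    ∃ M, 0 ≤ M ∧ ∀ t, 0 < t → t ≤ T → ∀ k,
      |Real.exp (t * P.mu k) * D k| ≤ M * t ^ (-(1 / 2) : ℝ) ∧
      jap k * |Real.exp (t * P.mu k) * D k| ≤ M * t ^ (-(3 / 4) : ℝ) := by
  obtain ⟨c, C, hC, h⟩ := hD
  refine ⟨C * Real.exp (|c| * T), by positivity, fun t ht htT k => ?_⟩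
  obtain ⟨hy, h1, h2⟩ := h k
  have hy0 : 0 ≤ c - P.mu k := by linarith
  have he : Real.exp (t * P.mu k) ≤ Real.exp (|c| * T) * Real.exp (-(t * (c - P.mu k))) := by
    have := exp_mul_mu_le (c := c) (y := c - P.mu k) ht htT
    rwa [sub_sub_cancel] at this
  have hg : ∀ s : ℝ, 0 ≤ s → s ≤ 1 → ∀ A : ℝ, 0 ≤ A → A ≤ C * (c - P.mu k) ^ s →
      Real.exp (t * P.mu k) * A ≤ C * Real.exp (|c| * T) * t ^ (-s) := fun s hs0 hs1 A hA0 hA => by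
    calc _ ≤ (Real.exp (|c| * T) * Real.exp (-(t * (c - P.mu k)))) * (C * (c - P.mu k) ^ s) :=
          mul_le_mul he hA hA0 (by positivity)
      _ = C * Real.exp (|c| * T) * ((c - P.mu k) ^ s * Real.exp (-(t * (c - P.mu k)))) := by ring
      _ ≤ _ := mul_le_mul_of_nonneg_left (rpow_mul_exp_neg_le hs0 hs1 ht hy0) (by positivity)
  rw [abs_mul, Real.abs_exp]
  refine ⟨hg _ (by norm_num) (by norm_num) _ (abs_nonneg _) h1, ?_⟩
  rw [mul_left_comm]
  exact hg _ (by norm_num) (by norm_num) _ (mul_nonneg (jap_pos k).le (abs_nonneg _)) h2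

lemma heat_apply {D : (Fin d → ℕ) → ℝ} (hD : P.HalfOrder D) {t : ℝ} (ht : 0 < t) (a : P.Ell)
    (k : Fin d → ℕ) : P.heat D t a k = Real.exp (t * P.mu k) * D k * a k := by
  obtain ⟨M, -, hM⟩ := hD.exists_abs_le t
  unfold heat
  simp only [ht, if_true]
  exact diag_apply (fun k => (hM t ht le_rfl k).1) a k

lemma HalfOrder.exists_norm_heat_le {D : (Fin d → ℕ) → ℝ} (hD : P.HalfOrder D) (T : ℝ) :
    ∃ M, 0 ≤ M ∧ ∀ t, 0 < t → t ≤ T → ‖P.heat D t‖ ≤ M * t ^ (-(1 / 2) : ℝ) := by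
  obtain ⟨M, hM0, hM⟩ := hD.exists_abs_le T
  refine ⟨M, hM0, fun t ht htT => ?_⟩
  unfold heat
  simp only [ht, if_true]
  exact norm_diag_le fun k => (hM t ht htT k).1

lemma abs_exp_neg_sub_exp_neg_le {s t y : ℝ} (hy : 0 ≤ y) {e : ℝ} (hs : e ≤ s) (ht : e ≤ t) :
    |Real.exp (-(s * y)) - Real.exp (-(t * y))| ≤ |s - t| * (y * Real.exp (-(e * y))) := by
  wlog h : s ≤ t generalizing s t
  · rw [abs_sub_comm, abs_sub_comm s t]
    exact this ht hs (le_of_not_ge h)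
  have h1 : Real.exp (-(t * y)) = Real.exp (-(s * y)) * Real.exp (-((t - s) * y)) := by
    rw [← Real.exp_add]
    ring_nf
  have h2 : 1 - (t - s) * y ≤ Real.exp (-((t - s) * y)) := by
    linarith [Real.add_one_le_exp (-((t - s) * y))]
  have h3 : Real.exp (-((t - s) * y)) ≤ 1 :=
    Real.exp_le_one_iff.2 (neg_nonpos.2 (mul_nonneg (by linarith) hy))
  have h4 : Real.exp (-(s * y)) ≤ Real.exp (-(e * y)) :=
    Real.exp_le_exp.2 (by nlinarith)
  have h5 := Real.exp_pos (-(s * y))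
  rw [abs_sub_comm s t, abs_of_nonneg (by linarith : 0 ≤ t - s), h1, abs_of_nonneg (by nlinarith)]
  calc _ = Real.exp (-(s * y)) * (1 - Real.exp (-((t - s) * y))) := by ring
    _ ≤ Real.exp (-(e * y)) * ((t - s) * y) :=
        mul_le_mul h4 (by linarith) (by linarith) (Real.exp_pos _).le
    _ = _ := by ring

/-- Continuity in the operator norm holds only away from t = 0. After splitting off the scalar
e^{tc}, the symbol is locally Lipschitz in t uniformly in k, since y² e^{-ty/2} is bounded for y = c
- μ_k. -/
lemma HalfOrder.continuousOn_heat {D : (Fin d → ℕ) → ℝ} (hD : P.HalfOrder D) :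
    ContinuousOn (P.heat D) (Ioi 0) := by
  have hD' := hD
  obtain ⟨c, C, hC, h⟩ := hD
  have hb : ∀ t : ℝ, 0 < t → ∀ k, |Real.exp (-(t * (c - P.mu k))) * D k| ≤ C * t ^ (-(1 / 2) : ℝ) :=
    fun t ht k => by
      obtain ⟨hy, h1, -⟩ := h k
      have hy0 : 0 ≤ c - P.mu k := by linarith
      rw [abs_mul, Real.abs_exp]
      calc _ ≤ Real.exp (-(t * (c - P.mu k))) * (C * (c - P.mu k) ^ (1 / 2 : ℝ)) :=
            mul_le_mul_of_nonneg_left h1 (Real.exp_pos _).le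
        _ = C * ((c - P.mu k) ^ (1 / 2 : ℝ) * Real.exp (-(t * (c - P.mu k)))) := by ring
        _ ≤ _ := mul_le_mul_of_nonneg_left
            (rpow_mul_exp_neg_le (by norm_num) (by norm_num) ht hy0) hC
  obtain ⟨R, hR⟩ : ∃ R : ℝ → (P.Ell →L[ℝ] P.Ell), R = fun t =>
    P.diag fun k => Real.exp (-(t * (c - P.mu k))) * D k := ⟨_, rfl⟩
  have hEq : ∀ t ∈ Ioi (0 : ℝ), P.heat D t = Real.exp (t * c) • R t := fun t ht => by
    ext1 a
    refine Ell.ext fun k => ?_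
    rw [heat_apply hD' ht, _root_.smul_apply, Ell.smul_apply, hR, diag_apply (hb t ht),
      ← mul_assoc, ← mul_assoc, ← Real.exp_add]
    ring_nf
  have hRc : ContinuousOn R (Ioi 0) := by
    intro t ht
    have ht' : 0 < t := ht
    have hlip : ∀ s ∈ Ioi (t / 2), dist (R s) (R t) ≤ (C * (2 / (t / 2) ^ 2)) * dist s t := by
      intro s hs
      have hs' : t / 2 < s := hs
      rw [dist_eq_norm, hR, Real.dist_eq]
      dsimp only
      rw [diag_sub (hb s (by linarith)) (hb t ht')]
      refine norm_diag_le fun k => ?_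
      obtain ⟨hy, h1, -⟩ := h k
      have hy0 : 0 ≤ c - P.mu k := by linarith
      set y := c - P.mu k
      rw [Pi.sub_apply, ← sub_mul, abs_mul]
      have h2 := abs_exp_neg_sub_exp_neg_le hy0 hs'.le (by linarith : t / 2 ≤ t)
      have h3 : y ^ (1 / 2 : ℝ) ≤ y := by
        calc y ^ (1 / 2 : ℝ) ≤ y ^ (1 : ℝ) := Real.rpow_le_rpow_of_exponent_le hy (by norm_num)
          _ = y := Real.rpow_one y
      -- Only the quadratic term of e^z ≥ 1 + z + z²/2 at z = ty/2 is used.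
      have h4 : y ^ 2 * Real.exp (-(t / 2 * y)) ≤ 2 / (t / 2) ^ 2 := by
        have h5 := Real.quadratic_le_exp_of_nonneg (x := t / 2 * y) (by positivity)
        rw [Real.exp_neg, ← div_eq_mul_inv, div_le_div_iff₀ (Real.exp_pos _) (by positivity)]
        nlinarith [mul_nonneg ht'.le hy0]
      calc _ ≤ (|s - t| * (y * Real.exp (-(t / 2 * y)))) * (C * y) :=
            mul_le_mul h2 (h1.trans (mul_le_mul_of_nonneg_left h3 hC)) (abs_nonneg _)
              (by positivity)
        _ = C * (y ^ 2 * Real.exp (-(t / 2 * y))) * |s - t| := by ring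
        _ ≤ _ := mul_le_mul_of_nonneg_right (mul_le_mul_of_nonneg_left h4 hC) (abs_nonneg _)
    refine ContinuousAt.continuousWithinAt ?_
    rw [ContinuousAt, tendsto_iff_dist_tendsto_zero]
    have h6 : Tendsto (fun s => (C * (2 / (t / 2) ^ 2)) * dist s t) (𝓝 t) (𝓝 0) := by
      have : Continuous fun s => (C * (2 / (t / 2) ^ 2)) * dist s t := by fun_prop
      simpa using this.tendsto t
    refine squeeze_zero' (Eventually.of_forall fun s => dist_nonneg) ?_ h6
    filter_upwards [Ioi_mem_nhds (show t / 2 < t by linarith)] with s hs using hlip s hs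
  refine ContinuousOn.congr ?_ hEq
  have hexp : Continuous fun t : ℝ => Real.exp (t * c) := by fun_prop
  exact hexp.continuousOn.smul hRc

/-- Strong continuity of the semigroup at time zero. -/
lemma tendsto_heat_one (a : P.Ell) :
    Tendsto (fun t => P.heat (fun _ => 1) t a) (𝓝[>] 0) (𝓝 a) := by
  have h1 := P.halfOrder_one
  obtain ⟨c, C, hC, h⟩ := P.halfOrder_one
  rw [tendsto_iff_norm_sub_tendsto_zero]
  have hlim : Tendsto (fun t : ℝ => ∑' k, |Real.exp (t * P.mu k) * a k - a k| * P.omega k)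
      (𝓝[>] 0) (𝓝 (∑' _ : Fin d → ℕ, (0 : ℝ))) := by
    refine tendsto_tsum_of_dominated_convergence
      (bound := fun k => (Real.exp |c| + 1) * (|a k| * P.omega k)) (a.summable.mul_left _)
      (fun k => ?_) ?_
    · have : Continuous fun t : ℝ => |Real.exp (t * P.mu k) * a k - a k| * P.omega k := by
        fun_prop
      have := this.tendsto 0
      simp only [zero_mul, Real.exp_zero, one_mul, sub_self, abs_zero] at this
      exact this.mono_left nhdsWithin_le_nhds
    · have : Ioc (0 : ℝ) 1 ∈ 𝓝[>] (0 : ℝ) := Ioc_mem_nhdsGT one_pos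
      filter_upwards [this] with t ht k
      rw [Real.norm_of_nonneg (mul_nonneg (abs_nonneg _) (P.omega_pos k).le), ← mul_assoc]
      refine mul_le_mul_of_nonneg_right ?_ (P.omega_pos k).le
      have he : Real.exp (t * P.mu k) ≤ Real.exp |c| := by
        refine Real.exp_le_exp.2 ?_
        have := (h k).1
        nlinarith [le_abs_self c, abs_nonneg c, ht.1, ht.2,
          mul_le_mul_of_nonneg_left (show P.mu k ≤ |c| by linarith [le_abs_self c]) ht.1.le]
      calc |Real.exp (t * P.mu k) * a k - a k| ≤ |Real.exp (t * P.mu k) * a k| + |a k| :=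
            abs_sub _ _
        _ = (Real.exp (t * P.mu k) + 1) * |a k| := by rw [abs_mul, Real.abs_exp]; ring
        _ ≤ _ := mul_le_mul_of_nonneg_right (by linarith) (abs_nonneg _)
  rw [tsum_zero] at hlim
  refine hlim.congr' ?_
  filter_upwards [self_mem_nhdsWithin] with t ht
  rw [Ell.norm_def]
  refine tsum_congr fun k => ?_
  rw [Ell.sub_apply, heat_apply h1 ht, mul_one]

end PDEData
end

noncomputable section
namespace PDEData

open MeasureTheory

/-! ### Beta integrals -/

/-- The beta integral `∫₀¹ (1 - x)^(-α) x^(-β) dx`. -/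
def betaConst (α β : ℝ) : ℝ := ∫ x in (0 : ℝ)..1, (1 - x) ^ (-α) * x ^ (-β)

/-- The integrand is the norm of that of the complex beta integral with parameters 1 - β and 1 - α.
They agree for 0 < x < 1; the point x = 1 is discarded as a null set. -/
lemma intervalIntegrable_beta_unit {α β : ℝ} (hα : α < 1) (hβ : β < 1) :
    IntervalIntegrable (fun x : ℝ => (1 - x) ^ (-α) * x ^ (-β)) volume 0 1 := by
  have h := (Complex.betaIntegral_convergent (u := ((1 - β : ℝ) : ℂ)) (v := ((1 - α : ℝ) : ℂ))
    (by simpa using hβ) (by simpa using hα)).norm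
  refine h.congr_ae ?_
  rw [uIoc_of_le zero_le_one]
  have h1 : ∀ᵐ x : ℝ ∂volume.restrict (Ioc 0 1), x ≠ 1 :=
    
    ae_restrict_of_ae (compl_mem_ae_iff.2 (measure_singleton 1))
  filter_upwards [h1, ae_restrict_mem measurableSet_Ioc] with x hx1 hx
  have hx' : 0 < 1 - x := sub_pos.2 (lt_of_le_of_ne hx.2 hx1)
  rw [norm_mul, Complex.norm_cpow_eq_rpow_re_of_pos hx.1]
  have : (1 - (x : ℂ)) = ((1 - x : ℝ) : ℂ) := by push_cast; ring
  rw [this, Complex.norm_cpow_eq_rpow_re_of_pos hx', mul_comm]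
  congr 2 <;> simp

lemma betaConst_nonneg (α β : ℝ) : 0 ≤ betaConst α β := by
  refine intervalIntegral.integral_nonneg zero_le_one fun x hx => ?_
  exact mul_nonneg (Real.rpow_nonneg (by linarith [hx.2]) _) (Real.rpow_nonneg hx.1 _)

lemma beta_scale {α β a t x : ℝ} (ht : a < t) (hx0 : 0 ≤ x) (hx1 : x ≤ 1) :
    (t - (a + (t - a) * x)) ^ (-α) * (a + (t - a) * x - a) ^ (-β) =
      (t - a) ^ (-α - β) * ((1 - x) ^ (-α) * x ^ (-β)) := by
  have h0 : 0 < t - a := by linarith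
  have h1 : t - (a + (t - a) * x) = (t - a) * (1 - x) := by ring
  have h2 : a + (t - a) * x - a = (t - a) * x := by ring
  rw [h1, h2, Real.mul_rpow h0.le (by linarith), Real.mul_rpow h0.le hx0, sub_eq_add_neg (-α),
    Real.rpow_add h0]
  ring

lemma intervalIntegrable_beta {α β a t : ℝ} (hα : α < 1) (hβ : β < 1) (ht : a < t) :
    IntervalIntegrable (fun r : ℝ => (t - r) ^ (-α) * (r - a) ^ (-β)) volume a t := by
  have h0 : 0 < t - a := by linarith
  have h := (((intervalIntegrable_beta_unit hα hβ).comp_mul_left (c := (t - a)⁻¹)).comp_sub_right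
    a).const_mul ((t - a) ^ (-α - β))
  have e1 : 0 / (t - a)⁻¹ + a = a := by simp
  have e2 : 1 / (t - a)⁻¹ + a = t := by simp
  rw [e1, e2] at h
  refine h.congr_ae ?_
  rw [uIoc_of_le ht.le]
  filter_upwards [ae_restrict_mem measurableSet_Ioc] with r hr
  have h3 := beta_scale (α := α) (β := β) (x := (t - a)⁻¹ * (r - a)) ht
    (mul_nonneg (inv_pos.2 h0).le (by linarith [hr.1])) (by
      rw [inv_mul_eq_div, div_le_one h0]
      linarith [hr.2])
  rw [← h3, mul_inv_cancel_left₀ h0.ne', add_sub_cancel]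

lemma integral_beta {α β a t : ℝ} (ht : a < t) :
    ∫ r in a..t, (t - r) ^ (-α) * (r - a) ^ (-β) = (t - a) ^ (1 - α - β) * betaConst α β := by
  have h0 : 0 < t - a := by linarith
  have h := intervalIntegral.smul_integral_comp_add_mul (a := 0) (b := 1)
    (fun r : ℝ => (t - r) ^ (-α) * (r - a) ^ (-β)) (t - a) a
  rw [mul_zero, add_zero, mul_one, add_sub_cancel] at h
  rw [← h]
  have h1 : ∫ x in (0 : ℝ)..1, (t - (a + (t - a) * x)) ^ (-α) * (a + (t - a) * x - a) ^ (-β) =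
      ∫ x in (0 : ℝ)..1, (t - a) ^ (-α - β) * ((1 - x) ^ (-α) * x ^ (-β)) := by
    refine intervalIntegral.integral_congr fun x hx => ?_
    rw [uIcc_of_le zero_le_one] at hx
    exact beta_scale ht hx.1 hx.2
  rw [h1, intervalIntegral.integral_const_mul, smul_eq_mul, ← mul_assoc, betaConst]
  congr 1
  rw [show 1 - α - β = 1 + (-α - β) by ring, Real.rpow_add h0, Real.rpow_one]

/-! ### Singular Volterra equations -/

variable {F : Type*} [NormedAddCommGroup F]

/-- A kernel on `a < r < t ≤ b`, Lipschitz in the unknown, with a square root singularity. -/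
structure VolterraKernel (Ψ : ℝ → ℝ → F → F) (a b M : ℝ) : Prop where
  cont : ContinuousOn (fun p : ℝ × ℝ × F => Ψ p.1 p.2.1 p.2.2)
    {p | a < p.2.1 ∧ p.2.1 < p.1 ∧ p.1 ≤ b}
  nonneg : 0 ≤ M
  lip : ∀ t r x y, a < r → r < t → t ≤ b →
    ‖Ψ t r x - Ψ t r y‖ ≤ M * (t - r) ^ (-(1 / 2) : ℝ) * ‖x - y‖
  zero : ∀ t r, a < r → r < t → t ≤ b → ‖Ψ t r 0‖ ≤ M * (t - r) ^ (-(1 / 2) : ℝ)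

/-- Continuous functions on `(a, b]` of order `(t - a)^(-1/2)` at `a`. -/
structure SingularAt (v : ℝ → F) (a b C : ℝ) : Prop where
  cont : ContinuousOn v (Ioc a b)
  bound : ∀ t ∈ Ioc a b, ‖v t‖ ≤ C * (t - a) ^ (-(1 / 2) : ℝ)

lemma SingularAt.nonneg {v : ℝ → F} {a b C : ℝ} (hv : SingularAt v a b C) (hab : a < b) :
    0 ≤ C := by
  have h := (norm_nonneg _).trans (hv.bound b ⟨hab, le_rfl⟩)
  exact nonneg_of_mul_nonneg_left h (Real.rpow_pos_of_pos (by linarith) _)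

namespace VolterraKernel

variable {Ψ : ℝ → ℝ → F → F} {a b M C : ℝ} {v w : ℝ → F}

lemma norm_le (hΨ : VolterraKernel Ψ a b M) (hv : SingularAt v a b C) {r t : ℝ} (h1 : a < r)
    (h2 : r < t) (h3 : t ≤ b) :
    ‖Ψ t r (v r)‖ ≤ M * (C + (b - a) ^ (1 / 2 : ℝ)) *
      ((t - r) ^ (-(1 / 2) : ℝ) * (r - a) ^ (-(1 / 2) : ℝ)) := by
  have e1 := hΨ.lip t r (v r) 0 h1 h2 h3
  have e2 := hΨ.zero t r h1 h2 h3
  have e3 := hv.bound r ⟨h1, by linarith⟩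
  rw [sub_zero] at e1
  -- Absorbs the part of the kernel that does not depend on the unknown into the weight (r -
  -- a)^(-1/2); hence the summand (b - a)^(1/2) next to C.
  have e4 : 1 ≤ (b - a) ^ (1 / 2 : ℝ) * (r - a) ^ (-(1 / 2) : ℝ) := by
    rw [Real.rpow_neg (by linarith), ← div_eq_mul_inv, one_le_div
      (Real.rpow_pos_of_pos (by linarith) _)]
    exact Real.rpow_le_rpow (by linarith) (by linarith) (by norm_num)
  have e5 : 0 ≤ M * (t - r) ^ (-(1 / 2) : ℝ) :=
    mul_nonneg hΨ.nonneg (Real.rpow_nonneg (by linarith) _)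
  calc ‖Ψ t r (v r)‖ ≤ ‖Ψ t r (v r) - Ψ t r 0‖ + ‖Ψ t r 0‖ := by
        simpa using norm_add_le (Ψ t r (v r) - Ψ t r 0) (Ψ t r 0)
    _ ≤ M * (t - r) ^ (-(1 / 2) : ℝ) * ‖v r‖ + M * (t - r) ^ (-(1 / 2) : ℝ) * 1 := by linarith
    _ ≤ M * (t - r) ^ (-(1 / 2) : ℝ) * (C * (r - a) ^ (-(1 / 2) : ℝ)) +
          M * (t - r) ^ (-(1 / 2) : ℝ) * ((b - a) ^ (1 / 2 : ℝ) * (r - a) ^ (-(1 / 2) : ℝ)) :=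
        add_le_add (mul_le_mul_of_nonneg_left e3 e5) (mul_le_mul_of_nonneg_left e4 e5)
    _ = _ := by ring

lemma continuousOn_integrand (hΨ : VolterraKernel Ψ a b M) (hv : ContinuousOn v (Ioc a b)) {t : ℝ}
    (ht : t ∈ Ioc a b) : ContinuousOn (fun r => Ψ t r (v r)) (Ioo a t) := by
  refine hΨ.cont.comp (f := fun r => (t, r, v r)) ?_ fun r hr => ⟨hr.1, hr.2, ht.2⟩
  exact continuousOn_const.prodMk (continuousOn_id.prodMk
    (hv.mono fun r hr => ⟨hr.1, hr.2.le.trans ht.2⟩))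

lemma intervalIntegrable (hΨ : VolterraKernel Ψ a b M) (hv : SingularAt v a b C) {t : ℝ}
    (ht : t ∈ Ioc a b) : IntervalIntegrable (fun r => Ψ t r (v r)) volume a t := by
  rw [intervalIntegrable_iff_integrableOn_Ioo_of_le ht.1.le]
  have hb := (intervalIntegrable_beta (α := 1 / 2) (β := 1 / 2) (by norm_num) (by norm_num)
    ht.1).const_mul (M * (C + (b - a) ^ (1 / 2 : ℝ)))
  rw [intervalIntegrable_iff_integrableOn_Ioo_of_le ht.1.le] at hb
  refine Integrable.mono' hb
    ((hΨ.continuousOn_integrand hv.cont ht).aestronglyMeasurable measurableSet_Ioo) ?_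
  filter_upwards [ae_restrict_mem measurableSet_Ioo] with r hr
  exact hΨ.norm_le hv hr.1 hr.2 ht.2

variable [NormedSpace ℝ F]

/-- The exponents 1/2 and 1/2 make the beta integral independent of the length of the interval. So
the integral term stays bounded up to t = a, although the unknown may blow up there. -/
lemma norm_integral_le (hΨ : VolterraKernel Ψ a b M) (hv : SingularAt v a b C) {t : ℝ}
    (ht : t ∈ Ioc a b) : ‖∫ r in a..t, Ψ t r (v r)‖ ≤
      M * (C + (b - a) ^ (1 / 2 : ℝ)) * betaConst (1 / 2) (1 / 2) := by
  have hb := (intervalIntegrable_beta (α := 1 / 2) (β := 1 / 2) (by norm_num) (by norm_num)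
    ht.1).const_mul (M * (C + (b - a) ^ (1 / 2 : ℝ)))
  have h := intervalIntegral.norm_integral_le_of_norm_le (g := fun r =>
    M * (C + (b - a) ^ (1 / 2 : ℝ)) * ((t - r) ^ (-(1 / 2) : ℝ) * (r - a) ^ (-(1 / 2) : ℝ)))
    (f := fun r => Ψ t r (v r)) ht.1.le ?_ hb
  · rw [intervalIntegral.integral_const_mul, integral_beta ht.1] at h
    norm_num at h
    simpa using h
  · have h1 : ∀ᵐ r : ℝ, r ≠ t := compl_mem_ae_iff.2 (measure_singleton t)
    filter_upwards [h1] with r hr hr'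
    exact hΨ.norm_le hv hr'.1 (lt_of_le_of_ne hr'.2 hr) ht.2

/-- The substitution r = a + (t - a)x fixes the domain of integration, and the factor t - a cancels
the scaling (t - a)^(-1) of the bound. The majorant no longer depends on t, so dominated convergence
applies. -/
lemma continuousOn_integral (hΨ : VolterraKernel Ψ a b M) (hv : SingularAt v a b C) :
    ContinuousOn (fun t => ∫ r in a..t, Ψ t r (v r)) (Ioc a b) := by
  have hsub : ∀ t, ∫ r in a..t, Ψ t r (v r) =
      ∫ x in (0 : ℝ)..1, (t - a) • Ψ t (a + (t - a) * x) (v (a + (t - a) * x)) := fun t => by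
    have h := intervalIntegral.smul_integral_comp_add_mul (a := 0) (b := 1)
      (fun r : ℝ => Ψ t r (v r)) (t - a) a
    rw [mul_zero, add_zero, mul_one, add_sub_cancel] at h
    rw [← h, intervalIntegral.integral_smul]
  simp_rw [hsub]
  have hmem : ∀ t ∈ Ioc a b, ∀ x ∈ Ioo (0 : ℝ) 1, a + (t - a) * x ∈ Ioo a t := by
    intro t ht x hx
    have h0 : 0 < t - a := by linarith [ht.1]
    constructor
    · nlinarith [mul_pos h0 hx.1]
    · nlinarith [mul_pos h0 (sub_pos.2 hx.2)]
  have h1 : ∀ᵐ x : ℝ, x ≠ 1 := compl_mem_ae_iff.2 (measure_singleton 1)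
  have hb := (intervalIntegrable_beta_unit (α := 1 / 2) (β := 1 / 2) (by norm_num)
    (by norm_num)).const_mul (M * (C + (b - a) ^ (1 / 2 : ℝ)))
  intro t ht
  refine intervalIntegral.continuousWithinAt_of_dominated_interval ?_ ?_ hb ?_
  · filter_upwards [self_mem_nhdsWithin] with s hs
    rw [uIoc_of_le zero_le_one, ← restrict_Ioo_eq_restrict_Ioc]
    refine ContinuousOn.aestronglyMeasurable ?_ measurableSet_Ioo
    refine continuousOn_const.smul ?_
    exact (hΨ.continuousOn_integrand hv.cont hs).comp (f := fun x => a + (s - a) * x)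
      (Continuous.continuousOn (by fun_prop)) fun x hx => hmem s hs x hx
  · filter_upwards [self_mem_nhdsWithin] with s hs
    filter_upwards [h1] with x hx hx'
    rw [uIoc_of_le zero_le_one] at hx'
    have hx2 : x ∈ Ioo (0 : ℝ) 1 := ⟨hx'.1, lt_of_le_of_ne hx'.2 hx⟩
    have h0 : 0 < s - a := by linarith [hs.1]
    have h3 := hΨ.norm_le hv (hmem s hs x hx2).1 (hmem s hs x hx2).2 hs.2
    rw [beta_scale hs.1 hx2.1.le hx2.2.le] at h3
    rw [norm_smul, Real.norm_of_nonneg h0.le]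
    refine (mul_le_mul_of_nonneg_left h3 h0.le).trans (le_of_eq ?_)
    have h4 : (s - a) * (s - a) ^ (-(1 / 2) - 1 / 2 : ℝ) = 1 := by
      rw [show (-(1 / 2) - 1 / 2 : ℝ) = -1 by norm_num, Real.rpow_neg_one, mul_inv_cancel₀ h0.ne']
    linear_combination (M * (C + (b - a) ^ (1 / 2 : ℝ)) *
      ((1 - x) ^ (-(1 / 2) : ℝ) * x ^ (-(1 / 2) : ℝ))) * h4
  · filter_upwards [h1] with x hx hx'
    rw [uIoc_of_le zero_le_one] at hx'
    have hx2 : x ∈ Ioo (0 : ℝ) 1 := ⟨hx'.1, lt_of_le_of_ne hx'.2 hx⟩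
    have hc : ContinuousOn (fun s => (s - a) • Ψ s (a + (s - a) * x) (v (a + (s - a) * x)))
        (Ioc a b) := by
      refine ContinuousOn.smul (by fun_prop) ?_
      refine hΨ.cont.comp (f := fun s => (s, a + (s - a) * x, v (a + (s - a) * x))) ?_
        fun s hs => ⟨(hmem s hs x hx2).1, (hmem s hs x hx2).2, hs.2⟩
      refine continuousOn_id.prodMk (ContinuousOn.prodMk (by fun_prop) ?_)
      exact hv.cont.comp (by fun_prop) fun s hs =>
        ⟨(hmem s hs x hx2).1, (hmem s hs x hx2).2.le.trans hs.2⟩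
    exact hc t ht

/-- The weights which turn the Volterra operator into a contraction. -/
def weight (a l t : ℝ) : ℝ := (t - a) ^ (-(1 / 2) : ℝ) * Real.exp (l * (t - a))

lemma weight_pos {a l t : ℝ} (h : a < t) : 0 < weight a l t :=
  mul_pos (Real.rpow_pos_of_pos (by linarith) _) (Real.exp_pos _)

/-- Split (t - r)^(-1/2) = (t - r)^(-3/4) (t - r)^(1/4) and bound (t - r)^(1/4) e^{-l(t - r)} by
l^(-1/4). The remaining beta integral with exponents 3/4 and 1/2 gives (t - a)^(1/4) (t - a)^(-1/2),
hence the weight again. Large l makes the factor at most 1/2. -/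
lemma exists_contraction (hΨ : VolterraKernel Ψ a b M) :
    ∃ l : ℝ, 0 < l ∧ ∀ (C C' κ : ℝ) (v w : ℝ → F), 0 ≤ κ → SingularAt v a b C →
      SingularAt w a b C' → (∀ r ∈ Ioc a b, ‖v r - w r‖ ≤ κ * weight a l r) →
      ∀ t ∈ Ioc a b, ‖(∫ r in a..t, Ψ t r (v r)) - ∫ r in a..t, Ψ t r (w r)‖ ≤
        1 / 2 * κ * weight a l t := by
  have hlim : Tendsto (fun l : ℝ => M * (b - a) ^ (1 / 4 : ℝ) * betaConst (3 / 4) (1 / 2) *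
      l ^ (-(1 / 4) : ℝ)) atTop (𝓝 0) := by
    simpa using (tendsto_rpow_neg_atTop (by norm_num : (0 : ℝ) < 1 / 4)).const_mul
      (M * (b - a) ^ (1 / 4 : ℝ) * betaConst (3 / 4) (1 / 2))
  obtain ⟨l, hl, hl0⟩ := ((hlim.eventually (Iic_mem_nhds (by norm_num : (0 : ℝ) < 1 / 2))).and
    (eventually_gt_atTop 0)).exists
  refine ⟨l, hl0, fun C C' κ v w hκ hv hw hvw t ht => ?_⟩
  have h0 : 0 < t - a := by linarith [ht.1]
  rw [← intervalIntegral.integral_sub (hΨ.intervalIntegrable hv ht) (hΨ.intervalIntegrable hw ht)]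
  have hM := hΨ.nonneg
  have hb := (intervalIntegrable_beta (α := 3 / 4) (β := 1 / 2) (by norm_num) (by norm_num)
    ht.1).const_mul (κ * M * l ^ (-(1 / 4) : ℝ) * Real.exp (l * (t - a)))
  have h := intervalIntegral.norm_integral_le_of_norm_le (g := fun r =>
    κ * M * l ^ (-(1 / 4) : ℝ) * Real.exp (l * (t - a)) *
      ((t - r) ^ (-(3 / 4) : ℝ) * (r - a) ^ (-(1 / 2) : ℝ)))
    (f := fun r => Ψ t r (v r) - Ψ t r (w r)) ht.1.le ?_ hb
  · refine h.trans ?_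
    rw [intervalIntegral.integral_const_mul, integral_beta ht.1]
    have e1 : (t - a) ^ (1 - 3 / 4 - 1 / 2 : ℝ) = (t - a) ^ (1 / 4 : ℝ) * (t - a) ^ (-(1 / 2) : ℝ) := by
      rw [← Real.rpow_add h0]
      norm_num
    have e2 : (t - a) ^ (1 / 4 : ℝ) ≤ (b - a) ^ (1 / 4 : ℝ) :=
      Real.rpow_le_rpow h0.le (by linarith [ht.2]) (by norm_num)
    have e3 : M * (t - a) ^ (1 / 4 : ℝ) * betaConst (3 / 4) (1 / 2) * l ^ (-(1 / 4) : ℝ) ≤ 1 / 2 := by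
      refine le_trans ?_ hl
      have := betaConst_nonneg (3 / 4) (1 / 2)
      gcongr
    rw [e1]
    have e4 : 0 ≤ κ * weight a l t := mul_nonneg hκ (weight_pos ht.1).le
    calc _ = (M * (t - a) ^ (1 / 4 : ℝ) * betaConst (3 / 4) (1 / 2) * l ^ (-(1 / 4) : ℝ)) *
          (κ * weight a l t) := by unfold weight; ring
      _ ≤ 1 / 2 * (κ * weight a l t) := mul_le_mul_of_nonneg_right e3 e4
      _ = _ := by ring
  · have h1 : ∀ᵐ r : ℝ, r ≠ t := compl_mem_ae_iff.2 (measure_singleton t)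
    filter_upwards [h1] with r hr hr'
    have hrt : 0 < t - r := sub_pos.2 (lt_of_le_of_ne hr'.2 hr)
    have hra : 0 < r - a := by linarith [hr'.1]
    have e1 := hΨ.lip t r (v r) (w r) hr'.1 (by linarith) ht.2
    have e2 := hvw r ⟨hr'.1, hr'.2.trans ht.2⟩
    have e3 := rpow_mul_exp_neg_le (s := 1 / 4) (by norm_num) (by norm_num) hl0 hrt.le
    have e4 : Real.exp (l * (r - a)) = Real.exp (l * (t - a)) * Real.exp (-(l * (t - r))) := by
      rw [← Real.exp_add]
      ring_nf
    have e5 : (t - r) ^ (-(1 / 2) : ℝ) = (t - r) ^ (-(3 / 4) : ℝ) * (t - r) ^ (1 / 4 : ℝ) := by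
      rw [← Real.rpow_add hrt]
      norm_num
    have p1 := Real.rpow_nonneg hrt.le (-(3 / 4))
    have p2 := Real.rpow_nonneg hra.le (-(1 / 2))
    have p3 := Real.rpow_nonneg hrt.le (-(1 / 2))
    calc _ ≤ M * (t - r) ^ (-(1 / 2) : ℝ) * (κ * weight a l r) :=
          e1.trans (mul_le_mul_of_nonneg_left e2 (mul_nonneg hM p3))
      _ = (κ * M * Real.exp (l * (t - a)) * ((t - r) ^ (-(3 / 4) : ℝ) *
            (r - a) ^ (-(1 / 2) : ℝ))) *
            ((t - r) ^ (1 / 4 : ℝ) * Real.exp (-(l * (t - r)))) := by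
          unfold weight
          rw [e4, e5]
          ring
      _ ≤ (κ * M * Real.exp (l * (t - a)) * ((t - r) ^ (-(3 / 4) : ℝ) *
            (r - a) ^ (-(1 / 2) : ℝ))) * l ^ (-(1 / 4) : ℝ) :=
          mul_le_mul_of_nonneg_left e3 (by positivity)
      _ = _ := by ring

/-- Solutions of singular Volterra equations are unique. -/
theorem unique (hΨ : VolterraKernel Ψ a b M) {C' : ℝ} {v0 : ℝ → F} (hab : a < b)
    (hv : SingularAt v a b C) (hw : SingularAt w a b C')
    (ev : ∀ t ∈ Ioc a b, v t = v0 t + ∫ r in a..t, Ψ t r (v r))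
    (ew : ∀ t ∈ Ioc a b, w t = v0 t + ∫ r in a..t, Ψ t r (w r)) : EqOn v w (Ioc a b) := by
  obtain ⟨l, hl, hc⟩ := hΨ.exists_contraction
  have hC := hv.nonneg hab
  have hC' := hw.nonneg hab
  -- Both functions are O((t - a)^(-1/2)), so their difference is finite in the weighted norm; each
  -- use of the equation then halves it.
  have key : ∀ n : ℕ, ∀ t ∈ Ioc a b, ‖v t - w t‖ ≤ (C + C') * (1 / 2) ^ n * weight a l t := by
    intro n
    induction n with
    | zero =>
      intro t ht
      have h1 := hv.bound t ht
      have h2 := hw.bound t ht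
      have h3 : (t - a) ^ (-(1 / 2) : ℝ) ≤ weight a l t :=
        le_mul_of_one_le_right (Real.rpow_nonneg (by linarith [ht.1]) _)
          (Real.one_le_exp (mul_nonneg hl.le (by linarith [ht.1])))
      calc ‖v t - w t‖ ≤ ‖v t‖ + ‖w t‖ := norm_sub_le _ _
        _ ≤ (C + C') * (t - a) ^ (-(1 / 2) : ℝ) := by linarith
        _ ≤ (C + C') * weight a l t := mul_le_mul_of_nonneg_left h3 (by linarith)
        _ = _ := by simp
    | succ n ih =>
      intro t ht
      have h1 := hc C C' ((C + C') * (1 / 2) ^ n) v w (by positivity) hv hw ih t ht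
      rw [ev t ht, ew t ht, add_sub_add_left_eq_sub]
      refine h1.trans (le_of_eq ?_)
      ring
  intro t ht
  have hlim : Tendsto (fun n : ℕ => (C + C') * (1 / 2) ^ n * weight a l t) atTop (𝓝 0) := by
    have := ((tendsto_pow_atTop_nhds_zero_of_lt_one (r := (1 / 2 : ℝ)) (by norm_num)
      (by norm_num)).const_mul (C + C')).mul_const (weight a l t)
    simpa using this
  have h := ge_of_tendsto' hlim fun n => key n t ht
  exact sub_eq_zero.1 (norm_le_zero_iff.1 h)

open BoundedContinuousFunction in
/-- Existence of solutions of singular Volterra equations. -/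
theorem exists_solution [CompleteSpace F] (hΨ : VolterraKernel Ψ a b M) (hab : a < b)
    {v0 : ℝ → F} (hv0 : SingularAt v0 a b C) :
    ∃ (v : ℝ → F) (C' : ℝ), SingularAt v a b C' ∧
      ∀ t ∈ Ioc a b, v t = v0 t + ∫ r in a..t, Ψ t r (v r) := by
  obtain ⟨l, hl, hc⟩ := hΨ.exists_contraction
  have hwc : ContinuousOn (weight a l) (Ioc a b) := by
    unfold weight
    refine ContinuousOn.mul ?_ (by fun_prop)
    exact ContinuousOn.rpow_const (by fun_prop) fun t ht => Or.inl (by linarith [ht.1])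
  -- The unknown is written as weight times y, with y in the complete space of bounded continuous
  -- functions on (a, b]. The fixed point is taken for y.
  obtain ⟨val, hval⟩ : ∃ val : (Ioc a b →ᵇ F) → ℝ → F, ∀ y t (h : t ∈ Ioc a b),
      val y t = weight a l t • y ⟨t, h⟩ := by
    classical
    exact ⟨fun y t => if h : t ∈ Ioc a b then weight a l t • y ⟨t, h⟩ else 0,
      fun y t h => dif_pos h⟩
  have hvalS : ∀ y, SingularAt (val y) a b (‖y‖ * Real.exp (l * (b - a))) := fun y => by
    constructor
    · rw [continuousOn_iff_continuous_domRestrict]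
      have : (Ioc a b).domRestrict (val y) = fun t : Ioc a b => weight a l t • y t := by
        funext t
        exact hval y t t.2
      rw [this]
      exact (continuousOn_iff_continuous_domRestrict.1 hwc).smul y.continuous
    · intro t ht
      rw [hval y t ht, norm_smul, Real.norm_of_nonneg (weight_pos ht.1).le]
      have h1 : weight a l t ≤ (t - a) ^ (-(1 / 2) : ℝ) * Real.exp (l * (b - a)) :=
        mul_le_mul_of_nonneg_left
          (Real.exp_le_exp.2 (mul_le_mul_of_nonneg_left (by linarith [ht.2]) hl.le))
          (Real.rpow_nonneg (by linarith [ht.1]) _)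
      calc _ ≤ ((t - a) ^ (-(1 / 2) : ℝ) * Real.exp (l * (b - a))) * ‖y‖ :=
            mul_le_mul h1 (y.norm_coe_le_norm _) (norm_nonneg _)
              (mul_nonneg (Real.rpow_nonneg (by linarith [ht.1]) _) (Real.exp_pos _).le)
        _ = _ := by ring
  have hT : ∀ y : Ioc a b →ᵇ F, ∃ z : Ioc a b →ᵇ F, ∀ t : Ioc a b,
      weight a l t • z t = v0 t + ∫ r in a..t, Ψ t r (val y r) := fun y => by
    have hcont : ContinuousOn (fun t => (weight a l t)⁻¹ •
        (v0 t + ∫ r in a..t, Ψ t r (val y r))) (Ioc a b) :=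
      (hwc.inv₀ fun t ht => (weight_pos ht.1).ne').smul
        (hv0.cont.add (hΨ.continuousOn_integral (hvalS y)))
    -- The bounded integral term is estimated against the weight, which is at least (t - a)^(-1/2) ≥
    -- (b - a)^(-1/2); hence the bound C + D (b - a)^(1/2) for the new y.
    set D := M * (‖y‖ * Real.exp (l * (b - a)) + (b - a) ^ (1 / 2 : ℝ)) * betaConst (1 / 2) (1 / 2)
    have hD : 0 ≤ D := (norm_nonneg _).trans (hΨ.norm_integral_le (hvalS y) ⟨hab, le_rfl⟩)
    refine ⟨BoundedContinuousFunction.ofNormedAddCommGroup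
      (fun t : Ioc a b => (weight a l t)⁻¹ • (v0 t + ∫ r in a..t, Ψ t r (val y r)))
      (continuousOn_iff_continuous_domRestrict.1 hcont) (C + D * (b - a) ^ (1 / 2 : ℝ)) fun t => ?_,
      fun t => ?_⟩
    · have h0 : 0 < (t : ℝ) - a := by linarith [t.2.1]
      have h1 := hv0.bound t t.2
      have h2 := hΨ.norm_integral_le (hvalS y) t.2
      have h3 : ((t : ℝ) - a) ^ (-(1 / 2) : ℝ) ≤ weight a l t :=
        le_mul_of_one_le_right (Real.rpow_nonneg h0.le _)
          (Real.one_le_exp (mul_nonneg hl.le h0.le))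
      have h4 : 1 ≤ (b - a) ^ (1 / 2 : ℝ) * ((t : ℝ) - a) ^ (-(1 / 2) : ℝ) := by
        rw [Real.rpow_neg h0.le, ← div_eq_mul_inv, one_le_div (Real.rpow_pos_of_pos h0 _)]
        exact Real.rpow_le_rpow h0.le (by linarith [t.2.2]) (by norm_num)
      have hC := hv0.nonneg hab
      rw [norm_smul, norm_inv, Real.norm_of_nonneg (weight_pos t.2.1).le, inv_mul_eq_div,
        div_le_iff₀ (weight_pos t.2.1)]
      calc _ ≤ C * ((t : ℝ) - a) ^ (-(1 / 2) : ℝ) + D * 1 :=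
            (norm_add_le _ _).trans (by linarith)
        _ ≤ C * ((t : ℝ) - a) ^ (-(1 / 2) : ℝ) +
            D * ((b - a) ^ (1 / 2 : ℝ) * ((t : ℝ) - a) ^ (-(1 / 2) : ℝ)) := by gcongr
        _ = (C + D * (b - a) ^ (1 / 2 : ℝ)) * ((t : ℝ) - a) ^ (-(1 / 2) : ℝ) := by ring
        _ ≤ _ := mul_le_mul_of_nonneg_left h3 (by
            have := Real.rpow_nonneg (by linarith : 0 ≤ b - a) (1 / 2)
            positivity)
    · exact smul_inv_smul₀ (weight_pos t.2.1).ne' _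
  choose T hT using hT
  have hcontr : ContractingWith (1 / 2) T := by
    refine ⟨by rw [← NNReal.coe_lt_coe]; norm_num, LipschitzWith.of_dist_le_mul fun y z => ?_⟩
    have hd : 0 ≤ dist y z := dist_nonneg
    refine (BoundedContinuousFunction.dist_le (by positivity)).2 fun t => ?_
    have h1 := hc _ _ (dist y z) (val y) (val z) hd (hvalS y) (hvalS z) (fun r hr => by
      rw [hval y r hr, hval z r hr, ← smul_sub, norm_smul,
        Real.norm_of_nonneg (weight_pos hr.1).le, mul_comm, ← dist_eq_norm]
      exact mul_le_mul_of_nonneg_right (BoundedContinuousFunction.dist_coe_le_dist _)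
        (weight_pos hr.1).le) t t.2
    rw [← add_sub_add_left_eq_sub _ _ (v0 t), ← hT y t, ← hT z t, ← smul_sub, norm_smul,
      Real.norm_of_nonneg (weight_pos t.2.1).le, mul_comm] at h1
    rw [dist_eq_norm]
    have h2 := le_of_mul_le_mul_right h1 (weight_pos t.2.1)
    simpa using h2
  set y := hcontr.fixedPoint with hy
  have hfix : T y = y := hcontr.fixedPoint_isFixedPt
  refine ⟨val y, _, hvalS y, fun t ht => ?_⟩
  rw [← hT y ⟨t, ht⟩, hfix, hval y t ht]

end VolterraKernel

end PDEData
end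

noncomputable section
namespace PDEData

open MeasureTheory

variable {d : ℕ} {P : PDEData d}

/-! ### Integrals against the semigroup -/

/-- The map is continuous on the open half plane where the time difference is positive, and it
vanishes elsewhere by the convention for `heat`. -/
lemma HalfOrder.aestronglyMeasurable_heat_sub {D : (Fin d → ℕ) → ℝ} (hD : P.HalfOrder D)
    (μ : Measure (ℝ × ℝ)) :
    AEStronglyMeasurable (fun p : ℝ × ℝ => P.heat D (p.1 - p.2)) μ := by
  have hs : MeasurableSet {p : ℝ × ℝ | p.2 < p.1} :=
    measurableSet_lt measurable_snd measurable_fst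
  have h1 : ContinuousOn (fun p : ℝ × ℝ => P.heat D (p.1 - p.2)) {p | p.2 < p.1} :=
    hD.continuousOn_heat.comp (Continuous.continuousOn (by fun_prop))
      fun p (hp : p.2 < p.1) => sub_pos.2 hp
  have h2 := (aestronglyMeasurable_indicator_iff hs).2
    (h1.aestronglyMeasurable (μ := μ) hs)
  refine h2.congr (Eventually.of_forall fun p => ?_)
  by_cases hp : p.2 < p.1
  · exact indicator_of_mem (s := {p : ℝ × ℝ | p.2 < p.1}) hp _
  · rw [indicator_of_notMem (s := {p : ℝ × ℝ | p.2 < p.1}) hp]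
    exact (heat_of_nonpos (sub_nonpos.2 (not_lt.1 hp))).symm

lemma _root_.MeasureTheory.AEStronglyMeasurable.clm_apply' {X E G : Type*} [MeasurableSpace X]
    [NormedAddCommGroup E] [NormedSpace ℝ E] [NormedAddCommGroup G] [NormedSpace ℝ G]
    {μ : Measure X} {f : X → E →L[ℝ] G} {g : X → E} (hf : AEStronglyMeasurable f μ)
    (hg : AEStronglyMeasurable g μ) : AEStronglyMeasurable (fun x => f x (g x)) μ :=
  (isBoundedBilinearMap_apply (𝕜 := ℝ) (E := E) (F := G)).continuous.comp_aestronglyMeasurable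
    (hf.prodMk hg)

lemma HalfOrder.continuousOn_heat_sub_left {D : (Fin d → ℕ) → ℝ} (hD : P.HalfOrder D) (t : ℝ) :
    ContinuousOn (fun r => P.heat D (t - r)) (Iio t) :=
  hD.continuousOn_heat.comp (Continuous.continuousOn (by fun_prop)) fun _ hr => mem_Ioi.2 (sub_pos.2 hr)

lemma HalfOrder.continuousOn_heat_sub_right {D : (Fin d → ℕ) → ℝ} (hD : P.HalfOrder D) (s : ℝ) :
    ContinuousOn (fun r => P.heat D (r - s)) (Ioi s) :=
  hD.continuousOn_heat.comp (Continuous.continuousOn (by fun_prop)) fun _ hr => mem_Ioi.2 (sub_pos.2 hr)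

section Fubini

variable {B : ℝ → P.Ell →L[ℝ] P.Ell} {s t C : ℝ} {D : (Fin d → ℕ) → ℝ} {H : ℝ → P.Ell}

lemma integrableOn_comp_heat (hD : P.HalfOrder D)
    (hB : ContinuousOn B (Ioo s t)) (hBC : ∀ r ∈ Ioo s t, ‖B r‖ ≤ C * (t - r) ^ (-(1 / 2) : ℝ))
    {y : ℝ} (hy : y ∈ Ico s t) :
    IntegrableOn (fun r => B r ∘L P.heat D (r - y)) (Ioo y t) := by
  obtain ⟨M, hM0, hM⟩ := hD.exists_norm_heat_le (t - s)
  have hb := (intervalIntegrable_beta (α := 1 / 2) (β := 1 / 2) (by norm_num) (by norm_num)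
    hy.2).const_mul (C * M)
  rw [intervalIntegrable_iff_integrableOn_Ioo_of_le hy.2.le] at hb
  refine Integrable.mono' hb ?_ ?_
  · refine ContinuousOn.aestronglyMeasurable ?_ measurableSet_Ioo
    exact (hB.mono (Ioo_subset_Ioo_left hy.1)).clm_comp
      ((hD.continuousOn_heat_sub_right y).mono fun r hr => hr.1)
  · filter_upwards [ae_restrict_mem measurableSet_Ioo] with r hr
    have h1 := hBC r ⟨hy.1.trans_lt hr.1, hr.2⟩
    have h2 := hM (r - y) (by linarith [hr.1]) (by linarith [hr.2, hy.1])
    calc _ ≤ ‖B r‖ * ‖P.heat D (r - y)‖ := ContinuousLinearMap.opNorm_comp_le _ _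
      _ ≤ (C * (t - r) ^ (-(1 / 2) : ℝ)) * (M * (r - y) ^ (-(1 / 2) : ℝ)) :=
          mul_le_mul h1 h2 (norm_nonneg _) ((norm_nonneg _).trans h1)
      _ = _ := by ring

/-- For fixed y the r-integral is a beta integral with exponents 1/2 and 1/2, a constant; so the
double integral is at most a multiple of the integral of ‖H‖. Since `heat` vanishes at nonpositive
times, the triangle y < r can be treated as the full square. -/
lemma integrable_prod_heat (hD : P.HalfOrder D)
    (hB : ContinuousOn B (Ioo s t)) (hBC : ∀ r ∈ Ioo s t, ‖B r‖ ≤ C * (t - r) ^ (-(1 / 2) : ℝ))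
    (hH : IntegrableOn H (Ioo s t)) :
    Integrable (Function.uncurry fun r y => B r (P.heat D (r - y) (H y)))
      ((volume.restrict (Ioo s t)).prod (volume.restrict (Ioo s t))) := by
  obtain ⟨M, hM0, hM⟩ := hD.exists_norm_heat_le (t - s)
  have hmeas : AEStronglyMeasurable (Function.uncurry fun r y => B r (P.heat D (r - y) (H y)))
      ((volume.restrict (Ioo s t)).prod (volume.restrict (Ioo s t))) :=
    ((hB.aestronglyMeasurable measurableSet_Ioo).comp_fst).clm_apply'
      ((hD.aestronglyMeasurable_heat_sub _).clm_apply' hH.aestronglyMeasurable.comp_snd)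
  have hb : ∀ y ∈ Ioo s t, IntegrableOn (fun r => C * M * ‖H y‖ *
      ((t - r) ^ (-(1 / 2) : ℝ) * (r - y) ^ (-(1 / 2) : ℝ))) (Ioo y t) := fun y hy => by
    have := (intervalIntegrable_beta (α := 1 / 2) (β := 1 / 2) (by norm_num) (by norm_num)
      hy.2).const_mul (C * M * ‖H y‖)
    rwa [intervalIntegrable_iff_integrableOn_Ioo_of_le hy.2.le] at this
  have hle : ∀ y ∈ Ioo s t, ∀ r ∈ Ioo s t, ‖B r (P.heat D (r - y) (H y))‖ ≤
      (Ioo y t).indicator (fun r => C * M * ‖H y‖ *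
        ((t - r) ^ (-(1 / 2) : ℝ) * (r - y) ^ (-(1 / 2) : ℝ))) r := fun y hy r hr => by
    by_cases h : y < r
    · rw [indicator_of_mem (show r ∈ Ioo y t from ⟨h, hr.2⟩)]
      have h1 := hBC r hr
      have h2 := hM (r - y) (by linarith) (by linarith [hr.2, hy.1])
      calc _ ≤ ‖B r‖ * (‖P.heat D (r - y)‖ * ‖H y‖) :=
            (B r).le_opNorm_of_le ((P.heat D (r - y)).le_opNorm _)
        _ ≤ (C * (t - r) ^ (-(1 / 2) : ℝ)) * ((M * (r - y) ^ (-(1 / 2) : ℝ)) * ‖H y‖) :=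
            mul_le_mul h1 (mul_le_mul_of_nonneg_right h2 (norm_nonneg _)) (by positivity)
              ((norm_nonneg _).trans h1)
        _ = _ := by ring
    · rw [indicator_of_notMem (fun h' => h h'.1), heat_of_nonpos (by linarith [not_lt.1 h])]
      simp
  rw [integrable_prod_iff' hmeas]
  have hind : ∀ y ∈ Ioo s t, Integrable ((Ioo y t).indicator (fun r => C * M * ‖H y‖ *
      ((t - r) ^ (-(1 / 2) : ℝ) * (r - y) ^ (-(1 / 2) : ℝ)))) (volume.restrict (Ioo s t)) :=
    fun y hy => ((integrable_indicator_iff measurableSet_Ioo).2 (hb y hy)).restrict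
  refine ⟨?_, ?_⟩
  · have hsec : ∀ᵐ y ∂volume.restrict (Ioo s t), AEStronglyMeasurable
        (fun r => B r (P.heat D (r - y) (H y))) (volume.restrict (Ioo s t)) :=
      hmeas.prod_swap.prodMk_left
    filter_upwards [hsec, ae_restrict_mem measurableSet_Ioo] with y hy1 hy
    refine Integrable.mono' (hind y hy) hy1 ?_
    filter_upwards [ae_restrict_mem measurableSet_Ioo] with r hr using hle y hy r hr
  · refine Integrable.mono' (hH.norm.const_mul (C * M * betaConst (1 / 2) (1 / 2)))
      hmeas.norm.prod_swap.integral_prod_right' ?_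
    filter_upwards [ae_restrict_mem measurableSet_Ioo] with y hy
    rw [Real.norm_of_nonneg (integral_nonneg fun r => norm_nonneg _)]
    calc _ ≤ ∫ r in Ioo s t, (Ioo y t).indicator (fun r => C * M * ‖H y‖ *
          ((t - r) ^ (-(1 / 2) : ℝ) * (r - y) ^ (-(1 / 2) : ℝ))) r := by
          refine integral_mono_of_nonneg (Eventually.of_forall fun r => norm_nonneg _)
            (hind y hy) ?_
          filter_upwards [ae_restrict_mem measurableSet_Ioo] with r hr using hle y hy r hr
      _ = ∫ r in y..t, C * M * ‖H y‖ *
          ((t - r) ^ (-(1 / 2) : ℝ) * (r - y) ^ (-(1 / 2) : ℝ)) := by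
          rw [setIntegral_indicator measurableSet_Ioo, intervalIntegral.integral_of_le hy.2.le,
            integral_Ioc_eq_integral_Ioo, Ioo_inter_Ioo, max_eq_right hy.1.le, min_self]
      _ = _ := by
          rw [intervalIntegral.integral_const_mul, integral_beta hy.2]
          norm_num
          ring

/-- Changing the order of integration in an iterated convolution with the semigroup. -/
lemma integral_comp_heat (hD : P.HalfOrder D)
    (hB : ContinuousOn B (Ioo s t)) (hBC : ∀ r ∈ Ioo s t, ‖B r‖ ≤ C * (t - r) ^ (-(1 / 2) : ℝ))
    (hH : IntegrableOn H (Ioo s t)) :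
    IntegrableOn (fun r => B r (∫ y in s..r, P.heat D (r - y) (H y))) (Ioo s t) ∧
    IntegrableOn (fun y => (∫ r in y..t, B r ∘L P.heat D (r - y)) (H y)) (Ioo s t) ∧
    ∫ r in Ioo s t, B r (∫ y in s..r, P.heat D (r - y) (H y)) =
      ∫ y in Ioo s t, (∫ r in y..t, B r ∘L P.heat D (r - y)) (H y) := by
  have hint := integrable_prod_heat hD hB hBC hH
  -- The same estimate with the identity in place of B: for almost every r the inner integrand is
  -- integrable, so B r may be taken out of the integral.
  have hid := integrable_prod_heat (B := fun _ => ContinuousLinearMap.id ℝ P.Ell)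
    (C := (t - s) ^ (1 / 2 : ℝ)) hD continuousOn_const (fun r hr => by
      refine ContinuousLinearMap.norm_id_le.trans ?_
      rw [Real.rpow_neg (by linarith [hr.2]), ← div_eq_mul_inv, one_le_div
        (Real.rpow_pos_of_pos (by linarith [hr.2]) _)]
      exact Real.rpow_le_rpow (by linarith [hr.2]) (by linarith [hr.1]) (by norm_num)) hH
  have e1 : ∀ᵐ r ∂volume.restrict (Ioo s t), ∫ y in Ioo s t, B r (P.heat D (r - y) (H y)) =
      B r (∫ y in s..r, P.heat D (r - y) (H y)) := by
    filter_upwards [hid.prod_right_ae, ae_restrict_mem measurableSet_Ioo] with r hr1 hr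
    simp only [Function.uncurry_apply_pair, ContinuousLinearMap.id_apply] at hr1
    rw [(B r).integral_comp_comm hr1, intervalIntegral.integral_of_le hr.1.le,
      integral_Ioc_eq_integral_Ioo]
    congr 1
    refine (setIntegral_eq_of_subset_of_forall_sdiff_eq_zero measurableSet_Ioo
      (Ioo_subset_Ioo_right hr.2.le) fun y hy => ?_)
    have : r ≤ y := not_lt.1 fun h => hy.2 ⟨hy.1.1, h⟩
    rw [heat_of_nonpos (by linarith)]
    rfl
  have e2 : ∀ y ∈ Ioo s t, ∫ r in Ioo s t, B r (P.heat D (r - y) (H y)) =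
      (∫ r in y..t, B r ∘L P.heat D (r - y)) (H y) := fun y hy => by
    have h1 := integrableOn_comp_heat hD hB hBC ⟨hy.1.le, hy.2⟩
    rw [intervalIntegral.integral_of_le hy.2.le, integral_Ioc_eq_integral_Ioo,
      ContinuousLinearMap.integral_apply h1]
    refine (setIntegral_eq_of_subset_of_forall_sdiff_eq_zero measurableSet_Ioo
      (Ioo_subset_Ioo_left hy.1.le) fun r hr => ?_)
    have : r ≤ y := not_lt.1 fun h => hr.2 ⟨h, hr.1.2⟩
    rw [heat_of_nonpos (by linarith)]
    simp
  have e2' : ∀ᵐ y ∂volume.restrict (Ioo s t), ∫ r in Ioo s t, B r (P.heat D (r - y) (H y)) =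
      (∫ r in y..t, B r ∘L P.heat D (r - y)) (H y) := by
    filter_upwards [ae_restrict_mem measurableSet_Ioo] with y hy using e2 y hy
  refine ⟨hint.integral_prod_left.congr e1, hint.integral_prod_right.congr e2', ?_⟩
  rw [← integral_congr_ae e1, ← integral_congr_ae e2']
  exact integral_integral_swap hint

end Fubini

/-! ### The evolution family of the linearized equation -/

/-- Given the solution `V` of the backward Volterra equation for the final time `t`, the evolution
operator from `s` to `t` applied to data of the form `D ψ`. -/
def resolventOp (P : PDEData d) (A V : ℝ → P.Ell →L[ℝ] P.Ell) (t : ℝ) (D : (Fin d → ℕ) → ℝ)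
    (s : ℝ) : P.Ell →L[ℝ] P.Ell :=
  P.heat D (t - s) + ∫ r in s..t, (V r ∘L A r) ∘L P.heat D (r - s)

/-- `V` solves the backward Volterra equation on `[t0, t)` for the final time `t`. -/
structure IsResolvent (P : PDEData d) (A V : ℝ → P.Ell →L[ℝ] P.Ell) (t0 t : ℝ) : Prop where
  cont : ContinuousOn V (Ico t0 t)
  bound : ∃ C, ∀ r ∈ Ico t0 t, ‖V r‖ ≤ C * (t - r) ^ (-(1 / 2) : ℝ)
  eqn : ∀ s ∈ Ico t0 t, V s = P.resolventOp A V t P.qsym s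

variable {A V : ℝ → P.Ell →L[ℝ] P.Ell} {t0 t1 : ℝ}

/-- The reflection s ↦ -s turns the backward equation into a forward Volterra equation for
operator-valued functions on (-t, -t0]. V(s) represents U(t, s)𝒬. With the final time fixed, V is
norm continuous in s, so it can be integrated against arbitrary sources. -/
theorem exists_isResolvent (hA : ContinuousOn A (Icc t0 t1)) {t : ℝ} (ht : t ∈ Ioc t0 t1) :
    ∃ V, P.IsResolvent A V t0 t := by
  have hq := P.halfOrder_qsym
  obtain ⟨M, hM0, hM⟩ := hq.exists_norm_heat_le (t - t0)
  obtain ⟨K, hK⟩ := isCompact_Icc.exists_bound_of_continuousOn hA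
  have hK0 : 0 ≤ K := (norm_nonneg _).trans (hK t0 ⟨le_rfl, ht.1.le.trans ht.2⟩)
  have hΨ : VolterraKernel (fun ρ σ (X : P.Ell →L[ℝ] P.Ell) =>
      (X ∘L A (-σ)) ∘L P.heat P.qsym (ρ - σ)) (-t) (-t0) (K * M) := by
    refine ⟨?_, mul_nonneg hK0 hM0, fun ρ σ X Y h1 h2 h3 => ?_, fun ρ σ h1 h2 h3 => ?_⟩
    · refine ContinuousOn.clm_comp (ContinuousOn.clm_comp (Continuous.continuousOn (by fun_prop))
        (hA.comp (Continuous.continuousOn (by fun_prop)) fun p hp => ?_))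
        (hq.continuousOn_heat.comp (Continuous.continuousOn (by fun_prop)) fun p hp => ?_)
      · exact ⟨by linarith [hp.2.1, hp.2.2], by linarith [hp.1, ht.2]⟩
      · exact sub_pos.2 hp.2.1
    · have e1 : (X ∘L A (-σ)) ∘L P.heat P.qsym (ρ - σ) - (Y ∘L A (-σ)) ∘L P.heat P.qsym (ρ - σ) =
          ((X - Y) ∘L A (-σ)) ∘L P.heat P.qsym (ρ - σ) := by
        ext1 a
        simp
      have e2 := hM (ρ - σ) (by linarith) (by linarith)
      have e3 := hK (-σ) ⟨by linarith, by linarith [ht.2]⟩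
      rw [e1]
      calc _ ≤ ‖(X - Y) ∘L A (-σ)‖ * ‖P.heat P.qsym (ρ - σ)‖ :=
            ContinuousLinearMap.opNorm_comp_le _ _
        _ ≤ (‖X - Y‖ * K) * (M * (ρ - σ) ^ (-(1 / 2) : ℝ)) := by
            refine mul_le_mul ?_ e2 (norm_nonneg _) (by positivity)
            exact (ContinuousLinearMap.opNorm_comp_le _ _).trans
              (mul_le_mul_of_nonneg_left e3 (norm_nonneg _))
        _ = _ := by ring
    · have : ((0 : P.Ell →L[ℝ] P.Ell) ∘L A (-σ)) ∘L P.heat P.qsym (ρ - σ) = 0 := by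
        ext1 a
        simp
      rw [this, norm_zero]
      exact mul_nonneg (mul_nonneg hK0 hM0) (Real.rpow_nonneg (by linarith) _)
  have hv0 : SingularAt (fun ρ => P.heat P.qsym (t + ρ)) (-t) (-t0) M := by
    refine ⟨hq.continuousOn_heat.comp (Continuous.continuousOn (by fun_prop))
      fun ρ hρ => ?_, fun ρ hρ => ?_⟩
    · change 0 < t + ρ
      linarith [hρ.1]
    · rw [sub_neg_eq_add, add_comm ρ t]
      exact hM _ (by linarith [hρ.1]) (by linarith [hρ.2])
  obtain ⟨v, C, hv, hve⟩ := hΨ.exists_solution (by linarith [ht.1]) hv0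
  have hneg : ∀ s ∈ Ico t0 t, -s ∈ Ioc (-t) (-t0) := fun s hs =>
    ⟨by linarith [hs.2], by linarith [hs.1]⟩
  refine ⟨fun s => v (-s), hv.cont.comp (Continuous.continuousOn (by fun_prop)) hneg,
    ⟨C, fun r hr => ?_⟩, fun s hs => ?_⟩
  · have := hv.bound (-r) (hneg r hr)
    rwa [sub_neg_eq_add, neg_add_eq_sub] at this
  · rw [hve (-s) (hneg s hs), resolventOp, ← sub_eq_add_neg]
    congr 1
    rw [← intervalIntegral.integral_comp_neg]
    refine intervalIntegral.integral_congr fun r _ => ?_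
    simp only [neg_neg]
    congr 2
    ring

lemma HalfOrder.integrableOn_heat_sub_apply {D : (Fin d → ℕ) → ℝ} (hD : P.HalfOrder D) {s t G : ℝ}
    (hst : s < t) {g : ℝ → P.Ell} (hg : AEStronglyMeasurable g (volume.restrict (Ioo s t)))
    (hgG : ∀ r ∈ Ioo s t, ‖g r‖ ≤ G) :
    IntegrableOn (fun r => P.heat D (t - r) (g r)) (Ioo s t) := by
  obtain ⟨M, hM0, hM⟩ := hD.exists_norm_heat_le (t - s)
  have hb := (intervalIntegrable_beta (α := 1 / 2) (β := 0) (by norm_num) (by norm_num)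
    hst).const_mul (M * G)
  rw [intervalIntegrable_iff_integrableOn_Ioo_of_le hst.le] at hb
  refine Integrable.mono' hb ((ContinuousOn.aestronglyMeasurable
    ((hD.continuousOn_heat_sub_left t).mono fun r hr => hr.2) measurableSet_Ioo).clm_apply' hg) ?_
  filter_upwards [ae_restrict_mem measurableSet_Ioo] with r hr
  have h1 := hM (t - r) (by linarith [hr.2]) (by linarith [hr.1])
  calc _ ≤ ‖P.heat D (t - r)‖ * ‖g r‖ := ContinuousLinearMap.le_opNorm _ _
    _ ≤ (M * (t - r) ^ (-(1 / 2) : ℝ)) * G :=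
        mul_le_mul h1 (hgG r hr) (norm_nonneg _) ((norm_nonneg _).trans h1)
    _ = _ := by simp; ring

lemma integrableOn_of_norm_le {g : ℝ → P.Ell} {s t G : ℝ}
    (hg : AEStronglyMeasurable g (volume.restrict (Ioo s t))) (hgG : ∀ r ∈ Ioo s t, ‖g r‖ ≤ G) :
    IntegrableOn g (Ioo s t) :=
  Integrable.of_bound hg G
    (by filter_upwards [ae_restrict_mem measurableSet_Ioo] with r hr using hgG r hr)

/-- Variation of constants: a mild solution of the inhomogeneous linearized equation expressed
by the evolution operators. -/
theorem IsResolvent.duhamel {t : ℝ} (hV : P.IsResolvent A V t0 t) (hA : ContinuousOn A (Icc t0 t))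
    {s : ℝ} (hs : s ∈ Ico t0 t) {D : (Fin d → ℕ) → ℝ} (hD : P.HalfOrder D) {psi : P.Ell}
    {v g f : ℝ → P.Ell} {G δ : ℝ} (hv : IntegrableOn v (Ioo s t))
    (hg : AEStronglyMeasurable g (volume.restrict (Ioo s t))) (hgG : ∀ r ∈ Ioo s t, ‖g r‖ ≤ G)
    (hf : AEStronglyMeasurable f (volume.restrict (Ioo s t))) (hfδ : ∀ r ∈ Ioo s t, ‖f r‖ ≤ δ)
    (hmild : ∀ r ∈ Ioc s t, v r = P.heat D (r - s) psi +
      (∫ y in s..r, P.heat P.qsym (r - y) (A y (v y) + g y)) +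
      ∫ y in s..r, P.heat (fun _ => 1) (r - y) (f y)) :
    v t = P.resolventOp A V t D s psi +
      (∫ r in s..t, P.resolventOp A V t P.qsym r (g r)) +
      ∫ r in s..t, P.resolventOp A V t (fun _ => 1) r (f r) := by
  have hq := P.halfOrder_qsym
  have h1 := P.halfOrder_one
  have hst := hs.2
  have hsub : Ioo s t ⊆ Ico t0 t := fun r hr => ⟨hs.1.trans hr.1.le, hr.2⟩
  have hsub' : Ioo s t ⊆ Icc t0 t := fun r hr => ⟨hs.1.trans hr.1.le, hr.2.le⟩
  obtain ⟨C, hC⟩ := hV.bound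
  obtain ⟨K, hK⟩ := isCompact_Icc.exists_bound_of_continuousOn hA
  obtain ⟨B, hBdef⟩ : ∃ B : ℝ → P.Ell →L[ℝ] P.Ell, B = fun r => V r ∘L A r := ⟨_, rfl⟩
  have hB : ContinuousOn B (Ioo s t) := hBdef ▸ (hV.cont.mono hsub).clm_comp (hA.mono hsub')
  have hBC : ∀ r ∈ Ioo s t, ‖B r‖ ≤ (C * K) * (t - r) ^ (-(1 / 2) : ℝ) := fun r hr => by
    have e1 := hC r (hsub hr)
    have e2 := hK r (hsub' hr)
    rw [hBdef]
    calc _ ≤ ‖V r‖ * ‖A r‖ := ContinuousLinearMap.opNorm_comp_le _ _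
      _ ≤ (C * (t - r) ^ (-(1 / 2) : ℝ)) * K :=
          mul_le_mul e1 e2 (norm_nonneg _) ((norm_nonneg _).trans e1)
      _ = _ := by ring
  have hR : ∀ D s, P.resolventOp A V t D s =
      P.heat D (t - s) + ∫ r in s..t, B r ∘L P.heat D (r - s) := fun D s => by
    rw [resolventOp, hBdef]
  have hAv : IntegrableOn (fun y => A y (v y)) (Ioo s t) := by
    refine Integrable.mono' (hv.norm.const_mul K) (((hA.mono hsub').aestronglyMeasurable
      measurableSet_Ioo).clm_apply' hv.aestronglyMeasurable) ?_
    filter_upwards [ae_restrict_mem measurableSet_Ioo] with r hr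
    exact (A r).le_of_opNorm_le (hK r (hsub' hr)) _
  have hgi := integrableOn_of_norm_le hg hgG
  have hfi := integrableOn_of_norm_le hf hfδ
  have hHi : IntegrableOn (fun y => A y (v y) + g y) (Ioo s t) := hAv.add hgi
  obtain ⟨q1, q2, q3⟩ := integral_comp_heat hq hB hBC hHi
  obtain ⟨f1, f2, f3⟩ := integral_comp_heat h1 hB hBC hfi
  have hD1 := integrableOn_comp_heat hD hB hBC ⟨le_rfl, hst⟩
  have hD2 : IntegrableOn (fun r => B r (P.heat D (r - s) psi)) (Ioo s t) :=
    hD1.apply_continuousLinearMap psi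
  have hBv_eq : ∀ r ∈ Ioo s t, B r (v r) = B r (P.heat D (r - s) psi) +
      B r (∫ y in s..r, P.heat P.qsym (r - y) (A y (v y) + g y)) +
      B r (∫ y in s..r, P.heat (fun _ => 1) (r - y) (f y)) := fun r hr => by
    conv_lhs => rw [hmild r ⟨hr.1, hr.2.le⟩]
    rw [map_add, map_add]
  have hsum1 : IntegrableOn (fun r => B r (P.heat D (r - s) psi) +
      B r (∫ y in s..r, P.heat P.qsym (r - y) (A y (v y) + g y))) (Ioo s t) := hD2.add q1
  have hsum := hsum1.add f1
  have hBv : IntegrableOn (fun r => B r (v r)) (Ioo s t) :=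
    hsum.congr_fun (fun r hr => (hBv_eq r hr).symm) measurableSet_Ioo
  -- Apply B r = V r A r to the mild equation, integrate over r, and exchange the order in both
  -- double integrals.
  have hBvI : ∫ r in Ioo s t, B r (v r) = (∫ r in s..t, B r ∘L P.heat D (r - s)) psi +
      (∫ y in Ioo s t, (∫ r in y..t, B r ∘L P.heat P.qsym (r - y)) (A y (v y) + g y)) +
      ∫ y in Ioo s t, (∫ r in y..t, B r ∘L P.heat (fun _ => 1) (r - y)) (f y) := by
    rw [setIntegral_congr_fun measurableSet_Ioo hBv_eq, integral_add hsum1 f1,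
      integral_add hD2 q1, q3, f3, intervalIntegral.integral_of_le hst.le,
      integral_Ioc_eq_integral_Ioo, ContinuousLinearMap.integral_apply hD1]
    rfl
  have hVg : IntegrableOn (fun r => V r (g r)) (Ioo s t) := by
    have hb := (intervalIntegrable_beta (α := 1 / 2) (β := 0) (by norm_num) (by norm_num)
      hst).const_mul (C * G)
    rw [intervalIntegrable_iff_integrableOn_Ioo_of_le hst.le] at hb
    refine Integrable.mono' hb (((hV.cont.mono hsub).aestronglyMeasurable
      measurableSet_Ioo).clm_apply' hg) ?_
    filter_upwards [ae_restrict_mem measurableSet_Ioo] with r hr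
    have e1 := hC r (hsub hr)
    calc _ ≤ ‖V r‖ * ‖g r‖ := ContinuousLinearMap.le_opNorm _ _
      _ ≤ (C * (t - r) ^ (-(1 / 2) : ℝ)) * G :=
          mul_le_mul e1 (hgG r hr) (norm_nonneg _) ((norm_nonneg _).trans e1)
      _ = _ := by simp; ring
  -- The resolvent equation at r, solved for its integral term. It introduces the integral of B r (v
  -- r) a second time, on the right.
  have hVr : ∀ r ∈ Ioo s t, (∫ y in r..t, B y ∘L P.heat P.qsym (y - r)) (A r (v r) + g r) =
      B r (v r) + V r (g r) - P.heat P.qsym (t - r) (A r (v r) + g r) := fun r hr => by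
    have e1 := hV.eqn r (hsub hr)
    rw [hR] at e1
    have e2 : B r (v r) = V r (A r (v r)) := by rw [hBdef]; rfl
    rw [e2, ← map_add, e1, _root_.add_apply, add_sub_cancel_left]
  have hBvg : IntegrableOn (fun r => B r (v r) + V r (g r)) (Ioo s t) := hBv.add hVg
  have hSq : IntegrableOn (fun r => P.heat P.qsym (t - r) (A r (v r) + g r)) (Ioo s t) := by
    refine (hBvg.sub q2).congr_fun (fun r hr => ?_) measurableSet_Ioo
    change B r (v r) + V r (g r) -
      (∫ y in r..t, B y ∘L P.heat P.qsym (y - r)) (A r (v r) + g r) = _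
    rw [hVr r hr, sub_sub_cancel]
  have hS1 := h1.integrableOn_heat_sub_apply hst hf hfδ
  have hq4 : ∫ y in Ioo s t, (∫ r in y..t, B r ∘L P.heat P.qsym (r - y)) (A y (v y) + g y) =
      (∫ r in Ioo s t, B r (v r)) + (∫ r in Ioo s t, V r (g r)) -
        ∫ r in Ioo s t, P.heat P.qsym (t - r) (A r (v r) + g r) := by
    rw [setIntegral_congr_fun measurableSet_Ioo hVr, integral_sub hBvg hSq,
      integral_add hBv hVg]
  have hVg' : ∫ r in s..t, P.resolventOp A V t P.qsym r (g r) = ∫ r in Ioo s t, V r (g r) := by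
    rw [intervalIntegral.integral_of_le hst.le, integral_Ioc_eq_integral_Ioo]
    exact setIntegral_congr_fun measurableSet_Ioo fun r hr => by
      rw [← hV.eqn r (hsub hr)]
  have hf4 : ∫ r in s..t, P.resolventOp A V t (fun _ => 1) r (f r) =
      (∫ r in Ioo s t, P.heat (fun _ => 1) (t - r) (f r)) +
        ∫ y in Ioo s t, (∫ r in y..t, B r ∘L P.heat (fun _ => 1) (r - y)) (f y) := by
    rw [intervalIntegral.integral_of_le hst.le, integral_Ioc_eq_integral_Ioo,
      ← integral_add hS1 f2]
    exact setIntegral_congr_fun measurableSet_Ioo fun r hr => by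
      rw [hR]
      rfl
  have hvt := hmild t ⟨hst, le_rfl⟩
  rw [intervalIntegral.integral_of_le hst.le, intervalIntegral.integral_of_le hst.le,
    integral_Ioc_eq_integral_Ioo, integral_Ioc_eq_integral_Ioo] at hvt
  rw [hVg', hf4, hvt, hR, _root_.add_apply]
  rw [hq4] at hBvI
  -- The integral of B r (v r) stands on both sides of `hBvI` and cancels; the remaining identity is
  -- the difference between the mild equation at t and the claim.
  have hzero : (∫ r in s..t, B r ∘L P.heat D (r - s)) psi + ((∫ r in Ioo s t, V r (g r)) -
      ∫ r in Ioo s t, P.heat P.qsym (t - r) (A r (v r) + g r)) +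
      ∫ y in Ioo s t, (∫ r in y..t, B r ∘L P.heat (fun _ => 1) (r - y)) (f y) = 0 := by
    have := sub_eq_zero.2 hBvI.symm
    rw [← this]
    abel
  rw [← sub_eq_zero, ← neg_eq_zero, ← hzero]
  abel

end PDEData
end

noncomputable section
namespace PDEData

open MeasureTheory

variable {d : ℕ} {P : PDEData d}

/-! ### Mild solutions and the equations for the coefficients -/

/-- Integrating factor, with the fundamental theorem of calculus in its version for one-sided limits
at the end points. Only a limit of y at s is used, which matches initial data prescribed
coefficientwise. -/
lemma scalar_duhamel {μ y0 s t1 : ℝ} {y h : ℝ → ℝ} (hy : ContinuousOn y (Ioc s t1))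
    (hode : ∀ t ∈ Ioo s t1, HasDerivAt y (μ * y t + h t) t) (hinit : Tendsto y (𝓝[>] s) (𝓝 y0))
    (hh : IntegrableOn h (Ioo s t1)) {t : ℝ} (ht : t ∈ Ioc s t1) :
    y t = Real.exp ((t - s) * μ) * y0 + ∫ r in s..t, Real.exp ((t - r) * μ) * h r := by
  have hder : ∀ r ∈ Ioo s t, HasDerivAt (fun r => Real.exp ((t - r) * μ) * y r)
      (Real.exp ((t - r) * μ) * h r) r := fun r hr => by
    have h1 : HasDerivAt (fun r => Real.exp ((t - r) * μ))
        (Real.exp ((t - r) * μ) * (-1 * μ)) r :=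
      (((hasDerivAt_id r).const_sub t).mul_const μ).exp
    refine (h1.mul (hode r ⟨hr.1, hr.2.trans_le ht.2⟩)).congr_deriv ?_
    ring
  have hint : IntervalIntegrable (fun r => Real.exp ((t - r) * μ) * h r) volume s t := by
    have h1 : IntervalIntegrable h volume s t := by
      rw [intervalIntegrable_iff_integrableOn_Ioo_of_le ht.1.le]
      exact hh.mono_set (Ioo_subset_Ioo_right ht.2)
    exact h1.continuousOn_mul (Continuous.continuousOn (by fun_prop))
  have hc : Continuous fun r => Real.exp ((t - r) * μ) := by fun_prop
  have ha : Tendsto (fun r => Real.exp ((t - r) * μ) * y r) (𝓝[>] s)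
      (𝓝 (Real.exp ((t - s) * μ) * y0)) :=
    ((hc.tendsto s).mono_left nhdsWithin_le_nhds).mul hinit
  have hb : Tendsto (fun r => Real.exp ((t - r) * μ) * y r) (𝓝[<] t)
      (𝓝 (Real.exp ((t - t) * μ) * y t)) := by
    refine ((hc.tendsto t).mono_left nhdsWithin_le_nhds).mul ?_
    have h1 : Tendsto y (𝓝[Ioc s t1] t) (𝓝 (y t)) := hy t ht
    refine h1.mono_left ?_
    rw [← nhdsWithin_Ioo_eq_nhdsLT ht.1]
    exact nhdsWithin_mono _ fun r hr => ⟨hr.1, hr.2.le.trans ht.2⟩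
  rw [intervalIntegral.integral_eq_sub_of_hasDerivAt_of_tendsto ht.1 hder hint ha hb]
  simp

lemma Ell.integrableOn_apply {H : ℝ → P.Ell} {S : Set ℝ} (hH : IntegrableOn H S)
    (k : Fin d → ℕ) : IntegrableOn (fun r => H r k) S :=
  (P.coeffL k).integrable_comp hH

lemma intervalIntegral_apply {g : ℝ → P.Ell} {s t : ℝ} (hst : s ≤ t)
    (hg : IntegrableOn g (Ioo s t)) (k : Fin d → ℕ) :
    (∫ r in s..t, g r) k = ∫ r in s..t, g r k := by
  have h := (P.coeffL k).intervalIntegral_comp_comm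
    ((intervalIntegrable_iff_integrableOn_Ioo_of_le hst).2 hg)
  exact h.symm

lemma intervalIntegral_heat_apply {D : (Fin d → ℕ) → ℝ} (hD : P.HalfOrder D) {H : ℝ → P.Ell}
    {s t : ℝ} (hst : s ≤ t) (hH : IntegrableOn (fun r => P.heat D (t - r) (H r)) (Ioo s t))
    (k : Fin d → ℕ) : (∫ r in s..t, P.heat D (t - r) (H r)) k =
      ∫ r in s..t, Real.exp ((t - r) * P.mu k) * (D k * H r k) := by
  rw [intervalIntegral_apply hst hH]
  refine intervalIntegral.integral_congr_ae ?_
  have h1 : ∀ᵐ r : ℝ, r ≠ t := compl_mem_ae_iff.2 (measure_singleton t)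
  filter_upwards [h1] with r hr hr'
  rw [uIoc_of_le hst] at hr'
  rw [heat_apply hD (sub_pos.2 (lt_of_le_of_ne hr'.2 hr)), mul_assoc]

/-- A function whose coefficients satisfy the differential equations is a mild solution. -/
lemma mild_of_coeff {D : (Fin d → ℕ) → ℝ} (hD : P.HalfOrder D) {psi : P.Ell}
    {v H f : ℝ → P.Ell} {s t1 : ℝ} (hv : ContinuousOn v (Ioc s t1))
    (hH : IntegrableOn H (Ioo s t1)) (hf : IntegrableOn f (Ioo s t1))
    (hode : ∀ t ∈ Ioo s t1, ∀ k, HasDerivAt (fun r => v r k)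
      (P.mu k * v t k + (P.qsym k * H t k + f t k)) t)
    (hinit : ∀ k, Tendsto (fun t => v t k) (𝓝[>] s) (𝓝 (D k * psi k))) {t : ℝ} (ht : t ∈ Ioc s t1)
    (hH' : IntegrableOn (fun r => P.heat P.qsym (t - r) (H r)) (Ioo s t))
    (hf' : IntegrableOn (fun r => P.heat (fun _ => 1) (t - r) (f r)) (Ioo s t)) :
    v t = P.heat D (t - s) psi + (∫ r in s..t, P.heat P.qsym (t - r) (H r)) +
      ∫ r in s..t, P.heat (fun _ => 1) (t - r) (f r) := by
  refine Ell.ext fun k => ?_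
  have hHk : IntegrableOn (fun r => P.qsym k * H r k) (Ioo s t1) :=
    (Ell.integrableOn_apply hH k).const_mul (P.qsym k)
  have hfk := Ell.integrableOn_apply hf k
  have h1 := scalar_duhamel ((P.coeffL k).continuous.comp_continuousOn hv)
    (fun t ht => hode t ht k) (hinit k) (hHk.add hfk) ht
  have hc : Continuous fun r => Real.exp ((t - r) * P.mu k) := by fun_prop
  have hsub : Ioo s t ⊆ Ioo s t1 := Ioo_subset_Ioo_right ht.2
  have i1 : IntervalIntegrable (fun r => Real.exp ((t - r) * P.mu k) * (P.qsym k * H r k))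
      volume s t :=
    ((intervalIntegrable_iff_integrableOn_Ioo_of_le ht.1.le).2 (hHk.mono_set hsub)).continuousOn_mul
      hc.continuousOn
  have i2 : IntervalIntegrable (fun r => Real.exp ((t - r) * P.mu k) * f r k) volume s t :=
    ((intervalIntegrable_iff_integrableOn_Ioo_of_le ht.1.le).2 (hfk.mono_set hsub)).continuousOn_mul
      hc.continuousOn
  rw [Ell.add_apply, Ell.add_apply, intervalIntegral_heat_apply P.halfOrder_qsym ht.1.le hH',
    intervalIntegral_heat_apply P.halfOrder_one ht.1.le hf', heat_apply hD (sub_pos.2 ht.1)]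
  refine h1.trans ?_
  simp only [one_mul]
  rw [add_assoc, ← intervalIntegral.integral_add i1 i2, mul_assoc]
  simp only [mul_add]

/-- The coefficients of a mild solution satisfy the differential equations. -/
lemma coeff_of_mild {D : (Fin d → ℕ) → ℝ} (hD : P.HalfOrder D) {psi : P.Ell}
    {v H : ℝ → P.Ell} {s t1 : ℝ} (hst : s < t1) (hHc : ContinuousOn H (Ioo s t1))
    (hH : IntegrableOn H (Ioo s t1))
    (hH' : ∀ t ∈ Ioc s t1, IntegrableOn (fun r => P.heat P.qsym (t - r) (H r)) (Ioo s t))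
    (hmild : ∀ t ∈ Ioc s t1,
      v t = P.heat D (t - s) psi + ∫ r in s..t, P.heat P.qsym (t - r) (H r)) :
    (∀ t ∈ Ioo s t1, ∀ k, HasDerivAt (fun r => v r k)
      (P.mu k * v t k + P.qsym k * H t k) t) ∧
    ∀ k, Tendsto (fun t => v t k) (𝓝[>] s) (𝓝 (D k * psi k)) := by
  -- Taking e^{(t - s)μ} out of the integral leaves an integrand independent of t, so the integral
  -- can be differentiated in its upper limit.
  obtain ⟨G, hG⟩ : ∃ G : (Fin d → ℕ) → ℝ → ℝ, G = fun k r =>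
      Real.exp (-((r - s) * P.mu k)) * (P.qsym k * H r k) := ⟨_, rfl⟩
  have hGi : ∀ k, IntervalIntegrable (G k) volume s t1 := fun k => by
    have h1 := (intervalIntegrable_iff_integrableOn_Ioo_of_le hst.le).2
      ((Ell.integrableOn_apply hH k).const_mul (P.qsym k))
    rw [hG]
    exact h1.continuousOn_mul (Continuous.continuousOn (by fun_prop))
  have hGc : ∀ k, ContinuousOn (G k) (Ioo s t1) := fun k => by
    rw [hG]
    exact ContinuousOn.mul (Continuous.continuousOn (by fun_prop))
      (continuousOn_const.mul ((P.coeffL k).continuous.comp_continuousOn hHc))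
  have hvk : ∀ k, ∀ t ∈ Ioc s t1, v t k =
      Real.exp ((t - s) * P.mu k) * (D k * psi k + ∫ r in s..t, G k r) := fun k t ht => by
    rw [hmild t ht, Ell.add_apply, heat_apply hD (sub_pos.2 ht.1),
      intervalIntegral_heat_apply P.halfOrder_qsym ht.1.le (hH' t ht), mul_add,
      ← intervalIntegral.integral_const_mul, mul_assoc, hG]
    congr 1
    refine intervalIntegral.integral_congr fun r _ => ?_
    dsimp only
    rw [← mul_assoc (Real.exp _) (Real.exp _), ← Real.exp_add]
    ring_nf
  refine ⟨fun t ht k => ?_, fun k => ?_⟩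
  · have h1 : HasDerivAt (fun u => ∫ r in s..u, G k r) (G k t) t := by
      have hmem : Ioo s t1 ∈ 𝓝 t := Ioo_mem_nhds ht.1 ht.2
      refine intervalIntegral.integral_hasDerivAt_right ((hGi k).mono_set ?_) ?_
        ((hGc k).continuousAt hmem)
      · rw [uIcc_of_le ht.1.le, uIcc_of_le hst.le]
        exact Icc_subset_Icc_right ht.2.le
      · exact (hGc k).stronglyMeasurableAtFilter isOpen_Ioo t ht
    have h2 : HasDerivAt (fun u => Real.exp ((u - s) * P.mu k))
        (Real.exp ((t - s) * P.mu k) * (1 * P.mu k)) t :=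
      (((hasDerivAt_id t).sub_const s).mul_const _).exp
    have h3 := h2.mul (h1.const_add (D k * psi k))
    have h4 : (fun r => v r k) =ᶠ[𝓝 t] fun u =>
        Real.exp ((u - s) * P.mu k) * (D k * psi k + ∫ r in s..u, G k r) := by
      filter_upwards [Ioo_mem_nhds ht.1 ht.2] with u hu using hvk k u ⟨hu.1, hu.2.le⟩
    refine (h3.congr_of_eventuallyEq h4).congr_deriv ?_
    have h5 : Real.exp ((t - s) * P.mu k) * G k t = P.qsym k * H t k := by
      rw [hG]
      dsimp only
      rw [← mul_assoc, ← Real.exp_add, add_neg_cancel, Real.exp_zero, one_mul]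
    rw [hvk k t ⟨ht.1, ht.2.le⟩, h5]
    ring
  · have h1 : ContinuousOn (fun u => ∫ r in s..u, G k r) (Icc s t1) := by
      have := intervalIntegral.continuousOn_primitive_interval' (hGi k) left_mem_uIcc
      rwa [uIcc_of_le hst.le] at this
    have h2 : Tendsto (fun u => ∫ r in s..u, G k r) (𝓝[>] s) (𝓝 0) := by
      have h3 := (h1 s ⟨le_rfl, hst.le⟩).tendsto
      rw [intervalIntegral.integral_same] at h3
      refine h3.mono_left ?_
      rw [← nhdsWithin_Ioc_eq_nhdsGT hst]
      exact nhdsWithin_mono _ Ioc_subset_Icc_self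
    have hc : Continuous fun t => Real.exp ((t - s) * P.mu k) := by fun_prop
    have h4 := ((hc.tendsto s).mono_left (nhdsWithin_le_nhds (s := Ioi s))).mul
      (h2.const_add (D k * psi k))
    simp only [sub_self, zero_mul, Real.exp_zero, add_zero, one_mul] at h4
    refine h4.congr' ?_
    filter_upwards [Ioc_mem_nhdsGT hst] with t ht using (hvk k t ht).symm

/-- The two singularities are separated by an intermediate time m: on (s, m] the semigroup is
bounded and H integrable; on (m, t) H is bounded and the semigroup integrable. -/
lemma HalfOrder.integrableOn_heat_sub_apply_of_continuousOn {D : (Fin d → ℕ) → ℝ}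
    (hD : P.HalfOrder D) {s t : ℝ} (hst : s < t) {H : ℝ → P.Ell} (hHc : ContinuousOn H (Ioc s t))
    (hH : IntegrableOn H (Ioo s t)) :
    IntegrableOn (fun r => P.heat D (t - r) (H r)) (Ioo s t) := by
  obtain ⟨M, hM0, hM⟩ := hD.exists_norm_heat_le (t - s)
  obtain ⟨m, hm⟩ := exists_between hst
  have hunion : Ioo s t = Ioc s m ∪ Ioo m t := (Ioc_union_Ioo_eq_Ioo hm.1.le hm.2).symm
  rw [hunion]
  refine IntegrableOn.union ?_ ?_
  · have hsub : Ioc s m ⊆ Ioo s t := fun r hr => ⟨hr.1, hr.2.trans_lt hm.2⟩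
    have hb := ((hH.mono_set hsub).norm).const_mul (M * (t - m) ^ (-(1 / 2) : ℝ))
    refine Integrable.mono' hb ((ContinuousOn.aestronglyMeasurable
      ((hD.continuousOn_heat_sub_left t).mono fun r hr => hr.2.trans_lt hm.2)
      measurableSet_Ioc).clm_apply' (hH.mono_set hsub).aestronglyMeasurable) ?_
    filter_upwards [ae_restrict_mem measurableSet_Ioc] with r hr
    refine (P.heat D (t - r)).le_of_opNorm_le ?_ _
    refine (hM (t - r) (by linarith [hr.2, hm.2]) (by linarith [hr.1])).trans
      (mul_le_mul_of_nonneg_left ?_ hM0)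
    exact Real.rpow_le_rpow_of_nonpos (by linarith [hm.2]) (by linarith [hr.2]) (by norm_num)
  · obtain ⟨G, hG⟩ := isCompact_Icc.exists_bound_of_continuousOn
      (hHc.mono fun r (hr : r ∈ Icc m t) => ⟨hm.1.trans_le hr.1, hr.2⟩)
    exact hD.integrableOn_heat_sub_apply hm.2
      ((hH.mono_set (Ioo_subset_Ioo_left hm.1.le)).aestronglyMeasurable)
      fun r hr => hG r ⟨hr.1.le, hr.2.le⟩

namespace VolterraKernel

variable {F : Type*} [NormedAddCommGroup F] [NormedSpace ℝ F]

/-- Solutions of singular Volterra equations attain continuous initial data. -/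
lemma tendsto_of_solution {Ψ : ℝ → ℝ → F → F} {a b M C : ℝ} {v v0 : ℝ → F} {x0 : F}
    (hΨ : VolterraKernel Ψ a b M) (hab : a < b) (hv : SingularAt v a b C)
    (ev : ∀ t ∈ Ioc a b, v t = v0 t + ∫ r in a..t, Ψ t r (v r))
    (h0 : Tendsto v0 (𝓝[>] a) (𝓝 x0)) : Tendsto v (𝓝[>] a) (𝓝 x0) := by
  set D := M * (C + (b - a) ^ (1 / 2 : ℝ)) * betaConst (1 / 2) (1 / 2)
  have hM := hΨ.nonneg
  -- First v is bounded near a, because v0 converges and the integral term is at most D. With this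
  -- bound the integral improves to O((t - a)^(1/2)) and tends to 0.
  obtain ⟨c, hc, hcb⟩ : ∃ c, c ∈ Ioc a b ∧ ∀ t ∈ Ioc a c, ‖v t‖ ≤ ‖x0‖ + 1 + D := by
    have h1 : ∀ᶠ t in 𝓝[>] a, ‖v0 t‖ < ‖x0‖ + 1 := h0.norm.eventually_lt_const (by linarith)
    obtain ⟨u, hu, hu'⟩ := mem_nhdsGT_iff_exists_Ioc_subset.1 (h1.and (Ioc_mem_nhdsGT hab))
    refine ⟨u, ⟨hu, (hu' ⟨hu, le_rfl⟩).2.2⟩, fun t ht => ?_⟩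
    have h2 := hu' ht
    rw [ev t h2.2]
    exact (norm_add_le _ _).trans (add_le_add h2.1.le (hΨ.norm_integral_le hv h2.2))
  set R := ‖x0‖ + 1 + D
  have hint : Tendsto (fun t => ∫ r in a..t, Ψ t r (v r)) (𝓝[>] a) (𝓝 0) := by
    have hlim : Tendsto (fun t : ℝ => M * (R + 1) * ((t - a) ^ (1 / 2 : ℝ) *
        betaConst (1 / 2) 0)) (𝓝[>] a) (𝓝 0) := by
      have hcont : Continuous fun t : ℝ => M * (R + 1) * ((t - a) ^ (1 / 2 : ℝ) *
          betaConst (1 / 2) 0) :=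
        continuous_const.mul (((continuous_id.sub continuous_const).rpow_const
          fun t => Or.inr (by norm_num)).mul continuous_const)
      have := hcont.tendsto a
      rw [sub_self, Real.zero_rpow (by norm_num), zero_mul, mul_zero] at this
      exact this.mono_left nhdsWithin_le_nhds
    refine squeeze_zero_norm' ?_ hlim
    filter_upwards [Ioc_mem_nhdsGT hc.1] with t ht
    have hb := (intervalIntegrable_beta (α := 1 / 2) (β := 0) (by norm_num) (by norm_num)
      ht.1).const_mul (M * (R + 1))
    have h := intervalIntegral.norm_integral_le_of_norm_le (g := fun r =>
      M * (R + 1) * ((t - r) ^ (-(1 / 2) : ℝ) * (r - a) ^ (-0 : ℝ)))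
      (f := fun r => Ψ t r (v r)) ht.1.le ?_ hb
    · refine h.trans (le_of_eq ?_)
      rw [intervalIntegral.integral_const_mul, integral_beta ht.1]
      norm_num
    · have h1 : ∀ᵐ r : ℝ, r ≠ t := compl_mem_ae_iff.2 (measure_singleton t)
      filter_upwards [h1] with r hr hr'
      have hrt : r < t := lt_of_le_of_ne hr'.2 hr
      have e1 := hΨ.lip t r (v r) 0 hr'.1 hrt (ht.2.trans hc.2)
      have e2 := hΨ.zero t r hr'.1 hrt (ht.2.trans hc.2)
      have e3 := hcb r ⟨hr'.1, hr'.2.trans ht.2⟩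
      have e4 : 0 ≤ M * (t - r) ^ (-(1 / 2) : ℝ) :=
        mul_nonneg hM (Real.rpow_nonneg (by linarith) _)
      rw [sub_zero] at e1
      rw [neg_zero, Real.rpow_zero, mul_one]
      calc ‖Ψ t r (v r)‖ ≤ ‖Ψ t r (v r) - Ψ t r 0‖ + ‖Ψ t r 0‖ := by
            simpa using norm_add_le (Ψ t r (v r) - Ψ t r 0) (Ψ t r 0)
        _ ≤ M * (t - r) ^ (-(1 / 2) : ℝ) * ‖v r‖ + M * (t - r) ^ (-(1 / 2) : ℝ) := by linarith
        _ ≤ M * (t - r) ^ (-(1 / 2) : ℝ) * R + M * (t - r) ^ (-(1 / 2) : ℝ) :=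
            add_le_add (mul_le_mul_of_nonneg_left e3 e4) le_rfl
        _ = _ := by ring
  have h2 := h0.add hint
  rw [add_zero] at h2
  refine h2.congr' ?_
  filter_upwards [Ioc_mem_nhdsGT hab] with t ht using (ev t ht).symm

end VolterraKernel

/-- The Volterra kernel belonging to a Lipschitz perturbation of the linear part. -/
lemma exists_volterraKernel_heat {Φ : ℝ → P.Ell → P.Ell} {a b K : ℝ}
    (hc : ContinuousOn (fun p : ℝ × P.Ell => Φ p.1 p.2) (Icc a b ×ˢ univ))
    (hlip : ∀ r ∈ Icc a b, ∀ x y, ‖Φ r x - Φ r y‖ ≤ K * ‖x - y‖)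
    (h0 : ∀ r ∈ Icc a b, ‖Φ r 0‖ ≤ K) (hK : 0 ≤ K) :
    ∃ M, VolterraKernel (fun t r x => P.heat P.qsym (t - r) (Φ r x)) a b M := by
  have hq := P.halfOrder_qsym
  obtain ⟨M, hM0, hM⟩ := hq.exists_norm_heat_le (b - a)
  refine ⟨M * K, ?_, mul_nonneg hM0 hK, fun t r x y h1 h2 h3 => ?_, fun t r h1 h2 h3 => ?_⟩
  · refine ContinuousOn.clm_apply
      (hq.continuousOn_heat.comp (Continuous.continuousOn (by fun_prop)) fun p hp => ?_)
      (hc.comp (f := fun p : ℝ × ℝ × P.Ell => (p.2.1, p.2.2))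
        (Continuous.continuousOn (by fun_prop)) fun p hp => ⟨⟨?_, ?_⟩, mem_univ _⟩)
    · exact sub_pos.2 hp.2.1
    · exact hp.1.le
    · exact hp.2.1.le.trans hp.2.2
  · rw [← map_sub]
    calc _ ≤ ‖P.heat P.qsym (t - r)‖ * ‖Φ r x - Φ r y‖ := ContinuousLinearMap.le_opNorm _ _
      _ ≤ (M * (t - r) ^ (-(1 / 2) : ℝ)) * (K * ‖x - y‖) :=
          mul_le_mul (hM _ (by linarith) (by linarith)) (hlip r ⟨h1.le, h2.le.trans h3⟩ x y)
            (norm_nonneg _) (mul_nonneg hM0 (Real.rpow_nonneg (by linarith) _))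
      _ = _ := by ring
  · calc _ ≤ ‖P.heat P.qsym (t - r)‖ * ‖Φ r 0‖ := ContinuousLinearMap.le_opNorm _ _
      _ ≤ (M * (t - r) ^ (-(1 / 2) : ℝ)) * K :=
          mul_le_mul (hM _ (by linarith) (by linarith)) (h0 r ⟨h1.le, h2.le.trans h3⟩)
            (norm_nonneg _) (mul_nonneg hM0 (Real.rpow_nonneg (by linarith) _))
      _ = _ := by ring

lemma HalfOrder.exists_singularAt_heat {D : (Fin d → ℕ) → ℝ} (hD : P.HalfOrder D) (psi : P.Ell)
    (a b : ℝ) : ∃ C, SingularAt (fun t => P.heat D (t - a) psi) a b C := by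
  obtain ⟨M, hM0, hM⟩ := hD.exists_norm_heat_le (b - a)
  refine ⟨M * ‖psi‖, ((hD.continuousOn_heat_sub_right a).mono fun t ht => ht.1).clm_apply
    continuousOn_const, fun t ht => ?_⟩
  refine ((P.heat D (t - a)).le_of_opNorm_le (hM _ (by linarith [ht.1]) (by linarith [ht.2]))
    psi).trans (le_of_eq ?_)
  ring

lemma SingularAt.integrableOn {F : Type*} [NormedAddCommGroup F] {v : ℝ → F} {a b C : ℝ}
    (hv : SingularAt v a b C) (hab : a < b) : IntegrableOn v (Ioo a b) := by
  have hb := (intervalIntegrable_beta (α := 0) (β := 1 / 2) (by norm_num) (by norm_num)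
    hab).const_mul C
  rw [intervalIntegrable_iff_integrableOn_Ioo_of_le hab.le] at hb
  refine Integrable.mono' hb ((hv.cont.mono Ioo_subset_Ioc_self).aestronglyMeasurable
    measurableSet_Ioo) ?_
  filter_upwards [ae_restrict_mem measurableSet_Ioo] with r hr
  simpa using hv.bound r ⟨hr.1, hr.2.le⟩

/-! ### The evolution operators -/

variable {t0 t1 : ℝ}

lemma extZero_apply {a : C(Icc t0 t1, P.Ell)} {t : ℝ} (ht : t ∈ Icc t0 t1) :
    extZero a t = a ⟨t, ht⟩ := dif_pos ht

lemma continuousOn_extZero (a : C(Icc t0 t1, P.Ell)) : ContinuousOn (extZero a) (Icc t0 t1) := by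
  rw [continuousOn_iff_continuous_domRestrict]
  have : (Icc t0 t1).domRestrict (extZero a) = a := funext fun t => extZero_apply t.2
  rw [this]
  exact a.continuous

/-- The derivative of the nonlinearity along `a`. -/
def linCoeff (a : C(Icc t0 t1, P.Ell)) (r : ℝ) : P.Ell →L[ℝ] P.Ell :=
  fderiv ℝ P.nonlin (extZero a r)

lemma continuousOn_linCoeff (a : C(Icc t0 t1, P.Ell)) : ContinuousOn (linCoeff a) (Icc t0 t1) :=
  continuous_fderiv_nonlin.comp_continuousOn (continuousOn_extZero a)

lemma exists_linCoeff_kernel (a : C(Icc t0 t1, P.Ell)) {s : ℝ} (hs : s ∈ Ico t0 t1) :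
    ∃ M, VolterraKernel (fun t r x => P.heat P.qsym (t - r) (linCoeff a r x)) s t1 M := by
  have hA := (continuousOn_linCoeff a).mono (Icc_subset_Icc_left hs.1)
  obtain ⟨K, hK⟩ := isCompact_Icc.exists_bound_of_continuousOn hA
  have hK0 : 0 ≤ K := (norm_nonneg _).trans (hK s ⟨le_rfl, hs.2.le⟩)
  refine exists_volterraKernel_heat (K := K) ?_ (fun r hr x y => ?_) (fun r hr => ?_) hK0
  · exact (hA.comp continuous_fst.continuousOn fun p hp => hp.1).clm_apply
      continuous_snd.continuousOn
  · rw [← map_sub]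
    exact (linCoeff a r).le_of_opNorm_le (hK r hr) _
  · simpa using hK0

/-- Linearized solutions are mild solutions. -/
lemma IsLinearizedSolution.mild {a : C(Icc t0 t1, P.Ell)} {s : ℝ} (hs : s ∈ Ico t0 t1)
    {D : (Fin d → ℕ) → ℝ} (hD : P.HalfOrder D) {psi : P.Ell} {b : ℝ → P.Ell}
    (hb : IsLinearizedSolution a s (fun k => D k * psi k) b) {t : ℝ} (ht : t ∈ Ioc s t1) :
    b t = P.heat D (t - s) psi + ∫ r in s..t, P.heat P.qsym (t - r) (linCoeff a r (b r)) := by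
  have hA := (continuousOn_linCoeff a).mono (Icc_subset_Icc_left hs.1)
  have hHc : ContinuousOn (fun r => linCoeff a r (b r)) (Ioc s t1) :=
    (hA.mono Ioc_subset_Icc_self).clm_apply hb.cont
  obtain ⟨K, hK⟩ := isCompact_Icc.exists_bound_of_continuousOn hA
  have hbi : IntegrableOn (fun r => ‖b r‖) (Ioo s t1) := hb.integrable.mono_set Ioo_subset_Ioc_self
  have hH : IntegrableOn (fun r => linCoeff a r (b r)) (Ioo s t1) := by
    refine Integrable.mono' (hbi.const_mul K)
      ((hHc.mono Ioo_subset_Ioc_self).aestronglyMeasurable measurableSet_Ioo) ?_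
    filter_upwards [ae_restrict_mem measurableSet_Ioo] with r hr
    exact (linCoeff a r).le_of_opNorm_le (hK r ⟨hr.1.le, hr.2.le⟩) _
  have h := mild_of_coeff hD (f := fun _ => 0) hb.cont hH (by simp [IntegrableOn])
    (fun t ht k => ?_) hb.init ht
    (P.halfOrder_qsym.integrableOn_heat_sub_apply_of_continuousOn ht.1
      (hHc.mono (Ioc_subset_Ioc_right ht.2)) (hH.mono_set (Ioo_subset_Ioo_right ht.2)))
    (by simp [IntegrableOn])
  · simpa using h
  · have := hb.ode t ht k
    simpa [Ell.zero_apply, Lop, Q, Dnonlin, linCoeff] using this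

lemma exists_isLinearizedSolution (a : C(Icc t0 t1, P.Ell)) {s : ℝ} (hs : s ∈ Ico t0 t1)
    {D : (Fin d → ℕ) → ℝ} (hD : P.HalfOrder D) (psi : P.Ell) :
    ∃ b C, SingularAt b s t1 C ∧ IsLinearizedSolution a s (fun k => D k * psi k) b := by
  obtain ⟨M, hΨ⟩ := exists_linCoeff_kernel a hs
  obtain ⟨C0, hv0⟩ := hD.exists_singularAt_heat psi s t1
  obtain ⟨b, C, hb, hmild⟩ := hΨ.exists_solution hs.2 hv0
  have hbi := hb.integrableOn hs.2
  have hA := (continuousOn_linCoeff a).mono (Icc_subset_Icc_left hs.1)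
  have hHc : ContinuousOn (fun r => linCoeff a r (b r)) (Ioc s t1) :=
    (hA.mono Ioc_subset_Icc_self).clm_apply hb.cont
  obtain ⟨K, hK⟩ := isCompact_Icc.exists_bound_of_continuousOn hA
  have hH : IntegrableOn (fun r => linCoeff a r (b r)) (Ioo s t1) := by
    refine Integrable.mono' (hbi.norm.const_mul K)
      ((hHc.mono Ioo_subset_Ioc_self).aestronglyMeasurable measurableSet_Ioo) ?_
    filter_upwards [ae_restrict_mem measurableSet_Ioo] with r hr
    exact (linCoeff a r).le_of_opNorm_le (hK r ⟨hr.1.le, hr.2.le⟩) _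
  obtain ⟨h1, h2⟩ := coeff_of_mild hD hs.2 (hHc.mono Ioo_subset_Ioc_self) hH (fun t ht =>
    P.halfOrder_qsym.integrableOn_heat_sub_apply_of_continuousOn ht.1
      (hHc.mono (Ioc_subset_Ioc_right ht.2)) (hH.mono_set (Ioo_subset_Ioo_right ht.2))) hmild
  exact ⟨b, C, hb, hb.cont, (integrableOn_Ioc_iff_integrableOn_Ioo (by simp)).2 hbi.norm, h1, h2⟩

/-- Any linearized solution is given by the resolvent, hence is unique. -/
lemma IsLinearizedSolution.eq_resolventOp {a : C(Icc t0 t1, P.Ell)} {s t : ℝ} (hs : t0 ≤ s)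
    (hst : s < t) (ht : t ≤ t1) {V : ℝ → P.Ell →L[ℝ] P.Ell}
    (hV : P.IsResolvent (linCoeff a) V t0 t) {D : (Fin d → ℕ) → ℝ} (hD : P.HalfOrder D)
    {psi : P.Ell} {b : ℝ → P.Ell} (hb : IsLinearizedSolution a s (fun k => D k * psi k) b) :
    b t = P.resolventOp (linCoeff a) V t D s psi := by
  have hbi : IntegrableOn b (Ioo s t) := by
    have h1 : IntegrableOn (fun r => ‖b r‖) (Ioo s t) := hb.integrable.mono_set
      fun r hr => ⟨hr.1, hr.2.le.trans ht⟩
    refine (integrable_norm_iff ?_).1 h1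
    exact (hb.cont.mono fun r (hr : r ∈ Ioo s t) => ⟨hr.1, hr.2.le.trans ht⟩).aestronglyMeasurable
      measurableSet_Ioo
  have h := hV.duhamel ((continuousOn_linCoeff a).mono (Icc_subset_Icc_right ht)) ⟨hs, hst⟩ hD
    (psi := psi) (v := b) (g := fun _ => 0) (f := fun _ => 0) (G := 0) (δ := 0) hbi
    aestronglyMeasurable_const (by simp) aestronglyMeasurable_const (by simp) fun r hr => by
      simpa using hb.mild ⟨hs, hst.trans_le ht⟩ hD ⟨hr.1, hr.2.trans ht⟩
  simpa using h

/-- The choice in `evol` is immaterial: every linearized solution takes at t the value prescribed by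
the resolvent for that final time. -/
lemma evol_eq_of_isLinearizedSolution {a : C(Icc t0 t1, P.Ell)} {s t : ℝ} (hs : t0 ≤ s)
    (hst : s < t) (ht : t ≤ t1) {D : (Fin d → ℕ) → ℝ} (hD : P.HalfOrder D) {psi : P.Ell}
    {b : ℝ → P.Ell} (hb : IsLinearizedSolution a s (fun k => D k * psi k) b) :
    evol a t s (fun k => D k * psi k) = b t := by
  have hex : ∃ b, IsLinearizedSolution a s (fun k => D k * psi k) b := ⟨b, hb⟩
  obtain ⟨V, hV⟩ := exists_isResolvent (continuousOn_linCoeff a) ⟨hs.trans_lt hst, ht⟩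
  rw [evol, dif_pos hex, hb.eq_resolventOp hs hst ht hV hD]
  exact hex.choose_spec.eq_resolventOp hs hst ht hV hD

/-- The evolution operators are given by the resolvent. -/
theorem evol_eq_resolventOp (a : C(Icc t0 t1, P.Ell)) {s t : ℝ} (hs : t0 ≤ s) (hst : s < t)
    (ht : t ≤ t1) {V : ℝ → P.Ell →L[ℝ] P.Ell} (hV : P.IsResolvent (linCoeff a) V t0 t)
    {D : (Fin d → ℕ) → ℝ} (hD : P.HalfOrder D) (psi : P.Ell) :
    evol a t s (fun k => D k * psi k) = P.resolventOp (linCoeff a) V t D s psi := by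
  obtain ⟨b, -, -, hb⟩ := exists_isLinearizedSolution a ⟨hs, hst.trans_le ht⟩ hD psi
  rw [evol_eq_of_isLinearizedSolution hs hst ht hD hb, hb.eq_resolventOp hs hst ht hV hD]

/-- A bound on the evolution operators with initial time in `(t0, t)` extends to `t0`. -/
lemma norm_evol_le_of_forall_gt (a : C(Icc t0 t1, P.Ell)) {t W : ℝ} (ht : t ∈ Ioc t0 t1)
    (hW : ∀ s, t0 < s → s < t → ∀ phi : P.Ell, ‖evol a t s phi‖ ≤ W * ‖phi‖) (phi : P.Ell) :
    ‖evol a t t0 phi‖ ≤ W * ‖phi‖ := by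
  have h1 := P.halfOrder_one
  have hone : ∀ x : P.Ell, (fun k => (1 : ℝ) * x k) = x.1 := fun x => funext fun k => one_mul _
  have ht01 : t0 < t1 := ht.1.trans_le ht.2
  obtain ⟨b, C, hbS, hb⟩ := exists_isLinearizedSolution a ⟨le_rfl, ht01⟩ h1 phi
  have hlim : Tendsto b (𝓝[>] t0) (𝓝 phi) := by
    obtain ⟨M, hΨ⟩ := exists_linCoeff_kernel a ⟨le_rfl, ht01⟩
    refine hΨ.tendsto_of_solution ht01 hbS (fun t ht => hb.mild ⟨le_rfl, ht01⟩ h1 ht) ?_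
    refine (tendsto_heat_one phi).comp ?_
    refine tendsto_nhdsWithin_iff.2 ⟨?_, ?_⟩
    · have : Continuous fun t => t - t0 := by fun_prop
      have := this.tendsto t0
      rw [sub_self] at this
      exact this.mono_left nhdsWithin_le_nhds
    · filter_upwards [self_mem_nhdsWithin] with t ht using sub_pos.2 (mem_Ioi.1 ht)
  -- Evolution property: b restarted at s solves the linearized problem with datum b s. Letting s
  -- decrease to t0, where b s tends to the datum, gives the bound at t0 itself, which the assumed
  -- bounds omit.
  have hkey : ∀ s ∈ Ioo t0 t, ‖b t‖ ≤ W * ‖b s‖ := fun s hs => by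
    have hbs : IsLinearizedSolution a s (fun k => (1 : ℝ) * b s k) b := by
      refine ⟨hb.cont.mono (Ioc_subset_Ioc_left hs.1.le),
        hb.integrable.mono_set (Ioc_subset_Ioc_left hs.1.le),
        fun r hr k => hb.ode r ⟨hs.1.trans hr.1, hr.2⟩ k, fun k => ?_⟩
      rw [one_mul]
      have h2 : ContinuousAt b s :=
        hb.cont.continuousAt (Ioc_mem_nhds hs.1 (hs.2.trans_le ht.2))
      exact (((P.coeffL k).continuous.tendsto _).comp h2.tendsto).mono_left nhdsWithin_le_nhds
    have h3 := evol_eq_of_isLinearizedSolution hs.1.le hs.2 ht.2 h1 hbs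
    rw [hone] at h3
    rw [← h3]
    exact hW s hs.1 hs.2 (b s)
  have h4 := evol_eq_of_isLinearizedSolution le_rfl ht.1 ht.2 h1 hb
  rw [hone] at h4
  rw [h4]
  refine ge_of_tendsto (hlim.norm.const_mul W) ?_
  filter_upwards [Ioo_mem_nhdsGT ht.1] with s hs using hkey s hs

end PDEData
end

noncomputable section
namespace PDEData

open MeasureTheory

variable {d : ℕ} {P : PDEData d}

/-! ### Measurability -/

/-- The sequence with the single nonzero entry `1` at `k`. -/
def Ell.single (P : PDEData d) (k : Fin d → ℕ) : P.Ell :=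
  ⟨Pi.single k 1, summable_of_ne_finset_zero (s := {k}) fun j hj => by
    rw [Finset.mem_singleton] at hj
    simp [hj]⟩

lemma Ell.norm_single (k : Fin d → ℕ) : ‖Ell.single P k‖ = P.omega k := by
  rw [Ell.norm_def, tsum_eq_single k fun j hj => by simp [Ell.single, hj]]
  simp [Ell.single]

lemma Ell.hasSum_single (a : P.Ell) : HasSum (fun k => a k • Ell.single P k) a := by
  have h1 : Summable fun k => a k • Ell.single P k := by
    refine Summable.of_norm ?_
    simp_rw [norm_smul, Ell.norm_single, Real.norm_eq_abs]
    exact a.summable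
  have h2 : ∑' k, a k • Ell.single P k = a := by
    refine Ell.ext fun j => ?_
    rw [← coeffL_apply, (P.coeffL j).map_tsum h1, tsum_eq_single j fun k hk => by
      rw [map_smul, coeffL_apply, Ell.single]
      simp [hk.symm]]
    rw [map_smul, coeffL_apply, Ell.single]
    simp
  have h3 := h1.hasSum
  rwa [h2] at h3

/-- The finite partial sums of the expansion in unit sequences are continuous and converge
pointwise. Needed for the defect, which is known to be continuous only coefficient by coefficient.
-/
lemma aestronglyMeasurable_of_coeff {g : ℝ → P.Ell} {S : Set ℝ} (hS : MeasurableSet S)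
    (hg : ∀ k, ContinuousOn (fun r => g r k) S) : AEStronglyMeasurable g (volume.restrict S) :=
  aestronglyMeasurable_of_tendsto_ae (u := atTop)
    (f := fun (s : Finset (Fin d → ℕ)) r => ∑ k ∈ s, g r k • Ell.single P k)
    (fun s => (continuousOn_finsetSum s fun k _ =>
      (hg k).smul continuousOn_const).aestronglyMeasurable hS)
    (Eventually.of_forall fun r => (g r).hasSum_single)

/-! ### Truncation of the nonlinearity -/

/-- The radial retraction onto the ball of radius `ρ`. -/
def radial {E : Type*} [NormedAddCommGroup E] [NormedSpace ℝ E] (ρ : ℝ) (x : E) : E :=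
  (ρ / max ρ ‖x‖) • x

section Radial

variable {E : Type*} [NormedAddCommGroup E] [NormedSpace ℝ E] {ρ : ℝ}

lemma norm_radial_le (hρ : 0 < ρ) (x : E) : ‖radial ρ x‖ ≤ ρ := by
  have h : 0 < max ρ ‖x‖ := lt_max_of_lt_left hρ
  rw [radial, norm_smul, norm_div, Real.norm_of_nonneg hρ.le, Real.norm_of_nonneg h.le,
    div_mul_eq_mul_div, div_le_iff₀ h]
  exact mul_le_mul_of_nonneg_left (le_max_right _ _) hρ.le

lemma radial_of_norm_le (hρ : 0 < ρ) {x : E} (hx : ‖x‖ ≤ ρ) : radial ρ x = x := by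
  rw [radial, max_eq_left hx, div_self hρ.ne', one_smul]

/-- The change of the vector and the change of the scalar factor contribute ‖x - y‖ each. The
constant 2 affects only the solvability of the truncated equation; the error estimate uses just
‖radial ρ x‖ ≤ ρ. -/
lemma norm_radial_sub_le (hρ : 0 < ρ) (x y : E) : ‖radial ρ x - radial ρ y‖ ≤ 2 * ‖x - y‖ := by
  have hx : 0 < max ρ ‖x‖ := lt_max_of_lt_left hρ
  have hy : 0 < max ρ ‖y‖ := lt_max_of_lt_left hρ
  have e : radial ρ x - radial ρ y =
      (ρ / max ρ ‖x‖) • (x - y) + (ρ / max ρ ‖x‖ - ρ / max ρ ‖y‖) • y := by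
    unfold radial
    module
  have h1 : ‖(ρ / max ρ ‖x‖) • (x - y)‖ ≤ ‖x - y‖ := by
    rw [norm_smul, Real.norm_of_nonneg (by positivity)]
    exact mul_le_of_le_one_left (norm_nonneg _) ((div_le_one hx).2 (le_max_left _ _))
  have h2 : ‖(ρ / max ρ ‖x‖ - ρ / max ρ ‖y‖) • y‖ ≤ ‖x - y‖ := by
    have e2 : ρ / max ρ ‖x‖ - ρ / max ρ ‖y‖ =
        ρ / max ρ ‖x‖ * ((max ρ ‖y‖ - max ρ ‖x‖) / max ρ ‖y‖) := by
      field_simp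
    have h3 : |max ρ ‖y‖ - max ρ ‖x‖| ≤ ‖x - y‖ := by
      refine (abs_max_sub_max_le_max _ _ _ _).trans ?_
      rw [sub_self, abs_zero, max_eq_right (abs_nonneg _), abs_sub_comm]
      exact abs_norm_sub_norm_le x y
    rw [norm_smul, e2, norm_mul, norm_div (max ρ ‖y‖ - max ρ ‖x‖), Real.norm_of_nonneg hy.le,
      mul_assoc]
    have h4 : ‖ρ / max ρ ‖x‖‖ ≤ 1 := by
      rw [Real.norm_of_nonneg (by positivity)]
      exact (div_le_one hx).2 (le_max_left _ _)
    refine (mul_le_of_le_one_left (by positivity) h4).trans ?_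
    rw [div_mul_eq_mul_div, div_le_iff₀ hy]
    exact mul_le_mul h3 (le_max_right _ _) (norm_nonneg _) (norm_nonneg _)
  rw [e]
  exact (norm_add_le _ _).trans (by linarith)

end Radial

variable {t0 t1 : ℝ}

/-- The quadratic remainder of the nonlinearity at `a r`. -/
def remainder (a : C(Icc t0 t1, P.Ell)) (r : ℝ) (z : P.Ell) : P.Ell :=
  P.nonlin (extZero a r + z) - P.nonlin (extZero a r) - linCoeff a r z

/-- The nonlinearity, modified outside the ball of radius `ρ` about `a r` so as to become globally
Lipschitz. -/
def trunc (a : C(Icc t0 t1, P.Ell)) (ρ : ℝ) (r : ℝ) (x : P.Ell) : P.Ell :=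
  P.nonlin (extZero a r) + linCoeff a r (x - extZero a r) +
    remainder a r (radial ρ (x - extZero a r))

lemma trunc_of_norm_le {a : C(Icc t0 t1, P.Ell)} {ρ r : ℝ} (hρ : 0 < ρ) {x : P.Ell}
    (hx : ‖x - extZero a r‖ ≤ ρ) : trunc a ρ r x = P.nonlin x := by
  rw [trunc, radial_of_norm_le hρ hx, remainder, add_sub_cancel]
  abel

/-- The Lipschitz condition on the nonlinearity in the ball of radius `ρ` about `a`. -/
def LipBound (a : C(Icc t0 t1, P.Ell)) (ρ L : ℝ) : Prop :=
  ∀ a1 a2 : C(Icc t0 t1, P.Ell), ‖a1 - a‖ ≤ ρ → ‖a2 - a‖ ≤ ρ →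
    ∀ r, ‖P.nonlin (a1 r) - P.nonlin (a2 r) - P.Dnonlin (a r) (a1 r - a2 r)‖ ≤ L * ‖a1 - a2‖

variable {a : C(Icc t0 t1, P.Ell)} {ρ L : ℝ}

/-- The hypothesis concerns functions of time; it is applied to a shifted by the constant functions
y and z, and evaluated at r. -/
lemma LipBound.norm_remainder_sub_le (h : LipBound a ρ L) (hL : 0 ≤ L) {r : ℝ}
    (hr : r ∈ Icc t0 t1) {y z : P.Ell} (hy : ‖y‖ ≤ ρ) (hz : ‖z‖ ≤ ρ) :
    ‖remainder a r y - remainder a r z‖ ≤ L * ‖y - z‖ := by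
  have hconst : ∀ x : P.Ell, ‖ContinuousMap.const (Icc t0 t1) x‖ ≤ ‖x‖ := fun x =>
    (ContinuousMap.norm_le _ (norm_nonneg x)).2 fun _ => le_rfl
  have h1 := h (a + ContinuousMap.const _ y) (a + ContinuousMap.const _ z)
    (by rw [add_sub_cancel_left]; exact (hconst y).trans hy)
    (by rw [add_sub_cancel_left]; exact (hconst z).trans hz) ⟨r, hr⟩
  have e1 : remainder a r y - remainder a r z = P.nonlin (a ⟨r, hr⟩ + y) -
      P.nonlin (a ⟨r, hr⟩ + z) - P.Dnonlin (a ⟨r, hr⟩) (a ⟨r, hr⟩ + y - (a ⟨r, hr⟩ + z)) := by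
    rw [remainder, remainder, linCoeff, extZero_apply hr, add_sub_add_left_eq_sub, Dnonlin,
      map_sub]
    abel
  have e2 : a + ContinuousMap.const (Icc t0 t1) y - (a + ContinuousMap.const (Icc t0 t1) z) =
      ContinuousMap.const (Icc t0 t1) (y - z) := by
    rw [add_sub_add_left_eq_sub]
    rfl
  rw [e1]
  refine h1.trans (mul_le_mul_of_nonneg_left ?_ hL)
  rw [e2]
  exact hconst _

lemma LipBound.norm_remainder_le (h : LipBound a ρ L) (hL : 0 ≤ L) (hρ : 0 < ρ) {r : ℝ}
    (hr : r ∈ Icc t0 t1) {z : P.Ell} (hz : ‖z‖ ≤ ρ) : ‖remainder a r z‖ ≤ L * ρ := by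
  have h1 := h.norm_remainder_sub_le hL hr hz (z := 0) (by simpa using hρ.le)
  have h2 : remainder a r 0 = 0 := by simp [remainder]
  rw [h2, sub_zero, sub_zero] at h1
  exact h1.trans (mul_le_mul_of_nonneg_left hz hL)

lemma continuous_radial {E : Type*} [NormedAddCommGroup E] [NormedSpace ℝ E] (hρ : 0 < ρ) :
    Continuous (radial ρ : E → E) := by
  have : LipschitzWith 2 (radial ρ : E → E) := LipschitzWith.of_dist_le_mul fun x y => by
    rw [dist_eq_norm, dist_eq_norm]
    exact norm_radial_sub_le hρ x y
  exact this.continuous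

lemma continuousOn_remainder (a : C(Icc t0 t1, P.Ell)) :
    ContinuousOn (fun p : ℝ × P.Ell => remainder a p.1 p.2) (Icc t0 t1 ×ˢ univ) := by
  have h1 : ContinuousOn (fun p : ℝ × P.Ell => extZero a p.1) (Icc t0 t1 ×ˢ univ) :=
    (continuousOn_extZero a).comp continuous_fst.continuousOn fun p hp => hp.1
  have h2 : ContinuousOn (fun p : ℝ × P.Ell => linCoeff a p.1) (Icc t0 t1 ×ˢ univ) :=
    (continuousOn_linCoeff a).comp continuous_fst.continuousOn fun p hp => hp.1
  exact ((continuous_nonlin.comp_continuousOn (h1.add continuous_snd.continuousOn)).sub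
    (continuous_nonlin.comp_continuousOn h1)).sub (h2.clm_apply continuous_snd.continuousOn)

lemma continuousOn_trunc (a : C(Icc t0 t1, P.Ell)) (hρ : 0 < ρ) :
    ContinuousOn (fun p : ℝ × P.Ell => trunc a ρ p.1 p.2) (Icc t0 t1 ×ˢ univ) := by
  have h1 : ContinuousOn (fun p : ℝ × P.Ell => extZero a p.1) (Icc t0 t1 ×ˢ univ) :=
    (continuousOn_extZero a).comp continuous_fst.continuousOn fun p hp => hp.1
  have h2 : ContinuousOn (fun p : ℝ × P.Ell => linCoeff a p.1) (Icc t0 t1 ×ˢ univ) :=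
    (continuousOn_linCoeff a).comp continuous_fst.continuousOn fun p hp => hp.1
  have h3 : ContinuousOn (fun p : ℝ × P.Ell => p.2 - extZero a p.1) (Icc t0 t1 ×ˢ univ) :=
    continuous_snd.continuousOn.sub h1
  exact ((continuous_nonlin.comp_continuousOn h1).add (h2.clm_apply h3)).add
    ((continuousOn_remainder a).comp (f := fun p : ℝ × P.Ell =>
      (p.1, radial ρ (p.2 - extZero a p.1))) (continuous_fst.continuousOn.prodMk
        ((continuous_radial hρ).comp_continuousOn h3)) fun p hp => ⟨hp.1, mem_univ _⟩)

/-- The linear term contributes a bound on the derivative along a, the retracted remainder the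
constant 2L. The last summand of K bounds the value at 0. -/
lemma LipBound.exists_volterraKernel (h : LipBound a ρ L) (hL : 0 ≤ L) (hρ : 0 < ρ) :
    ∃ M, VolterraKernel (fun t r x => P.heat P.qsym (t - r) (trunc a ρ r x)) t0 t1 M := by
  obtain ⟨K, hK⟩ := isCompact_Icc.exists_bound_of_continuousOn (continuousOn_linCoeff a)
  obtain ⟨K0, hK0⟩ := isCompact_Icc.exists_bound_of_continuousOn
    ((continuousOn_trunc a hρ).comp (f := fun r : ℝ => (r, (0 : P.Ell))) (s := Icc t0 t1)
      (Continuous.continuousOn (by fun_prop)) fun r hr => ⟨hr, mem_univ _⟩)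
  refine exists_volterraKernel_heat (K := |K| + 2 * L + |K0|) (continuousOn_trunc a hρ)
    (fun r hr x y => ?_) (fun r hr => ?_) (by positivity)
  · have e : trunc a ρ r x - trunc a ρ r y = linCoeff a r (x - y) +
        (remainder a r (radial ρ (x - extZero a r)) -
          remainder a r (radial ρ (y - extZero a r))) := by
      simp only [trunc, map_sub]
      abel
    have h1 := (linCoeff a r).le_of_opNorm_le (hK r hr) (x - y)
    have h2 := h.norm_remainder_sub_le hL hr (norm_radial_le hρ (x - extZero a r))
      (norm_radial_le hρ (y - extZero a r))
    have h3 := norm_radial_sub_le hρ (x - extZero a r) (y - extZero a r)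
    rw [sub_sub_sub_cancel_right] at h3
    have h4 := mul_le_mul_of_nonneg_left h3 hL
    have h5 := mul_le_mul_of_nonneg_right (le_abs_self K) (norm_nonneg (x - y))
    have h6 := mul_nonneg (abs_nonneg K0) (norm_nonneg (x - y))
    rw [e]
    exact (norm_add_le _ _).trans (by linarith)
  · refine (hK0 r hr).trans ((le_abs_self _).trans ?_)
    have := abs_nonneg K
    linarith

/-! ### The equation on one step -/

/-- `v` is the mild solution of the truncated equation. -/
def IsTruncSol (a : C(Icc t0 t1, P.Ell)) (ρ : ℝ) (v : C(Icc t0 t1, P.Ell)) : Prop :=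
  ∀ t ∈ Ioc t0 t1, extZero v t = P.heat (fun _ => 1) (t - t0) (extZero v t0) +
    ∫ r in t0..t, P.heat P.qsym (t - r) (trunc a ρ r (extZero v r))

lemma tendsto_heat_one_sub (x : P.Ell) (s : ℝ) :
    Tendsto (fun t => P.heat (fun _ => 1) (t - s) x) (𝓝[>] s) (𝓝 x) := by
  refine (tendsto_heat_one x).comp (tendsto_nhdsWithin_iff.2 ⟨?_, ?_⟩)
  · have : Continuous fun t => t - s := by fun_prop
    have := this.tendsto s
    rw [sub_self] at this
    exact this.mono_left nhdsWithin_le_nhds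
  · filter_upwards [self_mem_nhdsWithin] with t ht using sub_pos.2 (mem_Ioi.1 ht)

/-- The kernel is globally Lipschitz, so the solution reaches the end of the step for every initial
value, without any smallness. Continuity of the semigroup at time zero allows it to be extended to
t0. -/
theorem LipBound.exists_isTruncSol (h : LipBound a ρ L) (hL : 0 ≤ L) (hρ : 0 < ρ) (ht : t0 < t1)
    (x0 : P.Ell) : ∃ v : C(Icc t0 t1, P.Ell), extZero v t0 = x0 ∧ IsTruncSol a ρ v := by
  obtain ⟨M, hΨ⟩ := h.exists_volterraKernel hL hρ
  obtain ⟨C0, hv0⟩ := P.halfOrder_one.exists_singularAt_heat x0 t0 t1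
  obtain ⟨v, C, hv, hmild⟩ := hΨ.exists_solution ht hv0
  have hlim := hΨ.tendsto_of_solution ht hv hmild (tendsto_heat_one_sub x0 t0)
  obtain ⟨w, hw⟩ : ∃ w : ℝ → P.Ell, w = Function.update v t0 x0 := ⟨_, rfl⟩
  have hw0 : w t0 = x0 := by rw [hw, Function.update_self]
  have hw1 : ∀ t ∈ Ioc t0 t1, w t = v t := fun t ht => by
    rw [hw, Function.update_of_ne ht.1.ne']
  have hwc : ContinuousOn w (Icc t0 t1) := by
    intro t htt
    rcases htt.1.eq_or_lt with rfl | h1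
    · rw [hw, continuousWithinAt_update_same]
      refine hlim.mono_left ?_
      exact nhdsWithin_mono _ fun r hr => lt_of_le_of_ne hr.1.1 (Ne.symm hr.2)
    · have h2 : ContinuousWithinAt w (Ioc t0 t1) t :=
        (hv.cont.congr hw1) t ⟨h1, htt.2⟩
      refine h2.mono_of_mem_nhdsWithin ?_
      exact mem_nhdsWithin.2 ⟨Ioi t0, isOpen_Ioi, h1, fun r hr => ⟨hr.1, hr.2.2⟩⟩
  refine ⟨⟨(Icc t0 t1).domRestrict w, continuousOn_iff_continuous_domRestrict.1 hwc⟩, ?_,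
    fun t htt => ?_⟩
  · rw [extZero_apply ⟨le_rfl, ht.le⟩]
    exact hw0
  · rw [extZero_apply ⟨htt.1.le, htt.2⟩, extZero_apply ⟨le_rfl, ht.le⟩]
    change w t = P.heat (fun _ => 1) (t - t0) (w t0) + _
    rw [hw1 t htt, hw0, hmild t htt]
    congr 1
    refine intervalIntegral.integral_congr_ae ?_
    refine Eventually.of_forall fun r hr => ?_
    rw [uIoc_of_le htt.1.le] at hr
    rw [extZero_apply ⟨hr.1.le, hr.2.trans htt.2⟩]
    change _ = P.heat P.qsym (t - r) (trunc a ρ r (w r))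
    rw [hw1 r ⟨hr.1, hr.2.trans htt.2⟩]

lemma exists_singularAt_extZero (v : C(Icc t0 t1, P.Ell)) :
    ∃ C, SingularAt (extZero v) t0 t1 C := by
  refine ⟨‖v‖ * (t1 - t0) ^ (1 / 2 : ℝ), (continuousOn_extZero v).mono Ioc_subset_Icc_self,
    fun t ht => ?_⟩
  rw [extZero_apply ⟨ht.1.le, ht.2⟩, mul_assoc]
  refine (v.norm_coe_le_norm _).trans (le_mul_of_one_le_right (norm_nonneg _) ?_)
  rw [Real.rpow_neg (by linarith [ht.1]), ← div_eq_mul_inv, one_le_div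
    (Real.rpow_pos_of_pos (by linarith [ht.1]) _)]
  exact Real.rpow_le_rpow (by linarith [ht.1]) (by linarith [ht.2]) (by norm_num)

theorem IsTruncSol.unique (h : LipBound a ρ L) (hL : 0 ≤ L) (hρ : 0 < ρ) (ht : t0 < t1)
    {v w : C(Icc t0 t1, P.Ell)} (hv : IsTruncSol a ρ v) (hw : IsTruncSol a ρ w)
    (h0 : extZero v t0 = extZero w t0) : v = w := by
  obtain ⟨M, hΨ⟩ := h.exists_volterraKernel hL hρ
  obtain ⟨C, hC⟩ := exists_singularAt_extZero v
  obtain ⟨C', hC'⟩ := exists_singularAt_extZero w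
  have hw' := hw
  unfold IsTruncSol at hw'
  rw [← h0] at hw'
  have h1 := hΨ.unique ht hC hC' hv hw'
  ext1 t
  rcases t.2.1.eq_or_lt with h2 | h2
  · have : extZero v t = extZero w t := by rw [← h2, h0]
    rwa [extZero_apply t.2, extZero_apply t.2] at this
  · have := h1 ⟨h2, t.2.2⟩
    rwa [extZero_apply t.2, extZero_apply t.2] at this

lemma InDomain.hasDerivAt (ha : InDomain a) {t : ℝ} (ht : t ∈ Ioo t0 t1) :
    HasDerivAt (extZero a) (deriv (extZero a) t) t :=
  ((ha.c1.differentiableOn one_ne_zero).differentiableAt (isOpen_Ioo.mem_nhds ht)).hasDerivAt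

lemma tendsto_extZero (a : C(Icc t0 t1, P.Ell)) (ht : t0 < t1) :
    Tendsto (extZero a) (𝓝[>] t0) (𝓝 (extZero a t0)) := by
  have h := (continuousOn_extZero a t0 ⟨le_rfl, ht.le⟩).tendsto
  refine h.mono_left ?_
  rw [← nhdsWithin_Ioc_eq_nhdsGT ht]
  exact nhdsWithin_mono _ Ioc_subset_Icc_self

/-- An element of the domain is a mild solution of the equation with its defect added. -/
lemma InDomain.mild (ha : InDomain a) (ht01 : t0 < t1) {f : ℝ → P.Ell} {δ : ℝ}
    (hf : ∀ r ∈ Ioo t0 t1, ∀ k, f r k = deriv (extZero a) r k - P.Lop (extZero a r) k -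
      P.Q (P.nonlin (extZero a r)) k) (hfδ : ∀ r ∈ Ioo t0 t1, ‖f r‖ ≤ δ) :
    AEStronglyMeasurable f (volume.restrict (Ioo t0 t1)) ∧
    ∀ t ∈ Ioc t0 t1, extZero a t = P.heat (fun _ => 1) (t - t0) (extZero a t0) +
      (∫ r in t0..t, P.heat P.qsym (t - r) (P.nonlin (extZero a r))) +
      ∫ r in t0..t, P.heat (fun _ => 1) (t - r) (f r) := by
  have hac := (continuousOn_extZero a).mono Ioo_subset_Icc_self
  have hN : ContinuousOn (fun r => P.nonlin (extZero a r)) (Icc t0 t1) :=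
    continuous_nonlin.comp_continuousOn (continuousOn_extZero a)
  have hfm : AEStronglyMeasurable f (volume.restrict (Ioo t0 t1)) := by
    refine aestronglyMeasurable_of_coeff measurableSet_Ioo fun k => ?_
    refine ContinuousOn.congr (f := fun r => deriv (extZero a) r k - P.Lop (extZero a r) k -
      P.Q (P.nonlin (extZero a r)) k) ?_ fun r hr => hf r hr k
    refine (ContinuousOn.sub ?_ ?_).sub ?_
    · exact (P.coeffL k).continuous.comp_continuousOn
        (ha.c1.continuousOn_deriv_of_isOpen isOpen_Ioo le_rfl)
    · exact continuousOn_const.mul ((P.coeffL k).continuous.comp_continuousOn hac)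
    · exact continuousOn_const.mul ((P.coeffL k).continuous.comp_continuousOn
        (hN.mono Ioo_subset_Icc_self))
  refine ⟨hfm, fun t ht => ?_⟩
  have hfi := integrableOn_of_norm_le hfm hfδ
  obtain ⟨G, hG⟩ := isCompact_Icc.exists_bound_of_continuousOn hN
  have hNm := (hN.mono Ioo_subset_Icc_self).aestronglyMeasurable (μ := volume) measurableSet_Ioo
  have hNi := integrableOn_of_norm_le hNm fun r hr => hG r ⟨hr.1.le, hr.2.le⟩
  have hsub : Ioo t0 t ⊆ Ioo t0 t1 := Ioo_subset_Ioo_right ht.2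
  refine mild_of_coeff P.halfOrder_one ((continuousOn_extZero a).mono Ioc_subset_Icc_self) hNi hfi
    (fun r hr k => ?_) (fun k => ?_) ht
    (P.halfOrder_qsym.integrableOn_heat_sub_apply ht.1 (hNm.mono_set hsub)
      fun r hr => hG r ⟨hr.1.le, hr.2.le.trans ht.2⟩)
    (P.halfOrder_one.integrableOn_heat_sub_apply ht.1 (hfm.mono_set hsub)
      fun r hr => hfδ r (hsub hr))
  · have h1 := (P.coeffL k).hasFDerivAt.comp_hasDerivAt r (ha.hasDerivAt hr)
    refine h1.congr_deriv ?_
    rw [hf r hr k, coeffL_apply]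
    simp only [Lop, Q]
    ring
  · rw [one_mul]
    exact ((P.coeffL k).continuous.tendsto _).comp (tendsto_extZero a ht01)

/-- Zeros of the defect near `a` solve the truncated equation. -/
lemma InDomain.isTruncSol {v : C(Icc t0 t1, P.Ell)} (hv : InDomain v) (ht01 : t0 < t1)
    (hρ : 0 < ρ) (hva : ‖v - a‖ ≤ ρ) (h0 : ∀ r ∈ Ioo t0 t1, ∀ k, deriv (extZero v) r k -
      P.Lop (extZero v r) k - P.Q (P.nonlin (extZero v r)) k = 0) : IsTruncSol a ρ v := by
  obtain ⟨-, h1⟩ := hv.mild ht01 (f := fun _ => 0) (δ := 0)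
    (fun r hr k => by rw [h0 r hr k, Ell.zero_apply]) (by simp)
  intro t ht
  rw [h1 t ht]
  simp only [map_zero, intervalIntegral.integral_zero, add_zero]
  congr 1
  refine intervalIntegral.integral_congr fun r hr => ?_
  rw [uIcc_of_le ht.1.le] at hr
  have hr' : r ∈ Icc t0 t1 := ⟨hr.1, hr.2.trans ht.2⟩
  rw [trunc_of_norm_le hρ]
  rw [extZero_apply hr', extZero_apply hr']
  exact ((v - a).norm_coe_le_norm ⟨r, hr'⟩).trans hva

/-- The a priori bound for the truncated equation on one step. -/
theorem IsTruncSol.norm_sub_le (h : LipBound a ρ L) (hL : 0 ≤ L) (hρ : 0 < ρ) (ht01 : t0 < t1)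
    (ha : InDomain a) {δ : ℝ} (hδ : ∀ r ∈ Ioo t0 t1, ∃ y : P.Ell, (∀ k, y k =
      deriv (extZero a) r k - P.Lop (extZero a r) k - P.Q (P.nonlin (extZero a r)) k) ∧ ‖y‖ ≤ δ)
    {v : C(Icc t0 t1, P.Ell)} (hv : IsTruncSol a ρ v) {t γ W0 Wq W1 : ℝ} (ht : t ∈ Ioc t0 t1)
    (hγ1 : γ < 1) (hWq0 : 0 ≤ Wq) (hW10 : 0 ≤ W1)
    (hW0 : ∀ phi : P.Ell, ‖evol a t t0 phi‖ ≤ W0 * ‖phi‖)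
    (hWq : ∀ s ∈ Ioo t0 t, ∀ psi : P.Ell, (t - s) ^ γ * ‖evol a t s (P.Q psi)‖ ≤ Wq * ‖psi‖)
    (hW1 : ∀ s ∈ Ioo t0 t, ∀ phi : P.Ell, ‖evol a t s phi‖ ≤ W1 * ‖phi‖) :
    ‖extZero v t - extZero a t‖ ≤ W0 * ‖extZero v t0 - extZero a t0‖ +
      (t - t0) ^ (1 - γ) / (1 - γ) * Wq * (L * ρ) + (t - t0) * W1 * δ := by
  classical
  have h1 := P.halfOrder_one
  have hq := P.halfOrder_qsym
  have hone : ∀ x : P.Ell, (fun k => (1 : ℝ) * x k) = x.1 := fun x => funext fun k => one_mul _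
  -- The defect as a function with values in ℓ¹_ω; its measurability is recovered in
  -- `InDomain.mild`.
  choose! f hf hfδ using hδ
  obtain ⟨hfm, hmild⟩ := ha.mild ht01 hf hfδ
  obtain ⟨V, hV⟩ := exists_isResolvent (continuousOn_linCoeff a) ht
  obtain ⟨g, hg⟩ : ∃ g : ℝ → P.Ell, g = fun r =>
    remainder a r (radial ρ (extZero v r - extZero a r)) := ⟨_, rfl⟩
  -- The purpose of the truncation: the bound Lρ holds whether or not v stays in the ball.
  have hgG : ∀ r ∈ Icc t0 t1, ‖g r‖ ≤ L * ρ := fun r hr => by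
    rw [hg]
    exact h.norm_remainder_le hL hρ hr (norm_radial_le hρ _)
  have hwc : ContinuousOn (fun r => extZero v r - extZero a r) (Icc t0 t1) :=
    (continuousOn_extZero v).sub (continuousOn_extZero a)
  have hgc : ContinuousOn g (Icc t0 t1) := by
    rw [hg]
    exact (continuousOn_remainder a).comp (f := fun r =>
      (r, radial ρ (extZero v r - extZero a r))) (continuousOn_id.prodMk
        ((continuous_radial hρ).comp_continuousOn hwc)) fun r hr => ⟨hr, mem_univ _⟩
  have hsub : Ioo t0 t ⊆ Ioo t0 t1 := Ioo_subset_Ioo_right ht.2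
  have hsubI : Ioo t0 t ⊆ Icc t0 t1 := hsub.trans Ioo_subset_Icc_self
  have hN : ContinuousOn (fun r => P.nonlin (extZero a r)) (Icc t0 t1) :=
    continuous_nonlin.comp_continuousOn (continuousOn_extZero a)
  have hAw : ContinuousOn (fun r => linCoeff a r (extZero v r - extZero a r)) (Icc t0 t1) :=
    (continuousOn_linCoeff a).clm_apply hwc
  have hint : ∀ H : ℝ → P.Ell, ContinuousOn H (Icc t0 t1) → ∀ r ∈ Ioc t0 t1,
      IntervalIntegrable (fun y => P.heat P.qsym (r - y) (H y)) volume t0 r := fun H hH r hr => by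
    rw [intervalIntegrable_iff_integrableOn_Ioo_of_le hr.1.le]
    obtain ⟨G, hG⟩ := isCompact_Icc.exists_bound_of_continuousOn hH
    have hs : Ioo t0 r ⊆ Icc t0 t1 := fun y hy => ⟨hy.1.le, hy.2.le.trans hr.2⟩
    exact hq.integrableOn_heat_sub_apply hr.1
      ((hH.mono hs).aestronglyMeasurable measurableSet_Ioo) fun y hy => hG y (hs hy)
  -- Subtracting the mild equation of a, with its defect, from that of v: the difference solves the
  -- linearized equation with sources g under 𝒬 and -f.
  have hw : ∀ r ∈ Ioc t0 t, extZero v r - extZero a r =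
      P.heat (fun _ => 1) (r - t0) (extZero v t0 - extZero a t0) +
      (∫ y in t0..r, P.heat P.qsym (r - y) (linCoeff a y (extZero v y - extZero a y) + g y)) +
      ∫ y in t0..r, P.heat (fun _ => 1) (r - y) (-f y) := fun r hr => by
    have hr1 : r ∈ Ioc t0 t1 := ⟨hr.1, hr.2.trans ht.2⟩
    have e1 : ∫ y in t0..r, P.heat P.qsym (r - y) (trunc a ρ y (extZero v y)) =
        (∫ y in t0..r, P.heat P.qsym (r - y) (P.nonlin (extZero a y))) +
        ∫ y in t0..r, P.heat P.qsym (r - y)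
          (linCoeff a y (extZero v y - extZero a y) + g y) := by
      have hAg : ContinuousOn (fun y => linCoeff a y (extZero v y - extZero a y) + g y)
          (Icc t0 t1) := hAw.add hgc
      rw [← intervalIntegral.integral_add (hint _ hN r hr1) (hint _ hAg r hr1)]
      refine intervalIntegral.integral_congr fun y _ => ?_
      rw [← map_add, trunc, hg, add_assoc]
    rw [hv r hr1, hmild r hr1, e1, map_sub]
    simp only [map_neg, intervalIntegral.integral_neg]
    abel
  have hduh := hV.duhamel ((continuousOn_linCoeff a).mono (Icc_subset_Icc_right ht.2))
    ⟨le_rfl, ht.1⟩ h1 (v := fun r => extZero v r - extZero a r) (g := g) (f := fun r => -f r)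
    (G := L * ρ) (δ := δ) ((hwc.integrableOn_compact isCompact_Icc).mono_set hsubI)
    ((hgc.mono hsubI).aestronglyMeasurable measurableSet_Ioo) (fun r hr => hgG r (hsubI hr))
    (hfm.neg.mono_set hsub) (fun r hr => by rw [norm_neg]; exact hfδ r (hsub hr)) hw
  have hev1 : ∀ s, t0 ≤ s → s < t → ∀ x : P.Ell,
      P.resolventOp (linCoeff a) V t (fun _ => 1) s x = evol a t s x := fun s hs hst x => by
    rw [← evol_eq_resolventOp a hs hst ht.2 hV h1, hone]
  have hδ0 : 0 ≤ δ := by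
    obtain ⟨m, hm⟩ := exists_between ht01
    exact (norm_nonneg _).trans (hfδ m hm)
  have hh : 0 < t - t0 := sub_pos.2 ht.1
  have b1 : ‖P.resolventOp (linCoeff a) V t (fun _ => 1) t0 (extZero v t0 - extZero a t0)‖ ≤
      W0 * ‖extZero v t0 - extZero a t0‖ := by
    rw [hev1 t0 le_rfl ht.1]
    exact hW0 _
  have hne : ∀ᵐ r : ℝ, r ≠ t := compl_mem_ae_iff.2 (measure_singleton t)
  have b2 : ‖∫ r in t0..t, P.resolventOp (linCoeff a) V t P.qsym r (g r)‖ ≤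
      (t - t0) ^ (1 - γ) / (1 - γ) * Wq * (L * ρ) := by
    -- Beta exponents γ and 0: the integral of (t - r)^(-γ) is the factor (t - t0)^(1 - γ) / (1 -
    -- γ), which becomes τ̂.
    have hb := (intervalIntegrable_beta (α := γ) (β := 0) hγ1 (by norm_num)
      ht.1).const_mul (Wq * (L * ρ))
    have h2 := intervalIntegral.norm_integral_le_of_norm_le (g := fun r =>
      Wq * (L * ρ) * ((t - r) ^ (-γ) * (r - t0) ^ (-0 : ℝ)))
      (f := fun r => P.resolventOp (linCoeff a) V t P.qsym r (g r)) ht.1.le ?_ hb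
    · refine h2.trans (le_of_eq ?_)
      rw [intervalIntegral.integral_const_mul, integral_beta ht.1, betaConst]
      have e2 : ∫ x in (0 : ℝ)..1, (1 - x) ^ (-γ) * x ^ (-0 : ℝ) = 1 / (1 - γ) := by
        simp only [neg_zero, Real.rpow_zero, mul_one]
        rw [intervalIntegral.integral_comp_sub_left (fun x : ℝ => x ^ (-γ)), sub_self, sub_zero,
          integral_rpow (Or.inl (by linarith)), Real.one_rpow,
          Real.zero_rpow (by linarith), sub_zero, neg_add_eq_sub]
      rw [e2, sub_zero]
      ring
    · filter_upwards [hne] with r hr hr'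
      have hrt : r ∈ Ioo t0 t := ⟨hr'.1, lt_of_le_of_ne hr'.2 hr⟩
      have h3 : P.resolventOp (linCoeff a) V t P.qsym r (g r) = evol a t r (P.Q (g r)) := by
        rw [← evol_eq_resolventOp a hrt.1.le hrt.2 ht.2 hV hq]
        rfl
      have h4 := hWq r hrt (g r)
      have h5 : 0 < (t - r) ^ γ := Real.rpow_pos_of_pos (sub_pos.2 hrt.2) _
      rw [h3, neg_zero, Real.rpow_zero, mul_one, Real.rpow_neg (sub_pos.2 hrt.2).le,
        ← div_eq_mul_inv, le_div_iff₀ h5, mul_comm]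
      exact h4.trans (mul_le_mul_of_nonneg_left (hgG r (hsubI hrt)) hWq0)
  have b3 : ‖∫ r in t0..t, P.resolventOp (linCoeff a) V t (fun _ => 1) r (-f r)‖ ≤
      (t - t0) * W1 * δ := by
    have h2 := intervalIntegral.norm_integral_le_of_norm_le (g := fun _ => W1 * δ)
      (f := fun r => P.resolventOp (linCoeff a) V t (fun _ => 1) r (-f r)) ht.1.le ?_
      (intervalIntegrable_const (μ := volume))
    · refine h2.trans (le_of_eq ?_)
      rw [intervalIntegral.integral_const, smul_eq_mul, mul_assoc]
    · filter_upwards [hne] with r hr hr'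
      have hrt : r ∈ Ioo t0 t := ⟨hr'.1, lt_of_le_of_ne hr'.2 hr⟩
      rw [hev1 r hrt.1.le hrt.2]
      refine (hW1 r hrt _).trans (mul_le_mul_of_nonneg_left ?_ hW10)
      rw [norm_neg]
      exact hfδ r (hsub hrt)
  rw [hduh]
  exact (norm_add₃_le).trans (add_le_add (add_le_add b1 b2) b3)

end PDEData
end

noncomputable section
namespace PDEData

open MeasureTheory

variable {d : ℕ} {P : PDEData d}

/-! ### Smoothing -/

lemma mem_ellSubmodule_of_wsum_ne_top {a : (Fin d → ℕ) → ℝ} (h : P.wsum 0 a ≠ ⊤) :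
    a ∈ P.ellSubmodule := by
  have := summable_of_wsum_ne_top h
  simp only [pow_zero, mul_one] at this
  exact this

lemma wsum_mul_le {m a : (Fin d → ℕ) → ℝ} {K : ℝ} {j : ℕ} (n : ℕ) (hK : 0 ≤ K)
    (hm : ∀ k, |m k| ≤ K * jap k ^ j) :
    P.wsum n (fun k => m k * a k) ≤ ENNReal.ofReal K * P.wsum (n + j) a := by
  unfold wsum
  rw [← ENNReal.tsum_mul_left]
  refine ENNReal.tsum_le_tsum fun k => ?_
  rw [← ENNReal.ofReal_mul hK, abs_mul]
  refine ENNReal.ofReal_le_ofReal ?_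
  have h1 : 0 ≤ |a k| * P.omega k * jap k ^ n :=
    mul_nonneg (P.term_nonneg a k) (pow_pos (jap_pos k) n).le
  calc _ = |m k| * (|a k| * P.omega k * jap k ^ n) := by ring
    _ ≤ (K * jap k ^ j) * (|a k| * P.omega k * jap k ^ n) := mul_le_mul_of_nonneg_right (hm k) h1
    _ = _ := by ring

lemma exists_kLsq_le (P : PDEData d) : ∃ K, 0 ≤ K ∧ ∀ k, P.kLsq k ≤ K * jap k ^ 2 := by
  refine ⟨∑ j, P.L j ^ 2, Finset.sum_nonneg fun j _ => sq_nonneg _, fun k => ?_⟩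
  unfold kLsq
  rw [Finset.sum_mul]
  refine Finset.sum_le_sum fun j _ => ?_
  have h1 : (k j : ℝ) ≤ jap k := by
    have := Finset.single_le_sum (f := fun j => (k j : ℝ)) (fun i _ => Nat.cast_nonneg _)
      (Finset.mem_univ j)
    unfold jap
    linarith
  rw [mul_pow, mul_comm]
  exact mul_le_mul_of_nonneg_left (pow_le_pow_left₀ (Nat.cast_nonneg _) h1 2) (sq_nonneg _)

lemma exists_abs_mu_le (P : PDEData d) : ∃ K, 0 ≤ K ∧ ∀ k, |P.mu k| ≤ K * jap k ^ 4 := by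
  obtain ⟨K, hK0, hK⟩ := P.exists_kLsq_le
  refine ⟨|P.lam0| + |P.lam1| * K + |P.lam2| * K ^ 2, by positivity, fun k => ?_⟩
  have hj := one_le_jap k
  have hx := P.kLsq_nonneg k
  have h2 : jap k ^ 2 ≤ jap k ^ 4 := pow_le_pow_right₀ hj (by norm_num)
  have h0 : 1 ≤ jap k ^ 4 := one_le_pow₀ hj
  have h3 : P.kLsq k ≤ K * jap k ^ 4 := (hK k).trans (mul_le_mul_of_nonneg_left h2 hK0)
  have h4 : P.kLsq k ^ 2 ≤ K ^ 2 * jap k ^ 4 := by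
    calc P.kLsq k ^ 2 ≤ (K * jap k ^ 2) ^ 2 := pow_le_pow_left₀ hx (hK k) 2
      _ = _ := by ring
  unfold mu
  calc |P.lam0 - P.lam1 * P.kLsq k + P.lam2 * P.kLsq k ^ 2|
      ≤ |P.lam0| + |P.lam1| * P.kLsq k + |P.lam2| * P.kLsq k ^ 2 := by
        refine (abs_add_le _ _).trans (add_le_add ((abs_sub _ _).trans (le_of_eq ?_)) (le_of_eq ?_))
        · rw [abs_mul, abs_of_nonneg hx]
        · rw [abs_mul, abs_of_nonneg (sq_nonneg (P.kLsq k))]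
    _ ≤ |P.lam0| * jap k ^ 4 + |P.lam1| * (K * jap k ^ 4) + |P.lam2| * (K ^ 2 * jap k ^ 4) := by
        refine add_le_add (add_le_add ?_ ?_) ?_
        · exact le_mul_of_one_le_right (abs_nonneg _) h0
        · exact mul_le_mul_of_nonneg_left h3 (abs_nonneg _)
        · exact mul_le_mul_of_nonneg_left h4 (abs_nonneg _)
    _ = _ := by ring

lemma exists_abs_qsym_le (P : PDEData d) : ∃ K, 0 ≤ K ∧ ∀ k, |P.qsym k| ≤ K * jap k ^ 2 := by
  obtain ⟨K, hK0, hK⟩ := P.exists_kLsq_le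
  refine ⟨1 + K, by positivity, fun k => ?_⟩
  have hx := P.kLsq_nonneg k
  have hj : 1 ≤ jap k ^ 2 := one_le_pow₀ (one_le_jap k)
  have hKj := mul_nonneg hK0 (sq_nonneg (jap k))
  unfold qsym
  rw [abs_mul, abs_pow, abs_neg, abs_one, one_pow, one_mul, abs_pow, abs_of_nonneg hx]
  obtain hp | hp : P.p = 0 ∨ P.p = 1 := by have := P.p_le; omega
  · rw [hp, pow_zero]
    nlinarith
  · rw [hp, pow_one]
    nlinarith [hK k]

/-- Coefficientwise continuity and a uniform bound in a stronger norm imply continuity. -/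
lemma continuousOn_of_wsum_le {w : ℝ → P.Ell} {S : Set ℝ} {C : ENNReal} (hC : C ≠ ⊤)
    (hw : ∀ k, ContinuousOn (fun t => w t k) S) (hwC : ∀ t ∈ S, P.wsum 1 (w t) ≤ C) :
    ContinuousOn w S := by
  obtain ⟨A, hA⟩ : ∃ A : ℕ → ℝ → P.Ell, A = fun n t =>
    ∑ k ∈ Fintype.piFinset fun _ : Fin d => Finset.range n, w t k • Ell.single P k := ⟨_, rfl⟩
  have hAc : ∀ n, ContinuousOn (A n) S := fun n => by
    rw [hA]
    exact continuousOn_finsetSum _ fun k _ => (hw k).smul continuousOn_const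
  have hAk : ∀ n t k, A n t k = if k ∈ Fintype.piFinset fun _ : Fin d => Finset.range n
      then w t k else 0 := fun n t k => by
    have h1 : ∀ j, (w t j • Ell.single P j) k = if k = j then w t j else 0 := fun j => by
      rw [Ell.smul_apply, show Ell.single P j k = (Pi.single j 1 : (Fin d → ℕ) → ℝ) k from rfl,
        Pi.single_apply, mul_ite, mul_one, mul_zero]
    rw [hA, ← coeffL_apply, map_sum]
    simp only [coeffL_apply, h1, Finset.sum_ite_eq]
  -- Outside the box some entry of k is at least n, so the weight 1 + |k| exceeds n; the tail is at
  -- most C/n, uniformly in t.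
  have hdist : ∀ n : ℕ, 0 < n → ∀ t ∈ S, dist (w t) (A n t) ≤ C.toReal / n := fun n hn t ht => by
    have hn' : (0 : ℝ) < n := Nat.cast_pos.2 hn
    have hne : P.wsum 1 (w t) ≠ ⊤ := ne_top_of_le_ne_top hC (hwC t ht)
    have hs := summable_of_wsum_ne_top hne
    have h1 : ∑' k, |w t k| * P.omega k * jap k ^ 1 ≤ C.toReal := by
      have e1 : ∑' k, |w t k| * P.omega k * jap k ^ 1 = (P.wsum 1 (w t)).toReal := by
        have hnn : ∀ k, 0 ≤ |w t k| * P.omega k * jap k ^ 1 := fun k =>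
          mul_nonneg (P.term_nonneg _ k) (pow_pos (jap_pos k) 1).le
        unfold wsum
        rw [← ENNReal.ofReal_tsum_of_nonneg hnn hs, ENNReal.toReal_ofReal (tsum_nonneg hnn)]
      rw [e1]
      exact ENNReal.toReal_mono hC (hwC t ht)
    rw [dist_eq_norm, le_div_iff₀ hn', Ell.norm_def, ← tsum_mul_right]
    refine le_trans (Summable.tsum_le_tsum (fun k => ?_)
      ((w t - A n t).summable.mul_right _) hs) h1
    rw [Ell.sub_apply, hAk]
    split_ifs with hk
    · rw [sub_self, abs_zero, zero_mul, zero_mul]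
      exact mul_nonneg (P.term_nonneg _ k) (pow_pos (jap_pos k) 1).le
    · rw [sub_zero, pow_one]
      refine mul_le_mul_of_nonneg_left ?_ (P.term_nonneg _ k)
      simp only [Fintype.mem_piFinset, Finset.mem_range, not_forall, not_lt] at hk
      obtain ⟨j, hj⟩ := hk
      have h2 : (n : ℝ) ≤ k j := Nat.cast_le.2 hj
      have h3 := Finset.single_le_sum (f := fun j => (k j : ℝ)) (fun i _ => Nat.cast_nonneg _)
        (Finset.mem_univ j)
      unfold jap
      linarith
  have hunif : TendstoUniformlyOn A w atTop S := by
    rw [Metric.tendstoUniformlyOn_iff]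
    intro ε hε
    have hlim := tendsto_const_div_atTop_nhds_zero_nat C.toReal
    filter_upwards [hlim.eventually_lt_const hε, eventually_gt_atTop 0] with n hn hn0 t ht
    exact (hdist n hn0 t ht).trans_lt hn
  exact hunif.continuousOn (Frequently.of_forall hAc)

variable {t0 t1 : ℝ}

/-- The coefficients of `v` satisfy the equations of the evolution problem. -/
structure IsCoeffSol (P : PDEData d) (v : ℝ → P.Ell) (t0 t1 : ℝ) : Prop where
  cont : ContinuousOn v (Icc t0 t1)
  ode : ∀ t ∈ Ioo t0 t1, ∀ k, HasDerivAt (fun r => v r k)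
    (P.mu k * v t k + P.qsym k * P.nonlin (v t) k) t

namespace IsCoeffSol

variable {v : ℝ → P.Ell}

lemma exists_wsum_nonlin_le {n : ℕ} {S : Set ℝ} {C : ENNReal} (hC : C ≠ ⊤)
    (h : ∀ t ∈ S, P.wsum n (v t) ≤ C) : ∃ C' ≠ ⊤, ∀ t ∈ S, P.wsum n (P.nonlin (v t)) ≤ C' := by
  refine ⟨∑ j ∈ P.N.support, ENNReal.ofReal |P.N.coeff j| * C ^ j, ?_, fun t ht => ?_⟩
  · exact ENNReal.sum_ne_top.2 fun j _ => ENNReal.mul_ne_top ENNReal.ofReal_ne_top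
      (ENNReal.pow_ne_top hC)
  · refine (wsum_nonlin_le n (v t)).trans (Finset.sum_le_sum fun j _ => ?_)
    gcongr
    exact h t ht

lemma continuousOn_nonlin (hv : P.IsCoeffSol v t0 t1) :
    ContinuousOn (fun t => P.nonlin (v t)) (Icc t0 t1) :=
  continuous_nonlin.comp_continuousOn hv.cont

/-- Away from the initial time, a solution is bounded in all weighted norms. -/
theorem exists_wsum_le (hv : P.IsCoeffSol v t0 t1) (n : ℕ) {s : ℝ} (hs : s ∈ Ioc t0 t1) :
    ∃ C ≠ ⊤, ∀ t ∈ Icc s t1, P.wsum n (v t) ≤ C := by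
  induction n generalizing s with
  | zero =>
    obtain ⟨G, hG⟩ := isCompact_Icc.exists_bound_of_continuousOn hv.cont
    refine ⟨ENNReal.ofReal G, ENNReal.ofReal_ne_top, fun t ht => ?_⟩
    rw [wsum_zero_eq]
    exact ENNReal.ofReal_le_ofReal (hG t ⟨hs.1.le.trans ht.1, ht.2⟩)
  | succ n ih =>
    -- Restart at an intermediate time s', after which the norm of order n is already bounded
    -- uniformly, also for 𝒩(v) by the algebra property.
    obtain ⟨s', hs'⟩ := exists_between hs.1
    obtain ⟨C, hC, hvC⟩ := ih ⟨hs'.1, hs'.2.le.trans hs.2⟩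
    obtain ⟨C', hC', hNC⟩ := exists_wsum_nonlin_le hC hvC
    obtain ⟨M, hM0, hM⟩ := P.halfOrder_one.exists_abs_le (t1 - s')
    obtain ⟨M', hM0', hM'⟩ := P.halfOrder_qsym.exists_abs_le (t1 - s')
    have hsub : Icc s' t1 ⊆ Icc t0 t1 := Icc_subset_Icc_left hs'.1.le
    have hNk : ∀ k, ContinuousOn (fun r => P.nonlin (v r) k) (Icc s' t1) := fun k =>
      (P.coeffL k).continuous.comp_continuousOn (hv.continuousOn_nonlin.mono hsub)
    refine ⟨ENNReal.ofReal (M * (s - s') ^ (-(3 / 4) : ℝ)) * C +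
      ENNReal.ofReal (M' * ((t1 - s') ^ (1 / 4 : ℝ) * betaConst (3 / 4) 0)) * C',
      ENNReal.add_ne_top.2 ⟨ENNReal.mul_ne_top ENNReal.ofReal_ne_top hC,
        ENNReal.mul_ne_top ENNReal.ofReal_ne_top hC'⟩, fun t ht => ?_⟩
    have hts : s' < t := hs'.2.trans_le ht.1
    -- Duhamel's formula for one coefficient. The additional factor 1 + |k| is absorbed by the
    -- semigroup at the price of the power -3/4 of the elapsed time. Summation over k then commutes
    -- with the integral by Tonelli.
    have hkey : ∀ k, ENNReal.ofReal (|v t k| * P.omega k * jap k ^ (n + 1)) ≤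
        ENNReal.ofReal (M * (s - s') ^ (-(3 / 4) : ℝ)) *
          ENNReal.ofReal (|v s' k| * P.omega k * jap k ^ n) +
        ∫⁻ r in Ioo s' t, ENNReal.ofReal (M' * (t - r) ^ (-(3 / 4) : ℝ)) *
          ENNReal.ofReal (|P.nonlin (v r) k| * P.omega k * jap k ^ n) := fun k => by
      have hw : 0 ≤ P.omega k * jap k ^ n :=
        mul_nonneg (P.omega_pos k).le (pow_pos (jap_pos k) n).le
      have hj := jap_pos k
      have hqN : ContinuousOn (fun r => P.qsym k * P.nonlin (v r) k) (Icc s' t1) :=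
        continuousOn_const.mul (hNk k)
      have hd := scalar_duhamel (μ := P.mu k) (y0 := v s' k) (y := fun r => v r k)
        (h := fun r => P.qsym k * P.nonlin (v r) k) (s := s') (t1 := t1)
        ((P.coeffL k).continuous.comp_continuousOn
          (hv.cont.mono (Ioc_subset_Icc_self.trans hsub)))
        (fun r hr => hv.ode r ⟨hs'.1.trans hr.1, hr.2⟩ k)
        (((P.coeffL k).continuous.tendsto _).comp (Tendsto.mono_left
          (hv.cont.continuousAt (Icc_mem_nhds hs'.1 (hts.trans_le ht.2))).tendsto
          nhdsWithin_le_nhds))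
        ((hqN.integrableOn_compact isCompact_Icc).mono_set Ioo_subset_Icc_self) ⟨hts, ht.2⟩
      have h1 : jap k * |Real.exp ((t - s') * P.mu k) * v s' k| ≤
          M * (s - s') ^ (-(3 / 4) : ℝ) * |v s' k| := by
        have h2 := (hM (t - s') (by linarith) (by linarith [ht.2]) k).2
        rw [mul_one] at h2
        rw [abs_mul, ← mul_assoc]
        refine mul_le_mul_of_nonneg_right (h2.trans (mul_le_mul_of_nonneg_left ?_ hM0))
          (abs_nonneg _)
        exact Real.rpow_le_rpow_of_nonpos (by linarith [hs'.2]) (by linarith [ht.1])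
          (by norm_num)
      have h3 : ENNReal.ofReal (jap k *
          |∫ r in s'..t, Real.exp ((t - r) * P.mu k) * (P.qsym k * P.nonlin (v r) k)|) ≤
          ∫⁻ r in Ioo s' t, ENNReal.ofReal (M' * (t - r) ^ (-(3 / 4) : ℝ)) *
            ENNReal.ofReal |P.nonlin (v r) k| := by
        rw [intervalIntegral.integral_of_le hts.le, integral_Ioc_eq_integral_Ioo,
          ENNReal.ofReal_mul hj.le, ← Real.enorm_eq_ofReal_abs]
        refine (mul_le_mul_right (enorm_integral_le_lintegral_enorm _) _).trans ?_
        rw [← lintegral_const_mul' _ _ ENNReal.ofReal_ne_top]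
        refine setLIntegral_mono' measurableSet_Ioo fun r hr => ?_
        have h4 := (hM' (t - r) (by linarith [hr.2]) (by linarith [hr.1, ht.2]) k).2
        rw [Real.enorm_eq_ofReal_abs, ← ENNReal.ofReal_mul hj.le,
          ← ENNReal.ofReal_mul (mul_nonneg hM0' (Real.rpow_nonneg (by linarith [hr.2]) _)),
          ← mul_assoc, abs_mul, ← mul_assoc]
        exact ENNReal.ofReal_le_ofReal (mul_le_mul_of_nonneg_right h4 (abs_nonneg _))
      calc ENNReal.ofReal (|v t k| * P.omega k * jap k ^ (n + 1))
          = ENNReal.ofReal (jap k * |v t k|) * ENNReal.ofReal (P.omega k * jap k ^ n) := by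
            rw [← ENNReal.ofReal_mul (mul_nonneg hj.le (abs_nonneg _))]
            congr 1
            ring
        _ ≤ (ENNReal.ofReal (M * (s - s') ^ (-(3 / 4) : ℝ) * |v s' k|) +
            ∫⁻ r in Ioo s' t, ENNReal.ofReal (M' * (t - r) ^ (-(3 / 4) : ℝ)) *
              ENNReal.ofReal |P.nonlin (v r) k|) * ENNReal.ofReal (P.omega k * jap k ^ n) := by
            refine mul_le_mul_left ?_ _
            refine le_trans ?_ (add_le_add (ENNReal.ofReal_le_ofReal h1) h3)
            rw [← ENNReal.ofReal_add (mul_nonneg hj.le (abs_nonneg _))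
              (mul_nonneg hj.le (abs_nonneg _)), ← mul_add]
            refine ENNReal.ofReal_le_ofReal (mul_le_mul_of_nonneg_left ?_ hj.le)
            have h5 := abs_add_le (Real.exp ((t - s') * P.mu k) * v s' k)
              (∫ r in s'..t, Real.exp ((t - r) * P.mu k) * (P.qsym k * P.nonlin (v r) k))
            rwa [← hd] at h5
        _ = _ := by
            rw [add_mul, ← lintegral_mul_const' _ _ ENNReal.ofReal_ne_top]
            congr 1
            · rw [← ENNReal.ofReal_mul (mul_nonneg (mul_nonneg hM0
                (Real.rpow_nonneg (by linarith [hs'.2]) _)) (abs_nonneg _)),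
                ← ENNReal.ofReal_mul (mul_nonneg hM0 (Real.rpow_nonneg (by linarith [hs'.2]) _))]
              congr 1
              ring
            · refine lintegral_congr fun r => ?_
              rw [mul_assoc, ← ENNReal.ofReal_mul (abs_nonneg _), mul_assoc (|_|)]
    have hmeas : ∀ k, AEMeasurable (fun r => ENNReal.ofReal (M' * (t - r) ^ (-(3 / 4) : ℝ)) *
        ENNReal.ofReal (|P.nonlin (v r) k| * P.omega k * jap k ^ n))
        (volume.restrict (Ioo s' t)) := fun k => by
      have h1 : AEMeasurable (fun r => P.nonlin (v r) k) (volume.restrict (Ioo s' t)) :=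
        ((hNk k).mono fun r hr => ⟨hr.1.le, hr.2.le.trans ht.2⟩).aemeasurable measurableSet_Ioo
      have h2 : Measurable fun r : ℝ => M' * (t - r) ^ (-(3 / 4) : ℝ) := by fun_prop
      have h3 : AEMeasurable (fun r => |P.nonlin (v r) k|) (volume.restrict (Ioo s' t)) :=
        h1.norm
      exact h2.ennreal_ofReal.aemeasurable.mul
        ((h3.mul_const (P.omega k)).mul_const (jap k ^ n)).ennreal_ofReal
    have hlint : ∫⁻ r in Ioo s' t, ENNReal.ofReal (M' * (t - r) ^ (-(3 / 4) : ℝ)) ≤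
        ENNReal.ofReal (M' * ((t1 - s') ^ (1 / 4 : ℝ) * betaConst (3 / 4) 0)) := by
      have hb := (intervalIntegrable_beta (α := 3 / 4) (β := 0) (by norm_num) (by norm_num)
        hts).const_mul M'
      simp only [neg_zero, Real.rpow_zero, mul_one] at hb
      have hI := integral_beta (α := 3 / 4) (β := 0) hts
      simp only [neg_zero, Real.rpow_zero, mul_one] at hI
      rw [← ofReal_integral_eq_lintegral_ofReal
        ((intervalIntegrable_iff_integrableOn_Ioo_of_le hts.le).1 hb) (by
          filter_upwards [ae_restrict_mem measurableSet_Ioo] with r hr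
          exact mul_nonneg hM0' (Real.rpow_nonneg (by linarith [hr.2]) _)),
        ← integral_Ioc_eq_integral_Ioo, ← intervalIntegral.integral_of_le hts.le,
        intervalIntegral.integral_const_mul, hI]
      refine ENNReal.ofReal_le_ofReal (mul_le_mul_of_nonneg_left
        (mul_le_mul_of_nonneg_right ?_ (betaConst_nonneg _ _)) hM0')
      rw [show (1 - 3 / 4 - 0 : ℝ) = 1 / 4 by norm_num]
      exact Real.rpow_le_rpow (by linarith) (by linarith [ht.2]) (by norm_num)
    calc P.wsum (n + 1) (v t) ≤ ∑' k, (ENNReal.ofReal (M * (s - s') ^ (-(3 / 4) : ℝ)) *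
          ENNReal.ofReal (|v s' k| * P.omega k * jap k ^ n) +
        ∫⁻ r in Ioo s' t, ENNReal.ofReal (M' * (t - r) ^ (-(3 / 4) : ℝ)) *
          ENNReal.ofReal (|P.nonlin (v r) k| * P.omega k * jap k ^ n)) :=
          ENNReal.tsum_le_tsum hkey
      _ = ENNReal.ofReal (M * (s - s') ^ (-(3 / 4) : ℝ)) * P.wsum n (v s') +
          ∫⁻ r in Ioo s' t, ENNReal.ofReal (M' * (t - r) ^ (-(3 / 4) : ℝ)) *
            P.wsum n (P.nonlin (v r)) := by
          rw [ENNReal.tsum_add, ENNReal.tsum_mul_left, ← lintegral_tsum hmeas]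
          simp only [ENNReal.tsum_mul_left]
          rfl
      _ ≤ ENNReal.ofReal (M * (s - s') ^ (-(3 / 4) : ℝ)) * C +
          ∫⁻ r in Ioo s' t, ENNReal.ofReal (M' * (t - r) ^ (-(3 / 4) : ℝ)) * C' := by
          refine add_le_add (mul_le_mul_right (hvC s' ⟨le_rfl, hts.le.trans ht.2⟩) _)
            (setLIntegral_mono' measurableSet_Ioo fun r hr => ?_)
          exact mul_le_mul_right (hNC r ⟨hr.1.le, hr.2.le.trans ht.2⟩) _
      _ ≤ _ := by
          rw [lintegral_mul_const' _ _ hC']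
          exact add_le_add le_rfl (mul_le_mul_left hlint _)

lemma wsum_ne_top (hv : P.IsCoeffSol v t0 t1) (n : ℕ) {t : ℝ} (ht : t ∈ Ioc t0 t1) :
    P.wsum n (v t) ≠ ⊤ := by
  obtain ⟨C, hC, h⟩ := hv.exists_wsum_le n ht
  exact ne_top_of_le_ne_top hC (h t ⟨le_rfl, ht.2⟩)

lemma wsum_nonlin_ne_top (hv : P.IsCoeffSol v t0 t1) (n : ℕ) {t : ℝ} (ht : t ∈ Ioc t0 t1) :
    P.wsum n (P.nonlin (v t)) ≠ ⊤ := by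
  obtain ⟨C, hC, h⟩ := hv.exists_wsum_le n ht
  obtain ⟨C', hC', h'⟩ := exists_wsum_nonlin_le hC h
  exact ne_top_of_le_ne_top hC' (h' t ⟨le_rfl, ht.2⟩)

/-- Multiplication operators of polynomial growth, applied to functions bounded in all weighted
norms. -/
lemma exists_continuousOn_mul {u : ℝ → P.Ell} (hu : ContinuousOn u (Icc t0 t1))
    (hb : ∀ n, ∀ s ∈ Ioc t0 t1, ∃ C ≠ ⊤, ∀ t ∈ Icc s t1, P.wsum n (u t) ≤ C)
    {m : (Fin d → ℕ) → ℝ} {K : ℝ} {j : ℕ} (hK : 0 ≤ K) (hm : ∀ k, |m k| ≤ K * jap k ^ j) :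
    ∃ w : ℝ → P.Ell, ContinuousOn w (Ioc t0 t1) ∧ ∀ t ∈ Ioc t0 t1, ∀ k, w t k = m k * u t k := by
  classical
  have hmem : ∀ t, ∃ y : P.Ell, t ∈ Ioc t0 t1 → ∀ k, y k = m k * u t k := fun t => by
    by_cases ht : t ∈ Ioc t0 t1
    · obtain ⟨C, hC, h⟩ := hb (0 + j) t ht
      refine ⟨⟨fun k => m k * u t k, mem_ellSubmodule_of_wsum_ne_top
        (ne_top_of_le_ne_top ?_ (wsum_mul_le 0 hK hm))⟩, fun _ k => rfl⟩
      exact ENNReal.mul_ne_top ENNReal.ofReal_ne_top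
        (ne_top_of_le_ne_top hC (h t ⟨le_rfl, ht.2⟩))
    · exact ⟨0, fun h => absurd h ht⟩
  choose w hw using hmem
  refine ⟨w, fun t ht => ?_, hw⟩
  obtain ⟨s, hs⟩ := exists_between ht.1
  have hst : Icc s t1 ⊆ Ioc t0 t1 := fun r hr => ⟨hs.1.trans_le hr.1, hr.2⟩
  obtain ⟨C, hC, h⟩ := hb (1 + j) s ⟨hs.1, hs.2.le.trans ht.2⟩
  have h1 : ContinuousOn w (Icc s t1) := by
    refine continuousOn_of_wsum_le (C := ENNReal.ofReal K * C)
      (ENNReal.mul_ne_top ENNReal.ofReal_ne_top hC) (fun k => ?_) fun r hr => ?_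
    · have h2 : ContinuousOn (fun r => m k * u r k) (Icc s t1) :=
        continuousOn_const.mul ((P.coeffL k).continuous.comp_continuousOn
          (hu.mono (hst.trans Ioc_subset_Icc_self)))
      exact h2.congr fun r hr => hw r (hst hr) k
    · rw [show (w r : (Fin d → ℕ) → ℝ) = fun k => m k * u r k from funext (hw r (hst hr))]
      exact (wsum_mul_le 1 hK hm).trans (mul_le_mul_right (h r hr) _)
  refine (h1 t ⟨hs.2.le, ht.2⟩).mono_of_mem_nhdsWithin ?_
  exact mem_nhdsWithin.2 ⟨Ioi s, isOpen_Ioi, hs.2, fun r hr => ⟨le_of_lt hr.1, hr.2.2⟩⟩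

/-- Solutions are continuously differentiable, with values in the domain of `ℒ`, after the initial
time. -/
theorem exists_deriv (hv : P.IsCoeffSol v t0 t1) :
    ∃ w z : ℝ → P.Ell, ContinuousOn w (Ioc t0 t1) ∧ ContinuousOn z (Ioc t0 t1) ∧
      (∀ t ∈ Ioc t0 t1, ∀ k, w t k = P.mu k * v t k) ∧
      (∀ t ∈ Ioc t0 t1, ∀ k, z t k = P.mu k * v t k + P.qsym k * P.nonlin (v t) k) ∧
      ∀ t ∈ Ioc t0 t1, HasDerivWithinAt v (z t) (Icc t0 t1) t := by
  obtain ⟨Km, hKm, hm⟩ := P.exists_abs_mu_le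
  obtain ⟨Kq, hKq, hq⟩ := P.exists_abs_qsym_le
  obtain ⟨w, hwc, hw⟩ := exists_continuousOn_mul hv.cont (fun n s hs => hv.exists_wsum_le n hs)
    hKm hm
  obtain ⟨y, hyc, hy⟩ := exists_continuousOn_mul hv.continuousOn_nonlin (fun n s hs => by
    obtain ⟨C, hC, h⟩ := hv.exists_wsum_le n hs
    exact exists_wsum_nonlin_le hC h) hKq hq
  have hz : ∀ t ∈ Ioc t0 t1, ∀ k,
      (w t + y t) k = P.mu k * v t k + P.qsym k * P.nonlin (v t) k := fun t ht k => by
    rw [Ell.add_apply, hw t ht, hy t ht]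
  have hzc : ContinuousOn (fun t => w t + y t) (Ioc t0 t1) := hwc.add hyc
  refine ⟨w, fun t => w t + y t, hwc, hzc, hw, hz, fun t ht => ?_⟩
  obtain ⟨s, hs⟩ := exists_between ht.1
  have hsub : Icc s t1 ⊆ Ioc t0 t1 := fun r hr => ⟨hs.1.trans_le hr.1, hr.2⟩
  have hzs := hzc.mono hsub
  have hint : ∀ u ∈ Icc s t1, IntervalIntegrable (fun t => w t + y t) volume s u := fun u hu =>
    ContinuousOn.intervalIntegrable (by
      rw [uIcc_of_le hu.1]
      exact hzs.mono (Icc_subset_Icc_right hu.2))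
  -- The coefficient equations integrate to an identity in ℓ¹_ω. Since its integrand is continuous
  -- up to t1, differentiating it back gives a derivative in norm, one-sided at t1.
  have hftc : ∀ u ∈ Icc s t1, v u = v s + ∫ r in s..u, (w r + y r) := fun u hu => by
    refine Ell.ext fun k => ?_
    have h1 := intervalIntegral.integral_eq_sub_of_hasDerivAt_of_le (a := s) (b := u)
      (f := fun r => v r k) (f' := fun r => (w r + y r) k) hu.1
      ((P.coeffL k).continuous.comp_continuousOn (hv.cont.mono fun r hr =>
        ⟨(hs.1.trans_le hr.1).le, hr.2.trans hu.2⟩))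
      (fun r hr => by
        have hr' : r ∈ Ioo t0 t1 := ⟨hs.1.trans hr.1, hr.2.trans_le hu.2⟩
        rw [hz r ⟨hr'.1, hr'.2.le⟩]
        exact hv.ode r hr' k)
      ((intervalIntegrable_iff_integrableOn_Ioo_of_le hu.1).2 (Ell.integrableOn_apply
        ((intervalIntegrable_iff_integrableOn_Ioo_of_le hu.1).1 (hint u hu)) k))
    rw [Ell.add_apply, intervalIntegral_apply hu.1
      ((intervalIntegrable_iff_integrableOn_Ioo_of_le hu.1).1 (hint u hu)), h1]
    ring
  have htI : t ∈ Icc s t1 := ⟨hs.2.le, ht.2⟩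
  have : Fact (t ∈ Icc s t1) := ⟨htI⟩
  have h1 : HasDerivWithinAt (fun u => ∫ r in s..u, (w r + y r)) (w t + y t) (Icc s t1) t :=
    intervalIntegral.integral_hasDerivWithinAt_right (hint t htI)
      (hzs.stronglyMeasurableAtFilter_nhdsWithin measurableSet_Icc t) (hzs t htI)
  have h2 : HasDerivWithinAt v (w t + y t) (Icc s t1) t :=
    (h1.const_add (v s)).congr hftc (hftc t htI)
  refine h2.mono_of_mem_nhdsWithin ?_
  exact mem_nhdsWithin.2 ⟨Ioi s, isOpen_Ioi, hs.2, fun r hr => ⟨le_of_lt hr.1, hr.2.2⟩⟩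

end IsCoeffSol

/-- Solutions of the equations for the coefficients belong to the domain. -/
theorem IsCoeffSol.inDomain {v : C(Icc t0 t1, P.Ell)} (hv : P.IsCoeffSol (extZero v) t0 t1) :
    InDomain v ∧ ∀ t ∈ Ioo t0 t1, ∀ k, deriv (extZero v) t k =
      P.mu k * extZero v t k + P.qsym k * P.nonlin (extZero v t) k := by
  obtain ⟨w, z, hwc, hzc, hw, hz, hd⟩ := hv.exists_deriv
  have hd' : ∀ t ∈ Ioo t0 t1, HasDerivAt (extZero v) (z t) t := fun t ht =>
    (hd t ⟨ht.1, ht.2.le⟩).hasDerivAt (Icc_mem_nhds ht.1 ht.2)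
  refine ⟨⟨⟨w, hwc, hw⟩, ?_⟩, fun t ht k => ?_⟩
  · have h1 : ContDiffOn ℝ (0 + 1) (extZero v) (Ioo t0 t1) := by
      rw [contDiffOn_succ_iff_deriv_of_isOpen isOpen_Ioo]
      refine ⟨fun t ht => (hd' t ht).differentiableAt.differentiableWithinAt, by simp, ?_⟩
      rw [contDiffOn_zero]
      exact (hzc.mono Ioo_subset_Ioc_self).congr fun t ht => (hd' t ht).deriv
    simpa using h1
  · rw [(hd' t ht).deriv, hz t ⟨ht.1, ht.2.le⟩]

end PDEData
end

noncomputable section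

namespace PDEData

open MeasureTheory

variable {d : ℕ} {P : PDEData d}

/-! ### Passing from the truncated equation to the equation on one step -/

section OneStep

variable {t0 t1 : ℝ} {a : C(Icc t0 t1, P.Ell)} {ρ : ℝ}

lemma norm_extZero_sub_le {v : C(Icc t0 t1, P.Ell)} (hva : ‖v - a‖ ≤ ρ) {t : ℝ}
    (ht : t ∈ Icc t0 t1) : ‖extZero v t - extZero a t‖ ≤ ρ := by
  rw [extZero_apply ht, extZero_apply ht]
  exact ((v - a).norm_coe_le_norm ⟨t, ht⟩).trans hva

lemma norm_sub_le_of_Ioc (hρ : 0 ≤ ρ) (ht01 : t0 < t1) {v : C(Icc t0 t1, P.Ell)}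
    (h : ∀ t ∈ Ioc t0 t1, ‖extZero v t - extZero a t‖ ≤ ρ) : ‖v - a‖ ≤ ρ := by
  have h1 : ContinuousOn (fun t => ‖extZero v t - extZero a t‖) (Icc t0 t1) :=
    ((continuousOn_extZero v).sub (continuousOn_extZero a)).norm
  rw [← closure_Ioc ht01.ne] at h1
  refine (ContinuousMap.norm_le _ hρ).2 fun t => ?_
  have h2 := le_on_closure h h1 continuousOn_const (by rw [closure_Ioc ht01.ne]; exact t.2)
  rwa [extZero_apply t.2, extZero_apply t.2] at h2

/-- In the ball, solutions of the truncated equation solve the equation. -/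
lemma IsTruncSol.isCoeffSol (hρ : 0 < ρ) (ht01 : t0 < t1) {v : C(Icc t0 t1, P.Ell)}
    (hv : IsTruncSol a ρ v) (hva : ‖v - a‖ ≤ ρ) : P.IsCoeffSol (extZero v) t0 t1 := by
  have hHc : ContinuousOn (fun r => P.nonlin (extZero v r)) (Icc t0 t1) :=
    P.continuous_nonlin.comp_continuousOn (continuousOn_extZero v)
  have hH : IntegrableOn (fun r => P.nonlin (extZero v r)) (Ioo t0 t1) :=
    (hHc.integrableOn_Icc).mono_set Ioo_subset_Icc_self
  refine ⟨continuousOn_extZero v, (coeff_of_mild P.halfOrder_one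
    (psi := extZero v t0) ht01 (hHc.mono Ioo_subset_Icc_self) hH (fun t ht =>
      P.halfOrder_qsym.integrableOn_heat_sub_apply_of_continuousOn ht.1
      (hHc.mono fun r hr => ⟨hr.1.le, hr.2.trans ht.2⟩)
      (hH.mono_set (Ioo_subset_Ioo_right ht.2))) fun t ht => ?_).1⟩
  rw [hv t ht]
  congr 1
  refine intervalIntegral.integral_congr fun r hr => ?_
  rw [uIcc_of_le ht.1.le] at hr
  rw [trunc_of_norm_le hρ (norm_extZero_sub_le hva ⟨hr.1, hr.2.trans ht.2⟩)]

end OneStep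

/-! ### Error recursion over the steps and matrix row sums -/

section Sums

variable {K : ℕ}

/-- Unrolled linear recursion. A jump at the beginning of step j is carried through the steps j,
..., i - 1, hence the product over `Ico`; c j is already measured at the end of step j, hence `Ioo`.
The summand 1 is the jump at step i itself. -/
lemma le_of_forall_step_le {W c e : Fin K → ℝ} {ε : ℝ} (hW : ∀ i, 0 ≤ W i)
    (h0 : ∀ i : Fin K, i.val = 0 → e i ≤ ε)
    (hs : ∀ i i' : Fin K, i'.val = i.val + 1 → e i' ≤ ε + (W i * e i + c i)) (i : Fin K) :
    e i ≤ (∑ j ∈ Finset.Iio i, ∏ l ∈ Finset.Ico j i, W l + 1) * ε +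
      ∑ j ∈ Finset.Iio i, (∏ l ∈ Finset.Ioo j i, W l) * c j := by
  obtain ⟨n, hn⟩ : ∃ n, i.val = n := ⟨_, rfl⟩
  induction n generalizing i with
  | zero =>
    have h1 : Finset.Iio i = ∅ := by
      ext j
      simp only [Finset.mem_Iio, Finset.notMem_empty, iff_false, not_lt, Fin.le_def]
      omega
    simpa [h1] using h0 i hn
  | succ n ih =>
    obtain ⟨m, hm⟩ : ∃ m : Fin K, m.val = n := ⟨⟨n, by have := i.isLt; omega⟩, rfl⟩
    have hI : Finset.Iio i = insert m (Finset.Iio m) := by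
      ext j
      simp only [Finset.mem_Iio, Finset.mem_insert, Fin.lt_def, Fin.ext_iff]
      omega
    have hIco : ∀ j : Fin K, j ≤ m → Finset.Ico j i = insert m (Finset.Ico j m) := fun j hj => by
      ext l
      simp only [Finset.mem_Ico, Finset.mem_insert, Fin.lt_def, Fin.le_def, Fin.ext_iff] at *
      omega
    have hIoo : ∀ j : Fin K, j < m → Finset.Ioo j i = insert m (Finset.Ioo j m) := fun j hj => by
      ext l
      simp only [Finset.mem_Ioo, Finset.mem_insert, Fin.lt_def, Fin.ext_iff] at *
      omega
    have hIoo' : Finset.Ioo m i = ∅ := by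
      ext l
      simp only [Finset.mem_Ioo, Finset.notMem_empty, iff_false, Fin.lt_def]
      omega
    have e1 : ∑ j ∈ Finset.Iio i, ∏ l ∈ Finset.Ico j i, W l =
        W m * (∑ j ∈ Finset.Iio m, ∏ l ∈ Finset.Ico j m, W l + 1) := by
      rw [hI, Finset.sum_insert (by simp), hIco m le_rfl, mul_add, Finset.mul_sum]
      simp only [Finset.Ico_self, Finset.prod_insert, Finset.notMem_empty, not_false_eq_true,
        Finset.prod_empty]
      rw [add_comm]
      congr 1
      refine Finset.sum_congr rfl fun j hj => ?_
      rw [hIco j (Finset.mem_Iio.1 hj).le, Finset.prod_insert (by simp)]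
    have e2 : ∑ j ∈ Finset.Iio i, (∏ l ∈ Finset.Ioo j i, W l) * c j =
        W m * (∑ j ∈ Finset.Iio m, (∏ l ∈ Finset.Ioo j m, W l) * c j) + c m := by
      rw [hI, Finset.sum_insert (by simp), hIoo', Finset.prod_empty, one_mul, add_comm,
        Finset.mul_sum]
      congr 1
      refine Finset.sum_congr rfl fun j hj => ?_
      rw [hIoo j (Finset.mem_Iio.1 hj), Finset.prod_insert (by simp), mul_assoc]
    rw [e1, e2]
    have h1 := mul_le_mul_of_nonneg_left (ih m hm) (hW m)
    linarith [hs m i (by omega)]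

lemma sum_ite_lt_ite_eq (i : Fin K) (f : Fin K → ℝ) (D : ℝ) :
    (∑ j, if j < i then f j else if j = i then D else 0) = ∑ j ∈ Finset.Iio i, f j + D := by
  have h1 : ∀ j, (if j < i then f j else if j = i then D else 0) =
      (if j ∈ Finset.Iio i then f j else 0) + if j = i then D else 0 := fun j => by
    rcases lt_trichotomy j i with h | h | h
    · simp [h, h.ne]
    · simp [h]
    · simp [h.not_gt, h.ne']
  simp only [h1, Finset.sum_add_distrib, Finset.sum_ite_mem, Finset.univ_inter,
    Finset.sum_ite_eq', Finset.mem_univ, if_true]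

lemma row_sum_le_matInfNorm (M : Matrix (Fin K) (Fin K) ℝ) (i : Fin K) :
    ∑ j, M i j ≤ matInfNorm M := by
  unfold matInfNorm
  rw [Matrix.linfty_opNorm_def]
  refine le_trans ?_ (NNReal.coe_le_coe.2 (Finset.le_sup (f := fun i => ∑ j, ‖M i j‖₊)
    (Finset.mem_univ i)))
  push_cast
  exact Finset.sum_le_sum fun j _ => le_abs_self _

end Sums

/-! ### Jump conditions between the steps -/

section Steps

variable {K : ℕ} {t : Fin (K + 1) → ℝ} {phi : P.Ell}

lemma F2_of_val_eq_zero {a : P.StepSpace t} {i : Fin K} (hi : i.val = 0) :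
    F2 phi a i = extZero (a i) (t i.castSucc) - phi := by
  unfold F2
  rw [if_pos hi]

lemma F2_of_val_eq_add_one {a : P.StepSpace t} {i j : Fin K} (hi : i.val = j.val + 1) :
    F2 phi a i = extZero (a i) (t i.castSucc) - extZero (a j) (t j.succ) := by
  have h1 : (⟨i.val - 1, lt_of_le_of_lt (Nat.sub_le _ _) i.isLt⟩ : Fin K) = j := by
    ext
    simp [hi]
  have h2 : i.castSucc = j.succ := by
    ext
    simp [hi]
  unfold F2
  rw [if_neg (by omega), h1]
  exact congrArg (fun r => extZero (a i) (t i.castSucc) - extZero (a j) r) (congrArg t h2)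

/-- Solutions on the single steps fit together to a function without jumps. -/
lemma exists_stepSpace_F2_eq_zero {S : (i : Fin K) → C(Icc (t i.castSucc) (t i.succ), P.Ell) → Prop}
    (h : ∀ i x, ∃ v, extZero v (t i.castSucc) = x ∧ S i v) (phi : P.Ell) :
    ∃ a : P.StepSpace t, (∀ i, S i (a i)) ∧ ∀ i, F2 phi a i = 0 := by
  choose sol h0 hS using h
  obtain ⟨x, hx0, hxs⟩ : ∃ x : ℕ → P.Ell, x 0 = phi ∧ ∀ i : Fin K,
      x (i.val + 1) = extZero (sol i (x i)) (t i.succ) := by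
    -- The initial values are defined recursively: each is the end value of the preceding step. The
    -- value 0 beyond the last step is never used.
    refine ⟨fun n => Nat.rec phi (fun m y => if h : m < K then
      extZero (sol ⟨m, h⟩ y) (t (Fin.succ ⟨m, h⟩)) else 0) n, rfl, fun i => ?_⟩
    change (if h : i.val < K then _ else _) = _
    rw [dif_pos i.isLt]
  refine ⟨fun i => sol i (x i), fun i => hS i _, fun i => ?_⟩
  rcases Nat.eq_zero_or_pos i.val with hi | hi
  · rw [F2_of_val_eq_zero hi, h0, hi, hx0, sub_self]
  · obtain ⟨j, hj⟩ : ∃ j : Fin K, i.val = j.val + 1 :=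
      ⟨⟨i.val - 1, by have := i.isLt; omega⟩, by simp only; omega⟩
    rw [F2_of_val_eq_add_one hj, h0, hj, hxs, sub_self]

/-- Since a has no jumps, the error at the start of a step is the error at the end of the preceding
one minus the jump of `abar`, which has norm at most ε. -/
lemma norm_F2_sub_le {a abar : P.StepSpace t} (ha : ∀ i, F2 phi a i = 0) {ε : ℝ}
    (hε : ∀ i, ‖F2 phi abar i‖ ≤ ε) :
    (∀ i : Fin K, i.val = 0 →
      ‖extZero (a i) (t i.castSucc) - extZero (abar i) (t i.castSucc)‖ ≤ ε) ∧
    ∀ i i' : Fin K, i'.val = i.val + 1 →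
      ‖extZero (a i') (t i'.castSucc) - extZero (abar i') (t i'.castSucc)‖ ≤
        ε + ‖extZero (a i) (t i.succ) - extZero (abar i) (t i.succ)‖ := by
  refine ⟨fun i hi => ?_, fun i i' hi => ?_⟩
  · have h1 := ha i
    have h2 := hε i
    rw [F2_of_val_eq_zero hi] at h1 h2
    rwa [sub_eq_zero.1 h1, norm_sub_rev]
  · have h1 := ha i'
    have h2 := hε i'
    rw [F2_of_val_eq_add_one hi] at h1 h2
    rw [sub_eq_zero.1 h1]
    have h3 : extZero (a i) (t i.succ) - extZero (abar i') (t i'.castSucc) =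
        -(extZero (abar i') (t i'.castSucc) - extZero (abar i) (t i.succ)) +
        (extZero (a i) (t i.succ) - extZero (abar i) (t i.succ)) := by abel
    rw [h3]
    refine (norm_add_le _ _).trans ?_
    rw [norm_neg]
    exact add_le_add_left h2 _

end Steps

end PDEData
end

/-! ### The radius condition: existence and uniqueness in the ball -/

noncomputable section

namespace PDEData

open MeasureTheory

variable {d : ℕ} {P : PDEData d} {K : ℕ} {t : Fin (K + 1) → ℝ} {phi : P.Ell}

lemma IsZeroOfF.isCoeffSol {a : P.StepSpace t} (ha : IsZeroOfF phi a) (i : Fin K) :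
    P.IsCoeffSol (extZero (a i)) (t i.castSucc) (t i.succ) := by
  refine ⟨continuousOn_extZero _, fun r hr k => ?_⟩
  have h1 := (P.coeffL k).hasFDerivAt.comp_hasDerivAt r ((ha.1 i).hasDerivAt hr)
  have h2 : deriv (extZero (a i)) r k - P.Lop (extZero (a i) r) k -
      P.Q (P.nonlin (extZero (a i) r)) k = 0 := congrFun (ha.2.1 i r hr) k
  have h3 : deriv (extZero (a i)) r k = P.mu k * extZero (a i) r k +
      P.qsym k * P.nonlin (extZero (a i) r) k := by
    unfold Lop Q at h2
    linarith
  rw [← h3]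
  exact h1

/-- The radii polynomial argument: solutions of the truncated equations stay in the ball. -/
theorem norm_sub_le_of_isTruncSol {abar : P.StepSpace t} (ht : StrictMono t)
    (habar : ∀ i, InDomain (abar i)) {gam : ℝ} (hgam1 : gam < 1) {WS WSq WE WEq WT : Fin K → ℝ}
    (hW : EvolutionBounds abar gam WS WSq WE WEq WT) {δ ε Λ ρ : ℝ} (hΛ : 0 ≤ Λ) (hρ : 0 < ρ)
    (hδ : ∀ i, ∀ r ∈ Ioo (t i.castSucc) (t i.succ), F1 abar i r ∈ P.ellSubmodule ∧
      P.normOmega (F1 abar i r) ≤ δ)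
    (hε : ∀ i, ‖F2 phi abar i‖ ≤ ε) (hL : ∀ i, LipBound (abar i) ρ Λ)
    (hp : Wl WS WT * ε + WX t gam WS WSq WEq WT * Λ * ρ + WY t WS WE WT * δ ≤ ρ)
    {a : P.StepSpace t} (ha : ∀ i, IsTruncSol (abar i) ρ (a i)) (ha2 : ∀ i, F2 phi a i = 0)
    (i : Fin K) : ‖a i - abar i‖ ≤ ρ := by
  have hti : ∀ i : Fin K, t i.castSucc < t i.succ := fun i => ht Fin.castSucc_lt_succ
  have hδ' : ∀ i, ∀ r ∈ Ioo (t i.castSucc) (t i.succ), ∃ y : P.Ell, (∀ k, y k =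
      deriv (extZero (abar i)) r k - P.Lop (extZero (abar i) r) k -
      P.Q (P.nonlin (extZero (abar i) r)) k) ∧ ‖y‖ ≤ δ := fun i r hr =>
    ⟨⟨_, (hδ i r hr).1⟩, fun k => rfl, (hδ i r hr).2⟩
  have hε0 : 0 ≤ ε := (norm_nonneg _).trans (hε i)
  have hδ0 : 0 ≤ δ := by
    obtain ⟨r, hr⟩ := exists_between (hti i)
    obtain ⟨y, -, hy⟩ := hδ' i r hr
    exact (norm_nonneg _).trans hy
  obtain ⟨e, he⟩ : ∃ e : Fin K → ℝ, e = fun i =>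
    ‖extZero (a i) (t i.castSucc) - extZero (abar i) (t i.castSucc)‖ := ⟨_, rfl⟩
  obtain ⟨c, hc⟩ : ∃ c : Fin K → ℝ, c = fun j =>
    tauHat t gam j * WEq j * (Λ * ρ) + tau t j * WE j * δ := ⟨_, rfl⟩
  -- The a priori bound at the end of a step, where the sharper end point constants apply; it is the
  -- recursion for the initial errors e.
  have hend : ∀ j, ‖extZero (a j) (t j.succ) - extZero (abar j) (t j.succ)‖ ≤
      WT j * e j + c j := fun j => by
    obtain ⟨-, -, hWE, hWEq, -⟩ := hW.pos j
    have h1 := (ha j).norm_sub_le (hL j) hΛ hρ (hti j) (habar j) (hδ' j)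
      (t := t j.succ) ⟨hti j, le_rfl⟩ hgam1 hWEq.le hWE.le (hW.transfer j)
      (fun s hs => hW.endpoint_q j s hs.1.le hs.2) (fun s hs => hW.endpoint j s hs.1 hs.2)
    rw [he, hc]
    unfold tauHat tau
    linarith
  obtain ⟨h0, hs⟩ := norm_F2_sub_le ha2 hε
  have hei := le_of_forall_step_le (e := e) (c := c) (W := WT) (ε := ε)
    (fun j => (hW.pos j).2.2.2.2.le) (fun j hj => by rw [he]; exact h0 j hj)
    (fun j j' hj => by
      have h1 := hs j j' hj
      have h2 := hend j
      rw [he] at h2 ⊢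
      linarith) i
  obtain ⟨hWS, hWSq, -, -, -⟩ := hW.pos i
  have hτ : 0 < tau t i := sub_pos.2 (hti i)
  refine norm_sub_le_of_Ioc hρ.le (hti i) fun r hr => ?_
  -- The bound at an interior time r of step i. Here the constants uniform over the step are used,
  -- also for the initial time, where the bound is obtained as a limit.
  have h1 := (ha i).norm_sub_le (hL i) hΛ hρ (hti i) (habar i) (hδ' i) hr hgam1 hWSq.le hWS.le
    (norm_evol_le_of_forall_gt (abar i) hr fun s h1 h2 => hW.simplex i s r h1 h2 hr.2)
    (fun s hs => hW.simplex_q i s r hs.1 hs.2 hr.2) (fun s hs => hW.simplex i s r hs.1 hs.2 hr.2)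
  have h2 : (r - t i.castSucc) ^ (1 - gam) / (1 - gam) ≤ tauHat t gam i := by
    unfold tauHat tau
    have h3 : 0 < 1 - gam := by linarith
    have h4 := hr.1
    have h5 := hr.2
    gcongr
  have h3 : r - t i.castSucc ≤ tau t i := sub_le_sub_right hr.2 _
  have h4 : ‖extZero (a i) r - extZero (abar i) r‖ ≤
      WS i * e i + tauHat t gam i * WSq i * (Λ * ρ) + tau t i * WS i * δ := by
    rw [he]
    refine h1.trans ?_
    gcongr
  have hl := mul_le_mul_of_nonneg_right (row_sum_le_matInfNorm (Matrix.of fun i j =>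
    if j < i then WS i * ∏ l ∈ Finset.Ico j i, WT l else if j = i then WS i else 0) i) hε0
  have hX := mul_le_mul_of_nonneg_right (row_sum_le_matInfNorm (Matrix.of fun i j =>
    if j < i then tauHat t gam j * WS i * (∏ l ∈ Finset.Ioo j i, WT l) * WEq j
    else if j = i then tauHat t gam i * WSq i else 0) i) (mul_nonneg hΛ hρ.le)
  have hY := mul_le_mul_of_nonneg_right (row_sum_le_matInfNorm (Matrix.of fun i j =>
    if j < i then tau t j * WS i * (∏ l ∈ Finset.Ioo j i, WT l) * WE j
    else if j = i then tau t i * WS i else 0) i) hδ0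
  simp only [Matrix.of_apply] at hl hX hY
  rw [sum_ite_lt_ite_eq i (fun j => WS i * ∏ l ∈ Finset.Ico j i, WT l)] at hl
  rw [sum_ite_lt_ite_eq i
    (fun j => tauHat t gam j * WS i * (∏ l ∈ Finset.Ioo j i, WT l) * WEq j)] at hX
  rw [sum_ite_lt_ite_eq i
    (fun j => tau t j * WS i * (∏ l ∈ Finset.Ioo j i, WT l) * WE j)] at hY
  -- Inserting the unrolled recursion: the coefficients of ε, Λρ and δ are the sums of row i of the
  -- three matrices.
  have h5 : WS i * ((∑ j ∈ Finset.Iio i, ∏ l ∈ Finset.Ico j i, WT l + 1) * ε +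
      ∑ j ∈ Finset.Iio i, (∏ l ∈ Finset.Ioo j i, WT l) * c j) +
      tauHat t gam i * WSq i * (Λ * ρ) + tau t i * WS i * δ =
      (∑ j ∈ Finset.Iio i, WS i * ∏ l ∈ Finset.Ico j i, WT l + WS i) * ε +
      (∑ j ∈ Finset.Iio i, tauHat t gam j * WS i * (∏ l ∈ Finset.Ioo j i, WT l) * WEq j +
        tauHat t gam i * WSq i) * (Λ * ρ) +
      (∑ j ∈ Finset.Iio i, tau t j * WS i * (∏ l ∈ Finset.Ioo j i, WT l) * WE j +
        tau t i * WS i) * δ := by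
    have h6 : WS i * ∑ j ∈ Finset.Iio i, (∏ l ∈ Finset.Ioo j i, WT l) * c j =
        (∑ j ∈ Finset.Iio i, tauHat t gam j * WS i * (∏ l ∈ Finset.Ioo j i, WT l) * WEq j) *
          (Λ * ρ) +
        (∑ j ∈ Finset.Iio i, tau t j * WS i * (∏ l ∈ Finset.Ioo j i, WT l) * WE j) * δ := by
      rw [hc, Finset.mul_sum, Finset.sum_mul, Finset.sum_mul, ← Finset.sum_add_distrib]
      exact Finset.sum_congr rfl fun j _ => by ring
    rw [mul_add, h6, ← Finset.mul_sum]
    ring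
  have h7 := mul_le_mul_of_nonneg_left hei hWS.le
  unfold Wl WX WY at hp
  linarith

/-- Existence and uniqueness of the zero of `F` in the ball. -/
theorem existsUnique_isZeroOfF {abar : P.StepSpace t} (ht : StrictMono t)
    (habar : ∀ i, InDomain (abar i)) {gam : ℝ} (hgam1 : gam < 1) {WS WSq WE WEq WT : Fin K → ℝ}
    (hW : EvolutionBounds abar gam WS WSq WE WEq WT) {δ ε Λ ρ : ℝ} (hΛ : 0 ≤ Λ) (hρ : 0 < ρ)
    (hδ : ∀ i, ∀ r ∈ Ioo (t i.castSucc) (t i.succ), F1 abar i r ∈ P.ellSubmodule ∧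
      P.normOmega (F1 abar i r) ≤ δ)
    (hε : ∀ i, ‖F2 phi abar i‖ ≤ ε) (hL : ∀ i, LipBound (abar i) ρ Λ)
    (hp : Wl WS WT * ε + WX t gam WS WSq WEq WT * Λ * ρ + WY t WS WE WT * δ ≤ ρ) :
    ∃! a : P.StepSpace t, ‖a - abar‖ ≤ ρ ∧ IsZeroOfF phi a := by
  have hti : ∀ i : Fin K, t i.castSucc < t i.succ := fun i => ht Fin.castSucc_lt_succ
  obtain ⟨a, haS, ha2⟩ := exists_stepSpace_F2_eq_zero
    (fun i x => (hL i).exists_isTruncSol hΛ hρ (hti i) x) phi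
  have hai := norm_sub_le_of_isTruncSol ht habar hgam1 hW hΛ hρ hδ hε hL hp haS ha2
  refine ⟨a, ⟨(pi_norm_le_iff_of_nonneg hρ.le).2 hai, fun i => ?_, fun i r hr => ?_, ha2⟩, ?_⟩
  · exact ((haS i).isCoeffSol hρ (hti i) (hai i)).inDomain.1
  · refine funext fun k => ?_
    have h1 := ((haS i).isCoeffSol hρ (hti i) (hai i)).inDomain.2 r hr k
    change deriv (extZero (a i)) r k - P.mu k * _ - P.qsym k * _ = 0
    rw [h1]
    ring
  -- A second zero in the ball also solves the truncated equations. These have one solution per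
  -- initial value, and the vanishing jumps fix the initial values inductively, so no contraction
  -- constant below 1 is needed.
  · rintro b ⟨hb, hb1, hb2, hb3⟩
    have hbS : ∀ i, IsTruncSol (abar i) ρ (b i) := fun i =>
      (hb1 i).isTruncSol (hti i) hρ ((norm_le_pi_norm (b - abar) i).trans hb)
        fun r hr k => congrFun (hb2 i r hr) k
    funext i
    obtain ⟨n, hn⟩ : ∃ n, i.val = n := ⟨_, rfl⟩
    induction n generalizing i with
    | zero =>
      refine (hbS i).unique (hL i) hΛ hρ (hti i) (haS i) ?_
      have h1 := ha2 i
      have h2 := hb3 i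
      rw [F2_of_val_eq_zero hn, sub_eq_zero] at h1 h2
      rw [h1, h2]
    | succ n ih =>
      obtain ⟨j, hj⟩ : ∃ j : Fin K, j.val = n := ⟨⟨n, by have := i.isLt; omega⟩, rfl⟩
      refine (hbS i).unique (hL i) hΛ hρ (hti i) (haS i) ?_
      have h1 := ha2 i
      have h2 := hb3 i
      rw [F2_of_val_eq_add_one (j := j) (by omega), sub_eq_zero] at h1 h2
      rw [h1, h2, ih j hj]

end PDEData
end

/-! ### Gluing the steps to one solution -/

noncomputable section

namespace PDEData

open MeasureTheory

variable {d : ℕ} {P : PDEData d}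

/-- A function which is differentiable away from a point, where it and the derivative are
continuous, is differentiable there. -/
lemma hasDerivAt_of_continuousOn {f g : ℝ → ℝ} {a b s : ℝ} (hs : s ∈ Ioo a b)
    (hf : ContinuousAt f s) (hg : ContinuousAt g s)
    (h : ∀ r ∈ Ioo a b, r ≠ s → HasDerivAt f (g r) r) : HasDerivAt f (g s) s := by
  have h1 : HasDerivWithinAt f (g s) (Ici s) s := by
    refine hasDerivWithinAt_Ici_of_tendsto_deriv (s := Ioo s b)
      (fun r hr => (h r ⟨hs.1.trans hr.1, hr.2⟩ hr.1.ne').differentiableAt.differentiableWithinAt)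
      hf.continuousWithinAt (Ioo_mem_nhdsGT hs.2) ?_
    refine (hg.continuousWithinAt (s := Ioi s)).congr' ?_
    filter_upwards [Ioo_mem_nhdsGT hs.2] with r hr
    exact (h r ⟨hs.1.trans hr.1, hr.2⟩ hr.1.ne').deriv.symm
  have h2 : HasDerivWithinAt f (g s) (Iic s) s := by
    refine hasDerivWithinAt_Iic_of_tendsto_deriv (s := Ioo a s)
      (fun r hr => (h r ⟨hr.1, hr.2.trans hs.2⟩ hr.2.ne).differentiableAt.differentiableWithinAt)
      hf.continuousWithinAt (Ioo_mem_nhdsLT hs.1) ?_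
    refine (hg.continuousWithinAt (s := Iio s)).congr' ?_
    filter_upwards [Ioo_mem_nhdsLT hs.1] with r hr
    exact (h r ⟨hr.1, hr.2.trans hs.2⟩ hr.2.ne).deriv.symm
  simpa using h2.union h1

lemma IsCoeffSol.congr {v w : ℝ → P.Ell} {t0 t1 : ℝ} (hv : P.IsCoeffSol v t0 t1)
    (h : EqOn w v (Icc t0 t1)) : P.IsCoeffSol w t0 t1 := by
  refine ⟨hv.cont.congr h, fun t ht k => ?_⟩
  rw [h (Ioo_subset_Icc_self ht)]
  refine (hv.ode t ht k).congr_of_eventuallyEq ?_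
  filter_upwards [Icc_mem_nhds ht.1 ht.2] with r hr
  rw [h hr]

/-- Concatenation of solutions. -/
lemma IsCoeffSol.exists_glue {v w : ℝ → P.Ell} {t0 t1 t2 : ℝ} (h01 : t0 ≤ t1) (h12 : t1 ≤ t2)
    (hv : P.IsCoeffSol v t0 t1) (hw : P.IsCoeffSol w t1 t2) (h : v t1 = w t1) :
    ∃ u, P.IsCoeffSol u t0 t2 ∧ EqOn u v (Icc t0 t1) ∧ EqOn u w (Icc t1 t2) := by
  obtain ⟨u, hu⟩ : ∃ u : ℝ → P.Ell, u = fun r => if r ≤ t1 then v r else w r := ⟨_, rfl⟩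
  have huv : EqOn u v (Icc t0 t1) := fun r hr => by
    rw [hu]
    exact if_pos hr.2
  have huw : EqOn u w (Icc t1 t2) := fun r hr => by
    rcases hr.1.eq_or_lt with rfl | h1
    · rw [huv ⟨h01, le_rfl⟩, h]
    · rw [hu]
      exact if_neg h1.not_ge
  have hv' := hv.congr huv
  have hw' := hw.congr huw
  have hc : ContinuousOn u (Icc t0 t2) := by
    rw [← Icc_union_Icc_eq_Icc h01 h12]
    exact hv'.cont.union_of_isClosed hw'.cont isClosed_Icc isClosed_Icc
  have hode : ∀ t ∈ Ioo t0 t2, t ≠ t1 → ∀ k, HasDerivAt (fun r => u r k)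
      (P.mu k * u t k + P.qsym k * P.nonlin (u t) k) t := fun t ht hne k => by
    rcases lt_or_gt_of_ne hne with h1 | h1
    · exact hv'.ode t ⟨ht.1, h1⟩ k
    · exact hw'.ode t ⟨h1, ht.2⟩ k
  refine ⟨u, ⟨hc, fun t ht k => ?_⟩, huv, huw⟩
  -- At the junction u and the right-hand side of each coefficient equation are continuous, so the
  -- derivative from both sides exists and satisfies the equation there.
  rcases eq_or_ne t t1 with rfl | hne
  · have hct : ContinuousAt u t := hc.continuousAt (Icc_mem_nhds ht.1 ht.2)
    refine hasDerivAt_of_continuousOn (f := fun r => u r k)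
      (g := fun t => P.mu k * u t k + P.qsym k * P.nonlin (u t) k) ht
      ((P.coeffL k).continuous.continuousAt.comp hct) ?_ fun r hr hne => hode r hr hne k
    exact (continuousAt_const.mul ((P.coeffL k).continuous.continuousAt.comp hct)).add
      (continuousAt_const.mul ((P.coeffL k).continuous.continuousAt.comp
        (P.continuous_nonlin.continuousAt.comp hct)))
  · exact hode t ht hne k

/-- The steps of a zero of `F` form a solution on the whole interval. -/
lemma IsZeroOfF.exists_isCoeffSol {K : ℕ} {t : Fin (K + 1) → ℝ} {phi : P.Ell} (ht : StrictMono t)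
    {a : P.StepSpace t} (ha : IsZeroOfF phi a) :
    ∃ v, P.IsCoeffSol v (t 0) (t (Fin.last K)) ∧ v (t 0) = phi ∧
      ∀ i, EqOn v (extZero (a i)) (Icc (t i.castSucc) (t i.succ)) := by
  -- Induction over the nodes. The last clause carries the matching condition: at node n the
  -- solution has the value with which the next step starts.
  suffices h : ∀ n : Fin (K + 1), ∃ v, P.IsCoeffSol v (t 0) (t n) ∧ v (t 0) = phi ∧
      (∀ i : Fin K, i.castSucc < n → EqOn v (extZero (a i)) (Icc (t i.castSucc) (t i.succ))) ∧
      ∀ i : Fin K, i.castSucc = n → v (t i.castSucc) = extZero (a i) (t i.castSucc) by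
    obtain ⟨v, h1, h2, h3, -⟩ := h (Fin.last K)
    exact ⟨v, h1, h2, fun i => h3 i i.castSucc_lt_last⟩
  intro n
  induction n using Fin.induction with
  | zero =>
    -- On the degenerate interval from t 0 to t 0 the differential equations are vacuous, and only
    -- the initial value matters.
    refine ⟨fun _ => phi, ⟨continuousOn_const, fun r hr => ?_⟩, rfl,
      fun i hi => absurd hi (Fin.not_lt_zero _), fun i hi => ?_⟩
    · exact absurd (hr.1.trans hr.2) (lt_irrefl _)
    · have h1 := ha.2.2 i
      rw [F2_of_val_eq_zero (by simpa using congrArg Fin.val hi), sub_eq_zero] at h1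
      exact h1.symm
  | succ i ih =>
    obtain ⟨v, h1, h2, h3, h4⟩ := ih
    have h01 : t 0 ≤ t i.castSucc := ht.monotone (Fin.zero_le _)
    have h12 : t i.castSucc < t i.succ := ht Fin.castSucc_lt_succ
    obtain ⟨u, hu, huv, huw⟩ := h1.exists_glue h01 h12.le (ha.isCoeffSol i) (h4 i rfl)
    refine ⟨u, hu, ?_, fun j hj => ?_, fun j hj => ?_⟩
    · rw [huv ⟨le_rfl, h01⟩, h2]
    · rcases eq_or_ne j i with rfl | hne
      · exact huw
      · have hji : j.castSucc < i.castSucc := by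
          rw [Fin.castSucc_lt_castSucc_iff]
          rw [Fin.castSucc_lt_succ_iff] at hj
          exact lt_of_le_of_ne hj hne
        intro r hr
        have hr' : r ∈ Icc (t 0) (t i.castSucc) :=
          ⟨(ht.monotone (Fin.zero_le _)).trans hr.1, hr.2.trans (ht.monotone (by
            rw [Fin.le_def]
            rw [Fin.lt_def] at hji
            simpa using hji))⟩
        rw [huv hr', h3 j hji hr]
    · have h5 := ha.2.2 j
      rw [F2_of_val_eq_add_one (j := i) (by simpa using congrArg Fin.val hj), sub_eq_zero] at h5
      rw [h5, hj, huw ⟨h12.le, le_rfl⟩]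

end PDEData
end

noncomputable section

namespace PDEData

variable {d : ℕ} {P : PDEData d}

/-! ### Cosine series -/

/-- The wave vector `(m_j L_j)`. -/
def waveVec (P : PDEData d) (m : Fin d → ℤ) : EuclideanSpace ℝ (Fin d) :=
  WithLp.toLp 2 fun j => (m j : ℝ) * P.L j

/-- The phase `x ↦ ∑ m_j L_j x_j`. -/
def phase (P : PDEData d) (m : Fin d → ℤ) : EuclideanSpace ℝ (Fin d) →L[ℝ] ℝ :=
  innerSL ℝ (P.waveVec m)

lemma phase_apply (m : Fin d → ℤ) (x : EuclideanSpace ℝ (Fin d)) :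
    P.phase m x = ∑ j, (m j : ℝ) * P.L j * x j := by
  unfold phase waveVec
  rw [innerSL_apply_apply, PiLp.inner_apply]
  exact Finset.sum_congr rfl fun j _ => by simp [mul_comm]

lemma phase_add (m n : Fin d → ℤ) (x : EuclideanSpace ℝ (Fin d)) :
    P.phase (m + n) x = P.phase m x + P.phase n x := by
  rw [phase_apply, phase_apply, phase_apply, ← Finset.sum_add_distrib]
  refine Finset.sum_congr rfl fun j _ => ?_
  rw [Pi.add_apply]
  push_cast
  ring

lemma sum_waveVec_sq (m : Fin d → ℤ) : ∑ j, P.waveVec m j ^ 2 = P.kLsq (absV m) := by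
  unfold kLsq waveVec absV
  refine Finset.sum_congr rfl fun j _ => ?_
  change ((m j : ℝ) * P.L j) ^ 2 = _
  rw [mul_pow, mul_pow, Nat.cast_natAbs, ← sq_abs (m j : ℝ)]
  push_cast
  rfl

lemma norm_phase_sq (m : Fin d → ℤ) : ‖P.phase m‖ ^ 2 = P.kLsq (absV m) := by
  rw [phase, innerSL_apply_norm, EuclideanSpace.norm_sq_eq, ← sum_waveVec_sq]
  exact Finset.sum_congr rfl fun j _ => by rw [Real.norm_eq_abs, sq_abs]

lemma exists_norm_phase_le (P : PDEData d) :
    ∃ C, 0 ≤ C ∧ ∀ m, ‖P.phase m‖ ≤ C * jap (absV m) := by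
  obtain ⟨K, hK0, hK⟩ := P.exists_kLsq_le
  refine ⟨√K, Real.sqrt_nonneg K, fun m => ?_⟩
  refine abs_le_of_sq_le_sq' ?_ (mul_nonneg (Real.sqrt_nonneg K) (jap_pos _).le) |>.2
  rw [norm_phase_sq, mul_pow, Real.sq_sqrt hK0]
  exact hK _

/-- Euler's formula in each coordinate: the pair ±k_j gives 2 cos, a zero entry gives 1, and the
factors 2 multiply to α_k. -/
lemma sum_signs_exp (k : Fin d → ℕ) (x : EuclideanSpace ℝ (Fin d)) :
    ∑ m ∈ signs k, Complex.exp (P.phase m x * Complex.I) =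
      (alpha k * ∏ j, Real.cos (k j * P.L j * x j) : ℝ) := by
  have h1 : ∀ m : Fin d → ℤ, Complex.exp (P.phase m x * Complex.I) =
      ∏ j, Complex.exp ((m j * P.L j * x j : ℂ) * Complex.I) := fun m => by
    rw [← Complex.exp_sum, phase_apply]
    push_cast
    rw [Finset.sum_mul]
  simp only [h1]
  rw [sum_signs_prod k fun j (n : ℤ) => Complex.exp ((n * P.L j * x j : ℂ) * Complex.I)]
  unfold alpha
  rw [← Finset.prod_mul_distrib, Complex.ofReal_prod]
  refine Finset.prod_congr rfl fun j _ => ?_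
  split_ifs with h
  · simp [h]
  · push_cast
    rw [Complex.cos]
    ring_nf

lemma summable_int_jap {a : (Fin d → ℕ) → ℝ} {n : ℕ} (h : P.wsum n a ≠ ⊤) :
    Summable fun m : Fin d → ℤ => |a (absV m)| * jap (absV m) ^ n := by
  rw [wsum_eq_tsum_int] at h
  refine Summable.of_nonneg_of_le (fun m => mul_nonneg (abs_nonneg _) (pow_pos (jap_pos _) n).le)
    (fun m => ?_) (ENNReal.summable_toReal h)
  rw [ENNReal.toReal_ofReal (mul_nonneg (abs_nonneg _) (intWeight_pos P n _).le)]
  refine mul_le_mul_of_nonneg_left ?_ (abs_nonneg _)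
  exact le_mul_of_one_le_left (pow_pos (jap_pos _) n).le (one_le_pow₀ P.one_le_nu)

lemma summable_int_abs (a : P.Ell) : Summable fun m : Fin d → ℤ => |a (absV m)| := by
  simpa using summable_int_jap (P := P) (a := a) (n := 0)
    (by rw [wsum_zero_eq]; exact ENNReal.ofReal_ne_top)

lemma norm_mul_exp (c : ℝ) (m : Fin d → ℤ) (x : EuclideanSpace ℝ (Fin d)) :
    ‖(c : ℂ) * Complex.exp (P.phase m x * Complex.I)‖ = |c| := by
  rw [norm_mul, Complex.norm_exp_ofReal_mul_I, mul_one, Complex.norm_real, Real.norm_eq_abs]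

lemma summable_exp (a : P.Ell) (x : EuclideanSpace ℝ (Fin d)) : Summable fun m : Fin d → ℤ =>
    ‖(a (absV m) : ℂ) * Complex.exp (P.phase m x * Complex.I)‖ := by
  simpa only [norm_mul_exp] using summable_int_abs a

/-- Absolute convergence permits grouping ℤ^d by absolute values. In the exponential form products
of series become convolutions and α_k disappears. -/
lemma cosSeries_eq_tsum_exp (a : P.Ell) (x : EuclideanSpace ℝ (Fin d)) :
    (P.cosSeries a x : ℂ) =
      ∑' m : Fin d → ℤ, (a (absV m) : ℂ) * Complex.exp (P.phase m x * Complex.I) := by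
  have hs := (summable_exp a x).of_norm
  rw [← (Equiv.sigmaFiberEquiv (absV (d := d))).tsum_eq]
  refine Eq.trans ?_ (Summable.tsum_sigma
    ((Equiv.sigmaFiberEquiv (absV (d := d))).summable_iff.2 hs)).symm
  rw [cosSeries, Complex.ofReal_tsum]
  refine tsum_congr fun k => ?_
  have h1 : ∀ m : { m : Fin d → ℤ // absV m = k },
      (a (absV ((Equiv.sigmaFiberEquiv absV) ⟨k, m⟩)) : ℂ) *
        Complex.exp (P.phase ((Equiv.sigmaFiberEquiv absV) ⟨k, m⟩) x * Complex.I) =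
      (a k : ℂ) * Complex.exp (P.phase m x * Complex.I) := fun m => by
    change (a (absV m.1) : ℂ) * Complex.exp (P.phase m.1 x * Complex.I) = _
    rw [m.2]
  refine Eq.trans ?_ (tsum_congr h1).symm
  have h2 : ∑' m : { m : Fin d → ℤ // absV m = k },
      (a k : ℂ) * Complex.exp (P.phase m x * Complex.I) =
      ∑' m : (signs k), (a k : ℂ) * Complex.exp (P.phase m x * Complex.I) :=
    (Equiv.subtypeEquivRight fun m => mem_signs.symm).tsum_eq
      (fun m : (signs k) => (a k : ℂ) * Complex.exp (P.phase m x * Complex.I))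
  rw [h2, tsum_mul_left, Finset.tsum_subtype (signs k)
    fun m => Complex.exp (P.phase m x * Complex.I), sum_signs_exp]
  push_cast
  ring

lemma cosSeries_eq_tsum_cos (a : P.Ell) (x : EuclideanSpace ℝ (Fin d)) :
    P.cosSeries a x = ∑' m : Fin d → ℤ, a (absV m) * Real.cos (P.phase m x) := by
  have h1 := congrArg Complex.re (cosSeries_eq_tsum_exp a x)
  rw [Complex.ofReal_re, Complex.re_tsum (summable_exp a x).of_norm] at h1
  rw [h1]
  refine tsum_congr fun m => ?_
  rw [Complex.re_ofReal_mul, Complex.exp_ofReal_mul_I_re]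

/-- Convolution of the coefficients is multiplication of the series. -/
lemma cosSeries_mul (a b : P.Ell) (x : EuclideanSpace ℝ (Fin d)) :
    P.cosSeries (a.mul b) x = P.cosSeries a x * P.cosSeries b x := by
  rw [← Complex.ofReal_inj, Complex.ofReal_mul, cosSeries_eq_tsum_exp, cosSeries_eq_tsum_exp,
    cosSeries_eq_tsum_exp, tsum_mul_tsum_of_summable_norm (summable_exp a x) (summable_exp b x)]
  have hs := summable_mul_of_summable_norm (summable_exp a x) (summable_exp b x)
  -- Reindexing by total frequency m and one summand n turns the double sum of the product into an
  -- iterated sum whose inner sum is the convolution.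
  obtain ⟨e, he⟩ : ∃ e : ((Fin d → ℤ) × (Fin d → ℤ)) ≃ ((Fin d → ℤ) × (Fin d → ℤ)),
      ∀ m n, e (m, n) = (n, m - n) :=
    ⟨⟨fun p => (p.2, p.1 - p.2), fun p => (p.1 + p.2, p.1), fun p => by simp, fun p => by simp⟩,
      fun _ _ => rfl⟩
  rw [← e.tsum_eq]
  refine Eq.trans ?_ (Summable.tsum_prod (e.summable_iff.2 hs)).symm
  refine tsum_congr fun m => ?_
  have h1 : (a.mul b : P.Ell) (absV m) = ∑' n : Fin d → ℤ, a (absV n) * b (absV (m - n)) :=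
    conv_absV a b m
  rw [h1, Complex.ofReal_tsum, ← tsum_mul_right]
  refine tsum_congr fun n => ?_
  have h2 : P.phase m x = P.phase n x + P.phase (m - n) x := by rw [← phase_add, add_sub_cancel]
  rw [Function.comp_apply, he, h2, Complex.ofReal_add, add_mul, Complex.exp_add, Complex.ofReal_mul]
  ring

lemma abs_cosSeries_term_le (a : P.Ell) (x : EuclideanSpace ℝ (Fin d)) (k : Fin d → ℕ) :
    ‖alpha k * a k * ∏ j, Real.cos (k j * P.L j * x j)‖ ≤ |a k| * P.omega k := by
  rw [norm_mul, norm_mul, Real.norm_eq_abs, Real.norm_eq_abs, abs_of_pos (alpha_pos k),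
    norm_prod]
  have h1 : ∏ j, ‖Real.cos (k j * P.L j * x j)‖ ≤ 1 :=
    Finset.prod_le_one (fun j _ => norm_nonneg _) fun j _ => Real.abs_cos_le_one _
  have h2 : 1 ≤ P.nu ^ (∑ j, k j) := one_le_pow₀ P.one_le_nu
  have h3 : 0 ≤ alpha k * |a k| := mul_nonneg (alpha_pos k).le (abs_nonneg _)
  calc _ ≤ alpha k * |a k| * 1 := mul_le_mul_of_nonneg_left h1 h3
    _ ≤ alpha k * |a k| * P.nu ^ (∑ j, k j) := mul_le_mul_of_nonneg_left h2 h3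
    _ = _ := by unfold omega; ring

lemma summable_cosSeries (a : P.Ell) (x : EuclideanSpace ℝ (Fin d)) :
    Summable fun k => alpha k * a k * ∏ j, Real.cos (k j * P.L j * x j) :=
  Summable.of_norm_bounded a.summable (abs_cosSeries_term_le a x)

/-- The value of the cosine series at a point, as a function of the coefficients. -/
def cosL (P : PDEData d) (x : EuclideanSpace ℝ (Fin d)) : P.Ell →L[ℝ] ℝ :=
  LinearMap.mkContinuous
    { toFun := fun a => P.cosSeries a x
      map_add' := fun a b => by
        unfold cosSeries
        rw [← (summable_cosSeries a x).tsum_add (summable_cosSeries b x)]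
        refine tsum_congr fun k => ?_
        rw [Ell.add_apply]
        ring
      map_smul' := fun c a => by
        unfold cosSeries
        rw [RingHom.id_apply, smul_eq_mul, ← tsum_mul_left]
        refine tsum_congr fun k => ?_
        rw [Ell.smul_apply]
        ring } 1 fun a => by
    rw [one_mul]
    exact tsum_of_norm_bounded a.summable.hasSum (abs_cosSeries_term_le a x)

lemma cosL_apply (a : P.Ell) (x : EuclideanSpace ℝ (Fin d)) : P.cosL x a = P.cosSeries a x := rfl

lemma norm_cosL_le (x : EuclideanSpace ℝ (Fin d)) : ‖P.cosL x‖ ≤ 1 :=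
  LinearMap.mkContinuous_norm_le _ zero_le_one _

lemma cosSeries_one (x : EuclideanSpace ℝ (Fin d)) : P.cosSeries (Ell.one P) x = 1 := by
  have h1 : ∀ k, (Ell.one P) k = if k = 0 then 1 else 0 := fun k => rfl
  unfold cosSeries
  rw [tsum_eq_single 0 fun k hk => by rw [h1, if_neg hk, mul_zero, zero_mul], h1]
  simp [alpha]

lemma cosSeries_pow (a : P.Ell) (x : EuclideanSpace ℝ (Fin d)) (n : ℕ) :
    P.cosSeries (a.pow n) x = P.cosSeries a x ^ n := by
  induction n with
  | zero => rw [pow_zero]; exact cosSeries_one x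
  | succ n ih =>
    rw [pow_succ, ← ih, ← cosSeries_mul]
    rfl

/-- `nonlin` gives the coefficients of `N(u)`. -/
lemma cosSeries_nonlin (a : P.Ell) (x : EuclideanSpace ℝ (Fin d)) :
    P.cosSeries (P.nonlin a) x = P.N.eval (P.cosSeries a x) := by
  rw [← cosL_apply, nonlin, map_sum, Polynomial.eval_eq_sum, Polynomial.sum]
  refine Finset.sum_congr rfl fun n _ => ?_
  rw [map_smul, cosL_apply, cosSeries_pow, smul_eq_mul]

/-- Continuity in x for fixed coefficients and the Lipschitz constant 1 in the coefficients, uniform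
in x, give joint continuity. This yields continuity of u up to the initial time, where no smoothing
is available. -/
lemma continuous_cosSeries :
    Continuous fun p : P.Ell × EuclideanSpace ℝ (Fin d) => P.cosSeries p.1 p.2 := by
  refine continuous_prod_of_continuous_lipschitzWith _ 1 (fun a => ?_) fun x => ?_
  · exact continuous_tsum (fun k => by fun_prop) a.summable fun k x => abs_cosSeries_term_le a x k
  · exact (P.cosL x).lipschitz.weaken (norm_cosL_le x)

lemma norm_iteratedFDeriv_cos_phase_le (c : ℝ) (m : Fin d → ℤ) (n : ℕ)
    (x : EuclideanSpace ℝ (Fin d)) :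
    ‖iteratedFDeriv ℝ n (fun y => c * Real.cos (P.phase m y)) x‖ ≤ |c| * ‖P.phase m‖ ^ n := by
  have h1 : ContDiff ℝ n (fun y => Real.cos (P.phase m y)) :=
    Real.contDiff_cos.comp (P.phase m).contDiff
  have h2 : iteratedFDeriv ℝ n (fun y => c * Real.cos (P.phase m y)) x =
      c • iteratedFDeriv ℝ n (fun y => Real.cos (P.phase m y)) x :=
    iteratedFDeriv_const_smul_apply (a := c) h1.contDiffAt
  have h3 : iteratedFDeriv ℝ n (fun y => Real.cos (P.phase m y)) x =
      (iteratedFDeriv ℝ n Real.cos (P.phase m x)).compContinuousLinearMap fun _ => P.phase m :=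
    (P.phase m).iteratedFDeriv_comp_right (n := n) Real.contDiff_cos x le_rfl
  rw [h2, norm_smul, Real.norm_eq_abs, h3]
  refine mul_le_mul_of_nonneg_left ?_ (abs_nonneg c)
  refine (ContinuousMultilinearMap.norm_compContinuousLinearMap_le _ _).trans ?_
  rw [Finset.prod_const, Finset.card_univ, Fintype.card_fin, norm_iteratedFDeriv_eq_norm_iteratedDeriv]
  exact mul_le_of_le_one_left (by positivity) (Real.abs_iteratedDeriv_cos_le_one n _)

lemma laplacian_cos_phase (c : ℝ) (m : Fin d → ℤ) (x : EuclideanSpace ℝ (Fin d)) :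
    ∑ j, iteratedFDeriv ℝ 2 (fun y => c * Real.cos (P.phase m y)) x
      ![EuclideanSpace.basisFun (Fin d) ℝ j, EuclideanSpace.basisFun (Fin d) ℝ j] =
    -P.kLsq (absV m) * c * Real.cos (P.phase m x) := by
  have h1 : ContDiff ℝ (2 : ℕ) (fun y => Real.cos (P.phase m y)) :=
    Real.contDiff_cos.comp (P.phase m).contDiff
  have h2 : iteratedFDeriv ℝ 2 (fun y => c * Real.cos (P.phase m y)) x =
      c • iteratedFDeriv ℝ 2 (fun y => Real.cos (P.phase m y)) x :=
    iteratedFDeriv_const_smul_apply (a := c) h1.contDiffAt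
  have h3 : iteratedFDeriv ℝ 2 (fun y => Real.cos (P.phase m y)) x =
      (iteratedFDeriv ℝ 2 Real.cos (P.phase m x)).compContinuousLinearMap fun _ => P.phase m :=
    (P.phase m).iteratedFDeriv_comp_right (n := 2) Real.contDiff_cos x le_rfl
  have h4 : iteratedDeriv 2 Real.cos (P.phase m x) = -Real.cos (P.phase m x) := by
    simp
  have h5 : ∀ j, P.phase m (EuclideanSpace.basisFun (Fin d) ℝ j) = P.waveVec m j := fun j => by
    unfold phase
    rw [innerSL_apply_apply, EuclideanSpace.basisFun_apply, EuclideanSpace.inner_single_right]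
    simp
  rw [h2, h3, ← sum_waveVec_sq, ← Finset.sum_neg_distrib, Finset.sum_mul, Finset.sum_mul]
  refine Finset.sum_congr rfl fun j _ => ?_
  rw [_root_.smul_apply, ContinuousMultilinearMap.compContinuousLinearMap_apply,
    iteratedFDeriv_apply_eq_iteratedDeriv_mul_prod, h4, Fin.prod_univ_two]
  simp only [Matrix.cons_val_zero, Matrix.cons_val_one, h5, smul_eq_mul]
  ring

/-- Each derivative costs a factor ‖phase‖ = O(1 + |m|), so the weighted norm of order n controls
the n-th derivatives uniformly in x and justifies termwise differentiation. -/
lemma exists_summable_bound {a : P.Ell} (ha : ∀ n, P.wsum n a ≠ ⊤) :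
    ∃ v : ℕ → (Fin d → ℤ) → ℝ, (∀ n, Summable (v n)) ∧ ∀ n m x,
      ‖iteratedFDeriv ℝ n (fun y => a (absV m) * Real.cos (P.phase m y)) x‖ ≤ v n m := by
  obtain ⟨C, hC0, hC⟩ := P.exists_norm_phase_le
  refine ⟨fun n m => C ^ n * (|a (absV m)| * jap (absV m) ^ n),
    fun n => (summable_int_jap (ha n)).mul_left _, fun n m x => ?_⟩
  refine (norm_iteratedFDeriv_cos_phase_le _ m n x).trans ?_
  calc _ ≤ |a (absV m)| * (C * jap (absV m)) ^ n := by
        gcongr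
        exact hC m
    _ = _ := by ring

lemma contDiff_cosSeries {a : P.Ell} (ha : ∀ n, P.wsum n a ≠ ⊤) (n : ℕ) :
    ContDiff ℝ n (P.cosSeries a) := by
  obtain ⟨v, hv, hb⟩ := exists_summable_bound ha
  rw [show P.cosSeries a = fun x => ∑' m : Fin d → ℤ, a (absV m) * Real.cos (P.phase m x) from
    funext (cosSeries_eq_tsum_cos a)]
  exact contDiff_tsum (N := n) (fun m => contDiff_const.mul
    (Real.contDiff_cos.comp (P.phase m).contDiff)) (fun k _ => hv k) fun k m x _ => hb k m x

lemma laplacian_cosSeries {a b : P.Ell} (ha : ∀ n, P.wsum n a ≠ ⊤)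
    (hb : ∀ k, b k = -P.kLsq k * a k) :
    Laplacian.laplacian (P.cosSeries a) = P.cosSeries b := by
  obtain ⟨v, hv, hbd⟩ := exists_summable_bound ha
  rw [InnerProductSpace.laplacian_eq_iteratedFDeriv_orthonormalBasis _
    (EuclideanSpace.basisFun (Fin d) ℝ)]
  funext x
  have h1 : iteratedFDeriv ℝ 2 (P.cosSeries a) x = ∑' m : Fin d → ℤ,
      iteratedFDeriv ℝ 2 (fun y => a (absV m) * Real.cos (P.phase m y)) x := by
    rw [show P.cosSeries a = fun x => ∑' m : Fin d → ℤ, a (absV m) * Real.cos (P.phase m x) from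
      funext (cosSeries_eq_tsum_cos a)]
    exact congrFun (iteratedFDeriv_tsum (N := (2 : ℕ)) (fun m => contDiff_const.mul
      (Real.contDiff_cos.comp (P.phase m).contDiff)) (fun k _ => hv k)
      (fun k m x _ => hbd k m x) le_rfl) x
  have hs : Summable fun m : Fin d → ℤ =>
      iteratedFDeriv ℝ 2 (fun y => a (absV m) * Real.cos (P.phase m y)) x :=
    Summable.of_norm_bounded (hv 2) fun m => hbd 2 m x
  have h2 : ∀ w : Fin 2 → EuclideanSpace ℝ (Fin d), HasSum (fun m : Fin d → ℤ =>
      iteratedFDeriv ℝ 2 (fun y => a (absV m) * Real.cos (P.phase m y)) x w)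
      (iteratedFDeriv ℝ 2 (P.cosSeries a) x w) := fun w => by
    rw [h1]
    exact ContinuousMultilinearMap.hasSum_eval hs.hasSum w
  have h3 := hasSum_sum (s := Finset.univ) fun (j : Fin d) _ =>
    h2 ![EuclideanSpace.basisFun (Fin d) ℝ j, EuclideanSpace.basisFun (Fin d) ℝ j]
  rw [← h3.tsum_eq, cosSeries_eq_tsum_cos]
  refine tsum_congr fun m => ?_
  rw [laplacian_cos_phase, hb]

end PDEData
end

/-! ### Classical solutions from coefficient solutions, and the theorem -/

noncomputable section

namespace PDEData

variable {d : ℕ} {P : PDEData d}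

lemma exists_laplacian_coeff {a : P.Ell} (ha : ∀ n, P.wsum n a ≠ ⊤) :
    ∃ b : P.Ell, (∀ k, b k = -P.kLsq k * a k) ∧ ∀ n, P.wsum n b ≠ ⊤ := by
  obtain ⟨K, hK0, hK⟩ := P.exists_kLsq_le
  have h : ∀ n, P.wsum n (fun k => -P.kLsq k * a k) ≠ ⊤ := fun n =>
    ne_top_of_le_ne_top (ENNReal.mul_ne_top ENNReal.ofReal_ne_top (ha (n + 2)))
      (wsum_mul_le n hK0 fun k => by rw [abs_neg, abs_of_nonneg (P.kLsq_nonneg k)]; exact hK k)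
  exact ⟨⟨_, mem_ellSubmodule_of_wsum_ne_top (h 0)⟩, fun k => rfl, h⟩

lemma cosSeries_periodic (a : P.Ell) (x : EuclideanSpace ℝ (Fin d)) (j : Fin d) :
    P.cosSeries a (x + EuclideanSpace.single j (2 * Real.pi / P.L j)) = P.cosSeries a x := by
  unfold cosSeries
  refine tsum_congr fun k => ?_
  congr 1
  refine Finset.prod_congr rfl fun i _ => ?_
  rcases eq_or_ne i j with rfl | hij
  · have h1 : (k i : ℝ) * P.L i * (x + EuclideanSpace.single i (2 * Real.pi / P.L i)) i =
        k i * P.L i * x i + k i * (2 * Real.pi) := by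
      have := (P.L_pos i).ne'
      rw [PiLp.add_apply, PiLp.single_apply, if_pos rfl]
      field_simp
    rw [h1, Real.cos_add_nat_mul_two_pi]
  · rw [PiLp.add_apply, PiLp.single_apply, if_neg hij, add_zero]

lemma cosSeries_even (a : P.Ell) {x y : EuclideanSpace ℝ (Fin d)} (h : ∀ j, |x j| = |y j|) :
    P.cosSeries a x = P.cosSeries a y := by
  unfold cosSeries
  refine tsum_congr fun k => ?_
  congr 1
  refine Finset.prod_congr rfl fun i _ => ?_
  rcases abs_eq_abs.1 (h i) with h1 | h1
  · rw [h1]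
  · rw [h1, mul_neg, Real.cos_neg]

/-- The cosine series of a solution of the equations for the coefficients is a classical
solution. -/
theorem IsCoeffSol.isClassicalSolution {v : ℝ → P.Ell} {T : ℝ} (hv : P.IsCoeffSol v 0 T) :
    P.IsClassicalSolution (P.cosSeries (v 0)) T fun t => P.cosSeries (v t) := by
  obtain ⟨-, z, -, -, -, hz, hd⟩ := hv.exists_deriv
  refine ⟨?_, rfl, fun t _ x j => cosSeries_periodic _ x j, fun t _ x y h => cosSeries_even _ h,
    fun t ht => ?_, fun t ht x => ?_⟩
  · refine continuous_cosSeries.comp_continuousOn (f := fun p : ℝ × EuclideanSpace ℝ (Fin d) =>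
      (v p.1, p.2)) ?_
    exact (hv.cont.comp continuousOn_fst fun p hp => hp.1).prodMk continuousOn_snd
  · split_ifs
    · exact contDiff_cosSeries (fun n => hv.wsum_ne_top n ht) 2
    · exact contDiff_cosSeries (fun n => hv.wsum_ne_top n ht) 4
  · obtain ⟨b, hb, hbw⟩ := exists_laplacian_coeff fun n => hv.wsum_ne_top n ht
    -- b, c and e are the coefficients of Δu, Δ²u and ΔN(u); finiteness of all weighted norms is
    -- inherited by b, so the Laplacian can be applied again.
    obtain ⟨c, hc, -⟩ := exists_laplacian_coeff hbw
    obtain ⟨e, he, -⟩ := exists_laplacian_coeff fun n => hv.wsum_nonlin_ne_top n ht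
    have hN : (fun y => P.N.eval (P.cosSeries (v t) y)) = P.cosSeries (P.nonlin (v t)) :=
      funext fun y => (cosSeries_nonlin _ y).symm
    have h1 : HasDerivWithinAt (fun s => P.cosSeries (v s) x) (P.cosSeries (z t) x) (Icc 0 T) t :=
      (P.cosL x).hasFDerivAt.comp_hasDerivWithinAt t (hd t ht)
    refine h1.congr_deriv ?_
    rw [laplacian_cosSeries (fun n => hv.wsum_ne_top n ht) hb, laplacian_cosSeries hbw hc, hN]
    simp only [← cosL_apply]
    obtain hp | hp : P.p = 0 ∨ P.p = 1 := by have := P.p_le; omega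
    · have h2 : z t = P.lam0 • v t + P.lam1 • b + P.lam2 • c + P.nonlin (v t) :=
        Ell.ext fun k => by
          simp only [Ell.add_apply, Ell.smul_apply]
          rw [hz t ht, hc, hb, mu, qsym, hp]
          ring
      rw [h2, hp, Function.iterate_zero, id_eq]
      simp only [map_add, map_smul, smul_eq_mul, cosL_apply]
    · have h2 : z t = P.lam0 • v t + P.lam1 • b + P.lam2 • c + e :=
        Ell.ext fun k => by
          simp only [Ell.add_apply, Ell.smul_apply]
          rw [hz t ht, hc, hb, he, mu, qsym, hp]
          ring
      rw [h2, hp, Function.iterate_one]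
      have h3 := laplacian_cosSeries (fun n => hv.wsum_nonlin_ne_top n ht) he
      simp only [map_add, map_smul, smul_eq_mul, cosL_apply]
      rw [h3]

end PDEData
end

/-- Local existence over multiple time steps. -/
theorem theorem4p2 {d : ℕ} (hd1 : 1 ≤ d) (hd3 : d ≤ 3) (P : PDEData d)
    -- the time steps `0 = t 0 < t 1 < ⋯ < t K`
    (K : ℕ) (hK : 1 ≤ K) (t : Fin (K + 1) → ℝ) (ht0 : t 0 = 0) (ht : StrictMono t)
    -- initial datum and approximate solution
    (phi : P.Ell) (abar : P.StepSpace t) (habar : ∀ i, PDEData.InDomain (abar i))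
    -- bounds of the evolution operators
    (gam : ℝ) (hgam0 : 0 ≤ gam) (hgam1 : gam < 1) (WS WSq WE WEq WT : Fin K → ℝ)
    (hW : PDEData.EvolutionBounds abar gam WS WSq WE WEq WT)
    -- defect bounds
    (delta eps : Fin K → ℝ)
    (hdelta : ∀ i, ∀ r ∈ Set.Ioo (t i.castSucc) (t i.succ),
      PDEData.F1 abar i r ∈ P.ellSubmodule ∧ P.normOmega (PDEData.F1 abar i r) ≤ delta i)
    (heps : ∀ i, ‖PDEData.F2 phi abar i‖ ≤ eps i)
    -- local Lipschitz bounds of the nonlinearity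
    (Lip : Fin K → ℝ → ℝ) (hLpos : ∀ i rho, 0 < rho → 0 < Lip i rho)
    (hLmono : ∀ i, MonotoneOn (Lip i) (Set.Ioi 0))
    (hL : ∀ i rho, 0 < rho → ∀ a1 a2 : C(Set.Icc (t i.castSucc) (t i.succ), P.Ell),
      ‖a1 - abar i‖ ≤ rho → ‖a2 - abar i‖ ≤ rho →
      ∀ r, ‖P.nonlin (a1 r) - P.nonlin (a2 r) - P.Dnonlin (abar i r) (a1 r - a2 r)‖
        ≤ Lip i rho * ‖a1 - a2‖)
    -- the radius
    (rho0 : ℝ) (hrho0 : 0 < rho0)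
    (hp : PDEData.Wl WS WT * (⨆ i, eps i)
        + PDEData.WX t gam WS WSq WEq WT * (⨆ i, Lip i rho0) * rho0
        + PDEData.WY t WS WE WT * (⨆ i, delta i) ≤ rho0) :
    (∃! a : P.StepSpace t, ‖a - abar‖ ≤ rho0 ∧ PDEData.IsZeroOfF phi a) ∧
    (∀ a : P.StepSpace t, ‖a - abar‖ ≤ rho0 → PDEData.IsZeroOfF phi a →
      ∃ u : ℝ → EuclideanSpace ℝ (Fin d) → ℝ,
        P.IsClassicalSolution (P.cosSeries phi) (t (Fin.last K)) u ∧
        ∀ i, ∀ r : Set.Icc (t i.castSucc) (t i.succ), u r = P.cosSeries (a i r)) := by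
  have : Nonempty (Fin K) := ⟨⟨0, hK⟩⟩
  have hb : ∀ f : Fin K → ℝ, ∀ i, f i ≤ ⨆ i, f i := fun f i =>
    le_ciSup (Set.finite_range f).bddAbove i
  refine ⟨?_, fun a _ ha => ?_⟩
  -- The maximum of the Lipschitz constants at ρ₀ serves all steps at once, and the defect bounds
  -- are likewise weakened to their maxima.
  · have hΛ : 0 ≤ ⨆ i, Lip i rho0 :=
      (hLpos ⟨0, hK⟩ rho0 hrho0).le.trans (hb (fun i => Lip i rho0) _)
    refine PDEData.existsUnique_isZeroOfF ht habar hgam1 hW hΛ hrho0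
      (fun i r hr => ⟨(hdelta i r hr).1, (hdelta i r hr).2.trans (hb delta i)⟩)
      (fun i => (heps i).trans (hb eps i)) (fun i a1 a2 h1 h2 r => ?_) hp
    exact (hL i rho0 hrho0 a1 a2 h1 h2 r).trans
      (mul_le_mul_of_nonneg_right (hb (fun i => Lip i rho0) i) (norm_nonneg _))
  · obtain ⟨v, hv, hv0, hva⟩ := ha.exists_isCoeffSol ht
    rw [ht0] at hv hv0
    refine ⟨fun s => P.cosSeries (v s), hv0 ▸ hv.isClassicalSolution, fun i r => ?_⟩
    change P.cosSeries (v r) = _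
    rw [hva i r.2, PDEData.extZero_apply r.2]
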